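/- **Conventions.** Rings are associative and unital. Let $\mathcal C$ be an additive bicategory: the sets of 2-morphisms are abelian groups, vertical composition $\circ$ and horizontal composition $\times$ are biadditive, and every category of 1-morphisms between two given objects has finite direct sums (in particular a zero object). Let $\iota$ be a Frobenius 1-morphism of $\mathcal C$, that is, a 1-morphism with a two-sided dual $\bar\iota$, given by 2-morphisms $\mathrm{ev}_L:\bar\iota\times\iota\to 1$, $\mathrm{coev}_L:1\to\iota\times\bar\iota$, $\mathrm{ev}_R:\iota\times\bar\iota\to 1$, $\mathrm{coev}_R:1\to\bar\iota\times\iota$ such that $(\mathrm{ev}_L,\mathrm{coev}_L)$ and $(\mathrm{ev}_R,\mathrm{coev}_R)$ each satisfy the two triangle identities. Assume that $\iota$ has depth 2: $(\iota\times\bar\iota)\times\iota$ is a direct summand (retract) of a finite direct sum of copies of $\iota$, and $(\bar\iota\times\iota)\times\bar\iota$ is one of a finite direct sum of copies of $\bar\iota$. Put $L=\mathrm{End}(\iota)$, $R=\mathrm{End}(\bar\iota)$, $A=\mathrm{End}(\iota\times\bar\iota)$, $B=\mathrm{End}(\bar\iota\times\iota)$, rings under $\circ$. Coherence isomorphisms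 are suppressed, and $\iota$, $\bar\iota$ also denote identity 2-morphisms. **Hopf algebroids.** A *left bialgebroid* $(A,L,s_L,t_L,\gamma_L,\pi_L)$ consists of rings $A$, $L$, ring homomorphisms $s_L:L\to A$, $t_L:L^{op}\to A$ with commuting images, and maps $\gamma_L:A\to A_L\otimes{}_LA$, $a\mapsto a_{(1)}\otimes a_{(2)}$, and $\pi_L:A\to L$ that make $A$, with $l\cdot a\cdot l'=s_L(l)t_L(l')a$, a comonoid in $L$-$L$-bimodules, such that $a_{(1)}t_L(l)\otimes a_{(2)}=a_{(1)}\otimes a_{(2)}s_L(l)$, $\gamma_L(1)=1\otimes1$, $\gamma_L(ab)=\gamma_L(a)\gamma_L(b)$, $\pi_L(1)=1$, $\pi_L(a\,s_L\pi_L(b))=\pi_L(ab)=\pi_L(a\,t_L\pi_L(b))$. A *right bialgebroid* $(A,R,s_R,t_R,\gamma_R,\pi_R)$ is the mirror notion: $r\cdot a\cdot r'=a\,s_R(r')t_R(r)$, $\gamma_R(a)=a^{(1)}\otimes a^{(2)}\in A^R\otimes{}^RA$, $s_R(r)a^{(1)}\otimes a^{(2)}=a^{(1)}\otimes t_R(r)a^{(2)}$,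 $\gamma_R(1)=1\otimes1$, $\gamma_R(ab)=\gamma_R(a)\gamma_R(b)$, $\pi_R(1)=1$, $\pi_R(s_R\pi_R(a)b)=\pi_R(ab)=\pi_R(t_R\pi_R(a)b)$. A *Hopf algebroid* consists of a left bialgebroid over $L$ and a right bialgebroid over $R\simeq L^{op}$ on the same ring $A$ and an additive bijection $S:A\to A$ with $s_L(L)=t_R(R)$, $t_L(L)=s_R(R)$, $(\gamma_L\otimes\mathrm{id})\gamma_R=(\mathrm{id}\otimes\gamma_R)\gamma_L$, $(\gamma_R\otimes\mathrm{id})\gamma_L=(\mathrm{id}\otimes\gamma_L)\gamma_R$, $S(t_L(l)a\,t_L(l'))=s_L(l')S(a)s_L(l)$, $S(t_R(r')a\,t_R(r))=s_R(r)S(a)s_R(r')$, $S(a_{(1)})a_{(2)}=s_R\pi_R(a)$, $a^{(1)}S(a^{(2)})=s_L\pi_L(a)$. A *strict isomorphism* $(\Phi,\phi)$ of Hopf algebroids is a pair of bijective ring homomorphisms of the total rings and of the left base rings that commute with the maps $s_L,t_L,\pi_L,\gamma_L$ and satisfy $\Phi\circ S=S'\circ\Phi$. The *dual* $\mathcal A^*$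 of a right bialgebroid is the ring of additive maps $\phi:A\to R$ with $\phi(a\,s_R(r))=\phi(a)r$, with product $(\phi\psi)(a)=\phi(a^{(2)}t_R(\psi(a^{(1)})))$ and unit $\pi_R$; put $\phi\rightharpoonup a=a^{(2)}t_R(\phi(a^{(1)}))$ and $(\phi\leftharpoonup a)(b)=\phi(ab)$. A *two-sided non-degenerate integral* $i\in A$ satisfies $ai=s_L\pi_L(a)i$ and $ia=i\,s_R\pi_R(a)$ for all $a\in A$, and the map $i_R:\mathcal A^*\to A$, $\phi\mapsto\phi\rightharpoonup i$, as well as the map $\phi\mapsto i^{(1)}s_R(\phi(i^{(2)}))$, defined on the additive maps $\phi:A\to R$ with $\phi(a\,t_R(r))=r\phi(a)$, are bijective onto $A$. For such $i$ let $\mathcal A^*_i$ denote the ring $\mathcal A^*$ with the following structure maps (left base $R$, right base $L$), where $\lambda^*=i_R^{-1}(1)$: $$s_L^*(r)(a)=r\,\pi_R(a),\quad t_L^*(r)(a)=\pi_R(s_R(r)a),\quad \gamma_L^*(\phi)=\phi\leftharpoonup i^{(1)}\otimes i_R^{-1}(i^{(2)}),\quad \pi_L^*(\phi)=\phi(1),$$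 $$s_R^*(l)(a)=\pi_R(s_L(l)a),\quad t_R^*(l)(a)=\lambda^*(S(i\,t_L(l))a),\quad \gamma_R^*(\phi)=\phi\leftharpoonup S^2(i^{(2)})\otimes i_R^{-1}(i^{(1)}),\quad \pi_R^*(\phi)=\pi_L s_R\big((\lambda^*\phi)(i)\big),$$ $$S^*=i_R^{-1}\circ S\circ i_R.$$ **The structures on $A$ and $B$.** Put $$a_1\ast a_2=(\iota\times\mathrm{ev}_L\times\bar\iota)\circ(a_1\times a_2)\circ(\iota\times\mathrm{coev}_R\times\bar\iota),\qquad b_1\ast b_2=(\bar\iota\times\mathrm{ev}_R\times\iota)\circ(b_1\times b_2)\circ(\bar\iota\times\mathrm{coev}_L\times\iota),$$ $$\mathcal F(a)=(\bar\iota\times\iota\times\mathrm{ev}_L)\circ(\bar\iota\times a\times\iota)\circ(\mathrm{coev}_R\times\bar\iota\times\iota),\qquad \dot{\mathcal F}(a)=(\mathrm{ev}_L\times\bar\iota\times\iota)\circ(\bar\iota\times a\times\iota)\circ(\bar\iota\times\iota\times\mathrm{coev}_R),$$ which are bijections $A\to B$ with inverses $\mathcal F^{-1}(b)=(\mathrm{ev}_R\times\iota\times\bar\iota)\circ(\iota\times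 b\times\bar\iota)\circ(\iota\times\bar\iota\times\mathrm{coev}_L)$ and $\dot{\mathcal F}^{-1}(b)=(\iota\times\bar\iota\times\mathrm{ev}_R)\circ(\iota\times b\times\bar\iota)\circ(\mathrm{coev}_L\times\iota\times\bar\iota)$. Let $S_A=\dot{\mathcal F}^{-1}\circ\mathcal F$, $S_B=\mathcal F\circ\dot{\mathcal F}^{-1}$, $i_A=\mathrm{coev}_L\circ\mathrm{ev}_R$, and for $l\in L$, $a\in A$ $$\mu(l)=(\mathrm{ev}_L\times\bar\iota)\circ(\bar\iota\times l\times\bar\iota)\circ(\bar\iota\times\mathrm{coev}_L),\qquad \nu(l)=(\bar\iota\times\mathrm{ev}_R)\circ(\bar\iota\times l\times\bar\iota)\circ(\mathrm{coev}_R\times\bar\iota),$$ $$\varphi_L(a)=(\iota\times\mathrm{ev}_L)\circ(a\times\iota)\circ(\iota\times\mathrm{coev}_R)\in L,$$ where $\nu:L\to R^{op}$ is bijective. A *D2 quasi-basis* is a finite family $(y_j,x_j)$ in $A$ with $\sum_j(y_j\times\iota)\circ(\iota\times\mathrm{coev}_R)\circ(\iota\times\mathrm{ev}_L)\circ(x_j\times\iota)=\mathrm{id}_{(\iota\times\bar\iota)\times\iota}$.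 Let $\mathcal A$ be the ring $A$ with antipode $S_A$ and $$s_L(l)=l\times\bar\iota,\quad t_L(l)=\iota\times\mu(l),\quad \gamma_L(a)=\sum_j a\ast S_A^{-1}(y_j)\otimes x_j=\sum_j S_A^{-1}(y_j)\otimes x_j\ast a,\quad \pi_L(a)=\varphi_L(a\circ i_A),$$ $$s_R(r)=\iota\times r,\quad t_R(r)=\nu^{-1}(r)\times\bar\iota,\quad \gamma_R(a)=\sum_j a\ast S_A(x_j)\otimes y_j=\sum_j S_A(x_j)\otimes y_j\ast a,\quad \pi_R(a)=\nu\varphi_L(S_A^{-1}(a)\circ i_A),$$ and let $\mathcal B$ be the ring $B$ (left base $R$, right base $L$) with antipode $S_B$ and $$s_L(r)=r\times\iota,\quad t_L(r)=\bar\iota\times\nu^{-1}(r),\quad \gamma_L(b)=\sum_j b\ast\mathcal F(x_j)\otimes\mathcal F(y_j)=\sum_j\mathcal F(x_j)\otimes\mathcal F(y_j)\ast b,\quad \pi_L(b)=\nu\varphi_L\mathcal F^{-1}(b),$$ $$s_R(l)=\bar\iota\times l,\quad t_R(l)=\mu(l)\times\iota,\quad \gamma_R(b)=\sum_j b\ast\dot{\mathcal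 F}(y_j)\otimes\dot{\mathcal F}(x_j)=\sum_j\dot{\mathcal F}(y_j)\otimes\dot{\mathcal F}(x_j)\ast b,\quad \pi_R(b)=\varphi_L\dot{\mathcal F}^{-1}(b).$$ **Theorem.** A D2 quasi-basis exists. For every choice of it, $\mathcal A$ and $\mathcal B$ are Hopf algebroids, which do not depend on the choice. The element $i_A$ is a two-sided non-degenerate integral in $\mathcal A$, and $\mathcal A^*_{i_A}$ is a well-defined Hopf algebroid. The map $$\alpha^*:B\to\mathcal A^*,\qquad \alpha^*(b)(a)=\nu\,\varphi_L\big(S_A^{-1}(a)\circ\mathcal F^{-1}(b)\big),$$ is a ring isomorphism, and $(\alpha^*,\mathrm{id}_R)$ is a strict isomorphism of Hopf algebroids from $\mathcal B$ to $\mathcal A^*_{i_A}$. -/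

import Mathlib

open CategoryTheory CategoryTheory.Bicategory CategoryTheory.Limits
open scoped TensorProduct

/-! ## Tensor products over a noncommutative ring -/

section Balanced

variable {J J' K M N P M' N' : Type*}
  [AddCommGroup M] [AddCommGroup N] [AddCommGroup P] [AddCommGroup M'] [AddCommGroup N']

/-- The tensor product of a right module `M` (action `m · j = ρ j m`) and a left module `N`
(action `j · n = κ j n`): the quotient of the tensor product of abelian groups `M ⊗ N` by the
subgroup generated by the elements `(m · j) ⊗ n - m ⊗ (j · n)`. -/
def BalTensor (ρ : J → M →+ M) (κ : J → N →+ N) : Type _ :=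
  (M ⊗[ℤ] N) ⧸ AddSubgroup.closure
    {z : M ⊗[ℤ] N | ∃ (j : J) (m : M) (n : N), z = ρ j m ⊗ₜ[ℤ] n - m ⊗ₜ[ℤ] κ j n}

namespace BalTensor

noncomputable instance (ρ : J → M →+ M) (κ : J → N →+ N) : AddCommGroup (BalTensor ρ κ) :=
  inferInstanceAs (AddCommGroup ((M ⊗[ℤ] N) ⧸ AddSubgroup.closure
    {z : M ⊗[ℤ] N | ∃ (j : J) (m : M) (n : N), z = ρ j m ⊗ₜ[ℤ] n - m ⊗ₜ[ℤ] κ j n}))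

/-- The canonical projection from the tensor product of abelian groups. -/
noncomputable def mk (ρ : J → M →+ M) (κ : J → N →+ N) : M ⊗[ℤ] N →+ BalTensor ρ κ :=
  QuotientAddGroup.mk' _

/-- The class of an elementary tensor. -/
noncomputable def tmul (ρ : J → M →+ M) (κ : J → N →+ N) (m : M) (n : N) : BalTensor ρ κ :=
  mk ρ κ (m ⊗ₜ[ℤ] n)

variable {ρ : J → M →+ M} {κ : J → N →+ N} {ρ' : J → M' →+ M'} {κ' : J → N' →+ N'}

theorem balanced (j : J) (m : M) (n : N) : tmul ρ κ (ρ j m) n = tmul ρ κ m (κ j n) := by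
  have h : mk ρ κ (ρ j m ⊗ₜ[ℤ] n - m ⊗ₜ[ℤ] κ j n) = 0 :=
    (QuotientAddGroup.eq_zero_iff _).2 (AddSubgroup.subset_closure ⟨j, m, n, rfl⟩)
  rw [map_sub, sub_eq_zero] at h
  exact h

theorem tmul_add (m : M) (n n' : N) :
    tmul ρ κ m (n + n') = tmul ρ κ m n + tmul ρ κ m n' := by
  simp only [tmul, TensorProduct.tmul_add, map_add]

theorem add_tmul (m m' : M) (n : N) :
    tmul ρ κ (m + m') n = tmul ρ κ m n + tmul ρ κ m' n := by
  simp only [tmul, TensorProduct.add_tmul, map_add]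

theorem exists_sum (z : BalTensor ρ κ) :
    ∃ (n : ℕ) (u : Fin n → M) (v : Fin n → N), z = ∑ i, tmul ρ κ (u i) (v i) := by
  obtain ⟨w, rfl⟩ := QuotientAddGroup.mk'_surjective _ z
  change ∃ (n : ℕ) (u : Fin n → M) (v : Fin n → N), mk ρ κ w = _
  induction w using TensorProduct.induction_on with
  | zero => exact ⟨0, Fin.elim0, Fin.elim0, by simp⟩
  | tmul m n => exact ⟨1, fun _ => m, fun _ => n, by simp [tmul]⟩
  | add x y hx hy =>
    obtain ⟨n, u, v, h⟩ := hx
    obtain ⟨n', u', v', h'⟩ := hy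
    refine ⟨n + n', Fin.append u u', Fin.append v v', ?_⟩
    rw [map_add, h, h', Fin.sum_univ_add]
    simp

/-- Two additive maps that agree on elementary tensors are equal. -/
theorem hom_ext {f g : BalTensor ρ κ →+ P}
    (h : ∀ m n, f (tmul ρ κ m n) = g (tmul ρ κ m n)) : f = g := by
  ext z
  obtain ⟨n, u, v, rfl⟩ := exists_sum z
  simp only [map_sum, h]

/-- The universal property: a balanced biadditive map factors through the tensor product. -/
noncomputable def lift (f : M →+ N →+ P) (h : ∀ j m n, f (ρ j m) n = f m (κ j n)) :
    BalTensor ρ κ →+ P :=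
  QuotientAddGroup.lift _
    (TensorProduct.liftAddHom f fun r m n => by simp)
    (by
      rw [AddSubgroup.closure_le]
      rintro _ ⟨j, m, n, rfl⟩
      simp [AddMonoidHom.mem_ker, h])

@[simp]
theorem lift_tmul (f : M →+ N →+ P) (h : ∀ j m n, f (ρ j m) n = f m (κ j n)) (m : M) (n : N) :
    lift f h (tmul ρ κ m n) = f m n := rfl

/-- `tmul` as a biadditive map. -/
noncomputable def tmulHom (ρ : J → M →+ M) (κ : J → N →+ N) : M →+ N →+ BalTensor ρ κ :=
  AddMonoidHom.mk' (fun m => AddMonoidHom.mk' (fun n => tmul ρ κ m n) (tmul_add m))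
    (fun m m' => by ext n; exact add_tmul m m' n)

@[simp]
theorem tmulHom_apply (m : M) (n : N) : tmulHom ρ κ m n = tmul ρ κ m n := rfl

/-- The tensor product `f ⊗ g` of two module maps. -/
noncomputable def map (f : M →+ M') (g : N →+ N') (hf : ∀ j m, f (ρ j m) = ρ' j (f m))
    (hg : ∀ j n, g (κ j n) = κ' j (g n)) : BalTensor ρ κ →+ BalTensor ρ' κ' :=
  lift (((tmulHom ρ' κ').comp f).compl₂ g) (fun j m n => by
    change tmul ρ' κ' (f (ρ j m)) (g n) = tmul ρ' κ' (f m) (g (κ j n))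
    rw [hf, hg, balanced])

@[simp]
theorem map_tmul (f : M →+ M') (g : N →+ N') (hf : ∀ j m, f (ρ j m) = ρ' j (f m))
    (hg : ∀ j n, g (κ j n) = κ' j (g n)) (m : M) (n : N) :
    map f g hf hg (tmul ρ κ m n) = tmul ρ' κ' (f m) (g n) := rfl

/-- `f ⊗ id`. -/
noncomputable def mapL (f : M →+ M') (hf : ∀ j m, f (ρ j m) = ρ' j (f m)) :
    BalTensor ρ κ →+ BalTensor ρ' κ :=
  map f (AddMonoidHom.id N) hf (fun _ _ => rfl)

/-- `id ⊗ g`. -/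
noncomputable def mapR (g : N →+ N') (hg : ∀ j n, g (κ j n) = κ' j (g n)) :
    BalTensor ρ κ →+ BalTensor ρ κ' :=
  map (AddMonoidHom.id M) g (fun _ _ => rfl) hg

@[simp]
theorem mapL_tmul (f : M →+ M') (hf : ∀ j m, f (ρ j m) = ρ' j (f m)) (m : M) (n : N) :
    mapL (κ := κ) f hf (tmul ρ κ m n) = tmul ρ' κ (f m) n := rfl

@[simp]
theorem mapR_tmul (g : N →+ N') (hg : ∀ j n, g (κ j n) = κ' j (g n)) (m : M) (n : N) :
    mapR (ρ := ρ) g hg (tmul ρ κ m n) = tmul ρ κ' m (g n) := rfl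

/-- The tensor product `f ⊗ g` of two maps that are linear over a map `e` of the base rings. -/
noncomputable def mapBase {ρ₁ : J' → M' →+ M'} {κ₁ : J' → N' →+ N'} (e : J → J')
    (f : M →+ M') (g : N →+ N') (hf : ∀ j m, f (ρ j m) = ρ₁ (e j) (f m))
    (hg : ∀ j n, g (κ j n) = κ₁ (e j) (g n)) : BalTensor ρ κ →+ BalTensor ρ₁ κ₁ :=
  lift (((tmulHom ρ₁ κ₁).comp f).compl₂ g) (fun j m n => by
    change tmul ρ₁ κ₁ (f (ρ j m)) (g n) = tmul ρ₁ κ₁ (f m) (g (κ j n))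
    rw [hf, hg, balanced])

/-- The associativity map `(M ⊗ N) ⊗ P → M ⊗ (N ⊗ P)`, where the first tensor product is over
`J` and the second one over `K`, and the two actions on `N` commute. -/
noncomputable def assoc (ρ : J → M →+ M) (κ : J → N →+ N) (σ : K → N →+ N) (τ : K → P →+ P)
    (h : ∀ j k n, σ k (κ j n) = κ j (σ k n)) :
    BalTensor (fun k => mapR (ρ := ρ) (κ := κ) (κ' := κ) (σ k) (fun j n => h j k n)) τ →+
      BalTensor ρ (fun j => mapL (κ := τ) (ρ := σ) (ρ' := σ) (κ j) (fun k n => (h j k n).symm)) :=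
  lift
    (lift ((AddMonoidHom.compHom.comp (tmulHom ρ (fun j => mapL (κ := τ) (ρ := σ) (ρ' := σ) (κ j)
        (fun k n => (h j k n).symm)))).compl₂ (tmulHom σ τ))
      (fun j m n => by
        ext p
        simp only [AddMonoidHom.compl₂_apply, AddMonoidHom.comp_apply,
          AddMonoidHom.compHom_apply_apply, tmulHom_apply, balanced, mapL_tmul]))
    (fun k z p => by
      obtain ⟨n, u, v, rfl⟩ := exists_sum z
      simp only [map_sum, AddMonoidHom.finsetSum_apply, mapR_tmul, lift_tmul,
        AddMonoidHom.compl₂_apply, AddMonoidHom.comp_apply,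
        AddMonoidHom.compHom_apply_apply, tmulHom_apply, balanced])

@[simp]
theorem assoc_tmul (ρ : J → M →+ M) (κ : J → N →+ N) (σ : K → N →+ N) (τ : K → P →+ P)
    (h : ∀ j k n, σ k (κ j n) = κ j (σ k n)) (m : M) (n : N) (p : P) :
    assoc ρ κ σ τ h (tmul _ τ (tmul ρ κ m n) p) = tmul ρ _ m (tmul σ τ n p) := rfl

end BalTensor

end Balanced

/-! ## Bialgebroids -/

/-- Source and target maps: ring homomorphisms `s : L → A` and `t : Lᵒᵖ → A` whose images
commute. -/
structure SourceTarget (A L : Type*) [Ring A] [Ring L] where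
  s : L →+* A
  t : Lᵐᵒᵖ →+* A
  comm : ∀ l l' : L, s l * t (.op l') = t (.op l') * s l

namespace SourceTarget

variable {A L : Type*} [Ring A] [Ring L] (D : SourceTarget A L)

/-- `a ↦ s(l) a` -/
def sLeft (l : L) : A →+ A := AddMonoidHom.mulLeft (D.s l)
/-- `a ↦ t(l) a` -/
def tLeft (l : L) : A →+ A := AddMonoidHom.mulLeft (D.t (.op l))
/-- `a ↦ a s(l)` -/
def sRight (l : L) : A →+ A := AddMonoidHom.mulRight (D.s l)
/-- `a ↦ a t(l)` -/
def tRight (l : L) : A →+ A := AddMonoidHom.mulRight (D.t (.op l))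

@[simp] theorem sLeft_apply (l : L) (a : A) : D.sLeft l a = D.s l * a := rfl
@[simp] theorem tLeft_apply (l : L) (a : A) : D.tLeft l a = D.t (.op l) * a := rfl
@[simp] theorem sRight_apply (l : L) (a : A) : D.sRight l a = a * D.s l := rfl
@[simp] theorem tRight_apply (l : L) (a : A) : D.tRight l a = a * D.t (.op l) := rfl

/-- `A_L ⊗ _L A`, where `l · a · l' = s(l) t(l') a`: the tensor product in which
`t(l) a ⊗ b = a ⊗ s(l) b`. -/
abbrev LeftTensor : Type _ := BalTensor D.tLeft D.sLeft

/-- `A^L ⊗ ^L A`, where `l · a · l' = a s(l') t(l)`: the tensor product in which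
`a s(l) ⊗ b = a ⊗ b t(l)`. -/
abbrev RightTensor : Type _ := BalTensor D.sRight D.tRight

theorem sLeft_tLeft (l l' : L) (a : A) : D.sLeft l (D.tLeft l' a) = D.tLeft l' (D.sLeft l a) := by
  simp [sLeft, tLeft, ← mul_assoc, D.comm]

theorem sRight_tRight (l l' : L) (a : A) :
    D.sRight l (D.tRight l' a) = D.tRight l' (D.sRight l a) := by
  simp [sRight, tRight, mul_assoc, D.comm]

theorem sLeft_mulRight (l : L) (c a : A) :
    AddMonoidHom.mulRight c (D.sLeft l a) = D.sLeft l (AddMonoidHom.mulRight c a) := by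
  simp [sLeft, mul_assoc]

theorem tLeft_mulRight (l : L) (c a : A) :
    AddMonoidHom.mulRight c (D.tLeft l a) = D.tLeft l (AddMonoidHom.mulRight c a) := by
  simp [tLeft, mul_assoc]

theorem sRight_mulLeft (l : L) (c a : A) :
    AddMonoidHom.mulLeft c (D.sRight l a) = D.sRight l (AddMonoidHom.mulLeft c a) := by
  simp [sRight, mul_assoc]

theorem tRight_mulLeft (l : L) (c a : A) :
    AddMonoidHom.mulLeft c (D.tRight l a) = D.tRight l (AddMonoidHom.mulLeft c a) := by
  simp [tRight, mul_assoc]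

/-- Right multiplication by `c ⊗ d` on `A_L ⊗ _L A`: `a ⊗ b ↦ a c ⊗ b d`. -/
noncomputable def leftTensorMul (c d : A) : D.LeftTensor →+ D.LeftTensor :=
  BalTensor.map (AddMonoidHom.mulRight c) (AddMonoidHom.mulRight d)
    (fun l a => D.tLeft_mulRight l c a) (fun l a => D.sLeft_mulRight l d a)

/-- Left multiplication by `c ⊗ d` on `A^L ⊗ ^L A`: `a ⊗ b ↦ c a ⊗ d b`. -/
noncomputable def rightTensorMul (c d : A) : D.RightTensor →+ D.RightTensor :=
  BalTensor.map (AddMonoidHom.mulLeft c) (AddMonoidHom.mulLeft d)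
    (fun l a => D.sRight_mulLeft l c a) (fun l a => D.tRight_mulLeft l d a)

@[simp]
theorem leftTensorMul_tmul (c d a b : A) :
    D.leftTensorMul c d (BalTensor.tmul _ _ a b) = BalTensor.tmul _ _ (a * c) (b * d) := rfl

@[simp]
theorem rightTensorMul_tmul (c d a b : A) :
    D.rightTensorMul c d (BalTensor.tmul _ _ a b) = BalTensor.tmul _ _ (c * a) (d * b) := rfl

end SourceTarget

/-- A left bialgebroid with total ring `A` and base ring `L`. The bimodule structure is
`l · a · l' = s(l) t(l') a`. -/
structure LeftBialgebroid (A L : Type*) [Ring A] [Ring L] extends SourceTarget A L where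
  /-- the coproduct `a ↦ a₍₁₎ ⊗ a₍₂₎` -/
  γ : A →+ toSourceTarget.LeftTensor
  /-- the counit -/
  π : A →+ L
  /-- `γ` is a left `L`-module map: `γ(s(l) a) = s(l) a₍₁₎ ⊗ a₍₂₎`. -/
  γ_s_mul : ∀ l a, γ (toSourceTarget.sLeft l a) =
    BalTensor.mapL (toSourceTarget.sLeft l) (fun l' a' => toSourceTarget.sLeft_tLeft l l' a') (γ a)
  /-- `γ` is a right `L`-module map: `γ(t(l) a) = a₍₁₎ ⊗ t(l) a₍₂₎`. -/
  γ_t_mul : ∀ l a, γ (toSourceTarget.tLeft l a) =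
    BalTensor.mapR (toSourceTarget.tLeft l)
      (fun l' a' => (toSourceTarget.sLeft_tLeft l' l a').symm) (γ a)
  π_s_mul : ∀ l a, π (s l * a) = l * π a
  π_t_mul : ∀ l a, π (t (.op l) * a) = π a * l
  coassoc : ∀ a,
    BalTensor.assoc toSourceTarget.tLeft toSourceTarget.sLeft
        toSourceTarget.tLeft toSourceTarget.sLeft
        (fun l k a' => (toSourceTarget.sLeft_tLeft l k a').symm)
      (BalTensor.mapL γ (fun l a' => γ_t_mul l a') (γ a)) =
    BalTensor.mapR γ (fun l a' => γ_s_mul l a') (γ a)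
  /-- `s(π(a₍₁₎)) a₍₂₎ = a` -/
  counit_left : ∀ a,
    BalTensor.lift (AddMonoidHom.mul.comp (s.toAddMonoidHom.comp π))
      (fun l a' b' => by
        change s (π (t (.op l) * a')) * b' = s (π a') * (s l * b')
        rw [π_t_mul, map_mul, mul_assoc]) (γ a) = a
  /-- `t(π(a₍₂₎)) a₍₁₎ = a` -/
  counit_right : ∀ a,
    BalTensor.lift
      (AddMonoidHom.mul.comp ((t.toAddMonoidHom.comp MulOpposite.opAddEquiv.toAddMonoidHom).comp
        π)).flip
      (fun l a' b' => by
        change t (.op (π b')) * (t (.op l) * a') = t (.op (π (s l * b'))) * a'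
        rw [π_s_mul, MulOpposite.op_mul, map_mul, mul_assoc]) (γ a) = a
  /-- `a₍₁₎ t(l) ⊗ a₍₂₎ = a₍₁₎ ⊗ a₍₂₎ s(l)` -/
  cross : ∀ a l, toSourceTarget.leftTensorMul (t (.op l)) 1 (γ a) =
    toSourceTarget.leftTensorMul 1 (s l) (γ a)
  γ_one : γ 1 = BalTensor.tmul _ _ 1 1
  /-- `γ(a b) = γ(a) γ(b)`, where `γ(b)` may be represented by any sum `∑ᵢ cᵢ ⊗ dᵢ`. -/
  γ_mul : ∀ (a b : A) (n : ℕ) (c d : Fin n → A), γ b = ∑ i, BalTensor.tmul _ _ (c i) (d i) →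
    γ (a * b) = ∑ i, toSourceTarget.leftTensorMul (c i) (d i) (γ a)
  π_one : π 1 = 1
  π_mul_s : ∀ a b, π (a * s (π b)) = π (a * b)
  π_mul_t : ∀ a b, π (a * t (.op (π b))) = π (a * b)

/-- A right bialgebroid with total ring `A` and base ring `R`. The bimodule structure is
`r · a · r' = a s(r') t(r)`. -/
structure RightBialgebroid (A R : Type*) [Ring A] [Ring R] extends SourceTarget A R where
  /-- the coproduct `a ↦ a⁽¹⁾ ⊗ a⁽²⁾` -/
  γ : A →+ toSourceTarget.RightTensor
  /-- the counit -/
  π : A →+ R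
  /-- `γ` is a right `R`-module map: `γ(a s(r)) = a⁽¹⁾ ⊗ a⁽²⁾ s(r)`. -/
  γ_mul_s : ∀ r a, γ (toSourceTarget.sRight r a) =
    BalTensor.mapR (toSourceTarget.sRight r)
      (fun r' a' => toSourceTarget.sRight_tRight r r' a') (γ a)
  /-- `γ` is a left `R`-module map: `γ(a t(r)) = a⁽¹⁾ t(r) ⊗ a⁽²⁾`. -/
  γ_mul_t : ∀ r a, γ (toSourceTarget.tRight r a) =
    BalTensor.mapL (toSourceTarget.tRight r)
      (fun r' a' => (toSourceTarget.sRight_tRight r' r a').symm) (γ a)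
  π_mul_s : ∀ r a, π (a * s r) = π a * r
  π_mul_t : ∀ r a, π (a * t (.op r)) = r * π a
  coassoc : ∀ a,
    BalTensor.assoc toSourceTarget.sRight toSourceTarget.tRight
        toSourceTarget.sRight toSourceTarget.tRight
        (fun r k a' => toSourceTarget.sRight_tRight k r a')
      (BalTensor.mapL γ (fun r a' => γ_mul_s r a') (γ a)) =
    BalTensor.mapR γ (fun r a' => γ_mul_t r a') (γ a)
  /-- `a⁽²⁾ t(π(a⁽¹⁾)) = a` -/
  counit_left : ∀ a,
    BalTensor.lift
      (AddMonoidHom.mul.compl₂ ((t.toAddMonoidHom.comp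
        MulOpposite.opAddEquiv.toAddMonoidHom).comp π)).flip
      (fun r a' b' => by
        change b' * t (.op (π (a' * s r))) = (b' * t (.op r)) * t (.op (π a'))
        rw [π_mul_s, MulOpposite.op_mul, map_mul, mul_assoc]) (γ a) = a
  /-- `a⁽¹⁾ s(π(a⁽²⁾)) = a` -/
  counit_right : ∀ a,
    BalTensor.lift (AddMonoidHom.mul.compl₂ (s.toAddMonoidHom.comp π))
      (fun r a' b' => by
        change (a' * s r) * s (π b') = a' * s (π (b' * t (.op r)))
        rw [π_mul_t, map_mul, mul_assoc]) (γ a) = a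
  /-- `s(r) a⁽¹⁾ ⊗ a⁽²⁾ = a⁽¹⁾ ⊗ t(r) a⁽²⁾` -/
  cross : ∀ a r, toSourceTarget.rightTensorMul (s r) 1 (γ a) =
    toSourceTarget.rightTensorMul 1 (t (.op r)) (γ a)
  γ_one : γ 1 = BalTensor.tmul _ _ 1 1
  /-- `γ(a b) = γ(a) γ(b)`, where `γ(a)` may be represented by any sum `∑ᵢ cᵢ ⊗ dᵢ`. -/
  γ_mul : ∀ (a b : A) (n : ℕ) (c d : Fin n → A), γ a = ∑ i, BalTensor.tmul _ _ (c i) (d i) →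
    γ (a * b) = ∑ i, toSourceTarget.rightTensorMul (c i) (d i) (γ b)
  π_one : π 1 = 1
  π_s_mul : ∀ a b, π (s (π a) * b) = π (a * b)
  π_t_mul : ∀ a b, π (t (.op (π a)) * b) = π (a * b)

namespace LeftBialgebroid

variable {A L : Type*} [Ring A] [Ring L] (H : LeftBialgebroid A L)

theorem γ_mul_t (l : L) (a : A) : H.γ (a * H.t (.op l)) = H.leftTensorMul 1 (H.t (.op l)) (H.γ a) := by
  have h : H.γ (H.t (.op l)) = ∑ _i : Fin 1, BalTensor.tmul _ _ 1 (H.t (.op l)) := by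
    have := H.γ_t_mul l 1
    rw [SourceTarget.tLeft_apply, mul_one, H.γ_one, BalTensor.mapR_tmul] at this
    rw [this]
    simp [SourceTarget.tLeft]
  rw [H.γ_mul a _ 1 _ _ h]
  simp

theorem γ_mul_s (l : L) (a : A) : H.γ (a * H.s l) = H.leftTensorMul (H.s l) 1 (H.γ a) := by
  have h : H.γ (H.s l) = ∑ _i : Fin 1, BalTensor.tmul _ _ (H.s l) 1 := by
    have := H.γ_s_mul l 1
    rw [SourceTarget.sLeft_apply, mul_one, H.γ_one, BalTensor.mapL_tmul] at this
    rw [this]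
    simp [SourceTarget.sLeft]
  rw [H.γ_mul a _ 1 _ _ h]
  simp

end LeftBialgebroid

namespace RightBialgebroid

variable {A R : Type*} [Ring A] [Ring R] (H : RightBialgebroid A R)

theorem γ_t_mul (r : R) (a : A) : H.γ (H.t (.op r) * a) = H.rightTensorMul (H.t (.op r)) 1 (H.γ a) := by
  have h : H.γ (H.t (.op r)) = ∑ _i : Fin 1, BalTensor.tmul _ _ (H.t (.op r)) 1 := by
    have := H.γ_mul_t r 1
    rw [SourceTarget.tRight_apply, one_mul, H.γ_one, BalTensor.mapL_tmul] at this
    rw [this]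
    simp [SourceTarget.tRight]
  rw [H.γ_mul _ a 1 _ _ h]
  simp

theorem γ_s_mul (r : R) (a : A) : H.γ (H.s r * a) = H.rightTensorMul 1 (H.s r) (H.γ a) := by
  have h : H.γ (H.s r) = ∑ _i : Fin 1, BalTensor.tmul _ _ 1 (H.s r) := by
    have := H.γ_mul_s r 1
    rw [SourceTarget.sRight_apply, one_mul, H.γ_one, BalTensor.mapR_tmul] at this
    rw [this]
    simp [SourceTarget.sRight]
  rw [H.γ_mul _ a 1 _ _ h]
  simp

/-! ### Duals of a right bialgebroid -/

/-- The dual `𝒜^*`: additive maps `φ : A → R` with `φ(a s(r)) = φ(a) r`. -/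
def dualSubgroup : AddSubgroup (A →+ R) where
  carrier := {φ | ∀ a r, φ (a * H.s r) = φ a * r}
  zero_mem' := by intro a r; simp
  add_mem' := by
    intro φ ψ hφ hψ a r
    simp [hφ a r, hψ a r, add_mul]
  neg_mem' := by
    intro φ hφ a r
    simp [hφ a r]

/-- The dual `𝒜^*` of a right bialgebroid, as a type; see `instRingDual` for its product. -/
def Dual : Type _ := H.dualSubgroup

/-- The other dual `^*𝒜`: additive maps `φ : A → R` with `φ(a t(r)) = r φ(a)`. -/
def coDual : AddSubgroup (A →+ R) where
  carrier := {φ | ∀ a r, φ (a * H.t (.op r)) = r * φ a}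
  zero_mem' := by intro a r; simp
  add_mem' := by
    intro φ ψ hφ hψ a r
    simp [hφ a r, hψ a r, mul_add]
  neg_mem' := by
    intro φ hφ a r
    simp [hφ a r]

namespace Dual

variable {H}

instance : AddCommGroup H.Dual := inferInstanceAs (AddCommGroup H.dualSubgroup)

instance : FunLike H.Dual A R where
  coe φ := φ.1
  coe_injective _ _ h := Subtype.ext (DFunLike.coe_injective h)

instance : AddMonoidHomClass H.Dual A R where
  map_add φ := φ.1.map_add
  map_zero φ := φ.1.map_zero

@[ext]
theorem ext {φ ψ : H.Dual} (h : ∀ a, φ a = ψ a) : φ = ψ := DFunLike.ext _ _ h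

@[simp] theorem add_apply (φ ψ : H.Dual) (a : A) : (φ + ψ) a = φ a + ψ a := rfl

@[simp] theorem zero_apply (a : A) : (0 : H.Dual) a = 0 := rfl

theorem map_mul_s (φ : H.Dual) (a : A) (r : R) : φ (a * H.s r) = φ a * r := φ.2 a r

/-- `a ⊗ b ↦ b t(φ(a))` on `A^R ⊗ ^R A`. -/
noncomputable def actTensor (φ : H.Dual) : H.RightTensor →+ A :=
  BalTensor.lift
    (AddMonoidHom.mul.compl₂ ((H.t.toAddMonoidHom.comp
      MulOpposite.opAddEquiv.toAddMonoidHom).comp φ.1)).flip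
    (fun r a b => by
      change b * H.t (.op (φ (a * H.s r))) = (b * H.t (.op r)) * H.t (.op (φ a))
      rw [φ.map_mul_s, MulOpposite.op_mul, map_mul, mul_assoc])

@[simp]
theorem actTensor_tmul (φ : H.Dual) (a b : A) :
    φ.actTensor (BalTensor.tmul _ _ a b) = b * H.t (.op (φ a)) := rfl

/-- The action `φ ⇀ a = a⁽²⁾ t(φ(a⁽¹⁾))` of `𝒜^*` on `A`. -/
noncomputable def act (φ : H.Dual) : A →+ A := φ.actTensor.comp H.γ

theorem act_mul_s (φ : H.Dual) (a : A) (r : R) : φ.act (a * H.s r) = φ.act a * H.s r := by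
  simp only [act, AddMonoidHom.comp_apply, ← H.sRight_apply, H.γ_mul_s]
  obtain ⟨n, u, v, h⟩ := BalTensor.exists_sum (H.γ a)
  simp [h, mul_assoc, H.comm]

/-- The product `(φ ψ)(a) = φ(a⁽²⁾ t(ψ(a⁽¹⁾)))`. -/
noncomputable instance : Mul H.Dual where
  mul φ ψ := ⟨φ.1.comp ψ.act, fun a r => by
    change φ (ψ.act (a * H.s r)) = φ (ψ.act a) * r
    rw [act_mul_s, map_mul_s]⟩

/-- The unit is the counit of the bialgebroid. -/
instance : One H.Dual where
  one := ⟨H.π, fun a r => H.π_mul_s r a⟩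

theorem mul_apply (φ ψ : H.Dual) (a : A) : (φ * ψ) a = φ (ψ.act a) := rfl

theorem one_apply (a : A) : (1 : H.Dual) a = H.π a := rfl

theorem one_act (a : A) : (1 : H.Dual).act a = a := H.counit_left a

theorem add_act (φ ψ : H.Dual) (a : A) : (φ + ψ).act a = φ.act a + ψ.act a := by
  simp only [act, AddMonoidHom.comp_apply]
  obtain ⟨n, u, v, h⟩ := BalTensor.exists_sum (H.γ a)
  simp [h, mul_add, Finset.sum_add_distrib]

theorem mul_act (φ ψ : H.Dual) (a : A) : (φ * ψ).act a = φ.act (ψ.act a) := by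
  -- `a ⊗ (b ⊗ c) ↦ c t(φ(b t(ψ(a))))`
  let G : A →+ H.RightTensor →+ A := AddMonoidHom.mk'
    (fun u => φ.actTensor.comp (BalTensor.mapL (H.tRight (ψ u))
      (fun r' a' => (H.sRight_tRight r' (ψ u) a').symm)))
    (fun u u' => BalTensor.hom_ext fun m n => by
      simp [SourceTarget.tRight, mul_add])
  have hG : ∀ u m n, G u (BalTensor.tmul _ _ m n) = n * H.t (.op (φ (m * H.t (.op (ψ u))))) :=
    fun _ _ _ => rfl
  have hbal : ∀ r u w, G (H.sRight r u) w = G u (BalTensor.mapL (H.tRight r)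
      (fun k n => (H.sRight_tRight k r n).symm) w) := fun r u w => by
    obtain ⟨n, x, y, rfl⟩ := BalTensor.exists_sum w
    simp only [map_sum, BalTensor.mapL_tmul, hG]
    refine Finset.sum_congr rfl fun i _ => ?_
    simp [SourceTarget.tRight, SourceTarget.sRight, map_mul_s, mul_assoc]
  have e := congrArg (BalTensor.lift G hbal) (H.coassoc a)
  obtain ⟨n, u, v, h⟩ := BalTensor.exists_sum (H.γ a)
  have hl : (φ * ψ).act a = ∑ i, v i * H.t (.op (φ (ψ.act (u i)))) := by
    simp [act, h, mul_apply]
  have hr : φ.act (ψ.act a) = ∑ i, φ.act (v i * H.t (.op (ψ (u i)))) := by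
    have : ψ.act a = ∑ i, v i * H.t (.op (ψ (u i))) := by simp [act, h]
    rw [this, map_sum]
  rw [hl, hr]
  simp only [h, map_sum] at e
  refine Eq.trans (Finset.sum_congr rfl fun i _ => ?_)
    (e.trans (Finset.sum_congr rfl fun i _ => ?_))
  · obtain ⟨n', x, y, h'⟩ := BalTensor.exists_sum (H.γ (u i))
    have hs : BalTensor.tmul (fun k => BalTensor.mapR (ρ := H.sRight) (κ := H.tRight)
          (κ' := H.tRight) (H.sRight k) (fun j n => H.sRight_tRight k j n)) H.tRight
          (H.γ (u i)) (v i) =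
        ∑ j, BalTensor.tmul _ _ (BalTensor.tmul _ _ (x j) (y j)) (v i) := by
      rw [h', ← BalTensor.tmulHom_apply, map_sum, AddMonoidHom.finsetSum_apply]
      rfl
    rw [BalTensor.mapL_tmul, hs]
    simp only [map_sum, BalTensor.assoc_tmul, BalTensor.lift_tmul, hG]
    simp [act, h', Finset.mul_sum]
  · simp only [act, AddMonoidHom.comp_apply, ← H.tRight_apply, H.γ_mul_t]
    rfl

noncomputable instance instRingDual : Ring H.Dual where
  __ := (inferInstance : AddCommGroup H.Dual)
  mul_assoc φ ψ χ := by ext a; simp only [mul_apply, mul_act]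
  one_mul φ := by
    ext a
    rw [mul_apply, one_apply, act, AddMonoidHom.comp_apply]
    obtain ⟨n, u, v, h⟩ := BalTensor.exists_sum (H.γ a)
    have hc := congrArg φ (H.counit_right a)
    rw [h] at hc ⊢
    simp only [map_sum, BalTensor.lift_tmul, actTensor_tmul, H.π_mul_t] at hc ⊢
    rw [← hc]
    exact Finset.sum_congr rfl fun i _ => (φ.map_mul_s (u i) (H.π (v i))).symm
  mul_one φ := by ext a; rw [mul_apply, one_act]
  left_distrib φ ψ χ := by
    ext a
    rw [add_apply, mul_apply, mul_apply, mul_apply, add_act, map_add]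
  right_distrib φ ψ χ := by ext a; rfl
  zero_mul φ := by ext a; rfl
  mul_zero φ := by
    ext a
    rw [mul_apply]
    have : (0 : H.Dual).act a = 0 := by
      have := add_act (0 : H.Dual) 0 a
      simpa using this
    rw [this, map_zero]
    rfl

/-- The right `A`-action `(φ ↼ a)(b) = φ(a b)` on `𝒜^*`. -/
def precomp (φ : H.Dual) (a : A) : H.Dual :=
  ⟨φ.1.comp (AddMonoidHom.mulLeft a), fun b r => by
    change φ (a * (b * H.s r)) = φ (a * b) * r
    rw [← mul_assoc, map_mul_s]⟩

end Dual

/-- The action `φ ⇁ a = a⁽¹⁾ s(φ(a⁽²⁾))` of `^*𝒜` on `A`. -/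
noncomputable def coAct (φ : H.coDual) : A →+ A :=
  (BalTensor.lift (AddMonoidHom.mul.compl₂ (H.s.toAddMonoidHom.comp φ.1))
    (fun r a b => by
      change (a * H.s r) * H.s (φ.1 b) = a * H.s (φ.1 (b * H.t (.op r)))
      rw [φ.2 b r, map_mul, mul_assoc])).comp H.γ

end RightBialgebroid

/-! ## Hopf algebroids -/

section Compatibility

variable {A L R : Type*} [Ring A] [Ring L] [Ring R]
  (HL : LeftBialgebroid A L) (HR : RightBialgebroid A R)

theorem sRight_sLeft_comm (l : L) (r : R) (a : A) :
    HR.sRight r (HL.sLeft l a) = HL.sLeft l (HR.sRight r a) := by simp [mul_assoc]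

theorem tLeft_tRight_comm (r : R) (l : L) (a : A) :
    HL.tLeft l (HR.tRight r a) = HR.tRight r (HL.tLeft l a) := by simp [mul_assoc]

variable {HL HR}

theorem leftγ_mul_s (h : Set.range HL.t = Set.range HR.s) (r : R) (a : A) :
    HL.γ (HR.sRight r a) =
      BalTensor.mapR (HR.sRight r) (fun l a' => sRight_sLeft_comm HL HR l r a') (HL.γ a) := by
  obtain ⟨⟨l⟩, hl⟩ : HR.s r ∈ Set.range HL.t := h ▸ Set.mem_range_self r
  have := HL.γ_mul_t l a
  rw [show HL.t (MulOpposite.op l) = HR.s r from hl] at this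
  rw [HR.sRight_apply, this]
  obtain ⟨n, u, v, e⟩ := BalTensor.exists_sum (HL.γ a)
  simp [e]

theorem leftγ_mul_t (h : Set.range HL.s = Set.range HR.t) (r : R) (a : A) :
    HL.γ (HR.tRight r a) =
      BalTensor.mapL (HR.tRight r) (fun l a' => (tLeft_tRight_comm HL HR r l a').symm)
        (HL.γ a) := by
  obtain ⟨l, hl⟩ : HR.t (.op r) ∈ Set.range HL.s := h ▸ Set.mem_range_self _
  have := HL.γ_mul_s l a
  rw [hl] at this
  rw [HR.tRight_apply, this]
  obtain ⟨n, u, v, e⟩ := BalTensor.exists_sum (HL.γ a)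
  simp [e]

theorem rightγ_s_mul (h : Set.range HL.s = Set.range HR.t) (l : L) (a : A) :
    HR.γ (HL.sLeft l a) =
      BalTensor.mapL (HL.sLeft l) (fun r a' => (sRight_sLeft_comm HL HR l r a').symm)
        (HR.γ a) := by
  obtain ⟨⟨r⟩, hr⟩ : HL.s l ∈ Set.range HR.t := h ▸ Set.mem_range_self l
  have := HR.γ_t_mul r a
  rw [show HR.t (MulOpposite.op r) = HL.s l from hr] at this
  rw [HL.sLeft_apply, this]
  obtain ⟨n, u, v, e⟩ := BalTensor.exists_sum (HR.γ a)
  simp [e]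

theorem rightγ_t_mul (h : Set.range HL.t = Set.range HR.s) (l : L) (a : A) :
    HR.γ (HL.tLeft l a) =
      BalTensor.mapR (HL.tLeft l) (fun r a' => tLeft_tRight_comm HL HR r l a') (HR.γ a) := by
  obtain ⟨r, hr⟩ : HL.t (.op l) ∈ Set.range HR.s := h ▸ Set.mem_range_self _
  have := HR.γ_s_mul r a
  rw [hr] at this
  rw [HL.tLeft_apply, this]
  obtain ⟨n, u, v, e⟩ := BalTensor.exists_sum (HR.γ a)
  simp [e]

end Compatibility

/-- A Hopf algebroid: a left bialgebroid over `L` and a right bialgebroid over `R` on the same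
total ring `A`, related by an antipode `S`. -/
structure HopfAlgebroid (A L R : Type*) [Ring A] [Ring L] [Ring R] where
  left : LeftBialgebroid A L
  right : RightBialgebroid A R
  /-- the antipode -/
  S : A ≃+ A
  base_iso : Nonempty (R ≃+* Lᵐᵒᵖ)
  range_s : Set.range left.s = Set.range right.t
  range_t : Set.range left.t = Set.range right.s
  /-- `(γ_L ⊗ id) ∘ γ_R = (id ⊗ γ_R) ∘ γ_L` -/
  coassoc_left_right : ∀ a,
    BalTensor.assoc left.tLeft left.sLeft right.sRight right.tRight
        (fun l r a' => sRight_sLeft_comm left right l r a')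
      (BalTensor.mapL left.γ (fun r a' => leftγ_mul_s range_t r a') (right.γ a)) =
    BalTensor.mapR right.γ (fun l a' => rightγ_s_mul range_s l a') (left.γ a)
  /-- `(γ_R ⊗ id) ∘ γ_L = (id ⊗ γ_L) ∘ γ_R` -/
  coassoc_right_left : ∀ a,
    BalTensor.assoc right.sRight right.tRight left.tLeft left.sLeft
        (fun r l a' => tLeft_tRight_comm left right r l a')
      (BalTensor.mapL right.γ (fun l a' => rightγ_t_mul range_t l a') (left.γ a)) =
    BalTensor.mapR left.γ (fun r a' => leftγ_mul_t range_s r a') (right.γ a)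
  S_left : ∀ (l l' : L) (a : A),
    S (left.t (.op l) * a * left.t (.op l')) = left.s l' * S a * left.s l
  S_right : ∀ (r r' : R) (a : A),
    S (right.t (.op r') * a * right.t (.op r)) = right.s r * S a * right.s r'
  /-- `S(a₍₁₎) a₍₂₎ = s_R(π_R(a))` -/
  antipode_left : ∀ a,
    BalTensor.lift (AddMonoidHom.mul.comp S.toAddMonoidHom)
      (fun l a' b' => by
        change S (left.t (.op l) * a') * b' = S a' * (left.s l * b')
        have h := S_left l 1 a'
        rw [MulOpposite.op_one, map_one, map_one, mul_one, one_mul] at h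
        rw [h, mul_assoc]) (left.γ a) = right.s (right.π a)
  /-- `a⁽¹⁾ S(a⁽²⁾) = s_L(π_L(a))` -/
  antipode_right : ∀ a,
    BalTensor.lift (AddMonoidHom.mul.compl₂ S.toAddMonoidHom)
      (fun r a' b' => by
        change (a' * right.s r) * S b' = a' * S (b' * right.t (.op r))
        have h := S_right r 1 b'
        rw [MulOpposite.op_one, map_one, map_one, mul_one, one_mul] at h
        rw [h, mul_assoc]) (right.γ a) = left.s (left.π a)

/-- A homomorphism `(Φ, φ)` of left bialgebroids. -/
structure LeftBialgebroid.IsHom {A L A' L' : Type*} [Ring A] [Ring L] [Ring A'] [Ring L']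
    (H : LeftBialgebroid A L) (H' : LeftBialgebroid A' L') (Φ : A →+* A') (φ : L →+* L') :
    Prop where
  s : ∀ l, H'.s (φ l) = Φ (H.s l)
  t : ∀ l, H'.t (.op (φ l)) = Φ (H.t (.op l))
  π : ∀ a, H'.π (Φ a) = φ (H.π a)
  /-- `γ'(Φ(a)) = Φ(a₍₁₎) ⊗ Φ(a₍₂₎)` -/
  γ : ∀ a, H'.γ (Φ a) =
    BalTensor.mapBase φ Φ.toAddMonoidHom Φ.toAddMonoidHom
      (fun l a' => by
        change Φ (H.t (.op l) * a') = H'.t (.op (φ l)) * Φ a'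
        rw [map_mul, t])
      (fun l a' => by
        change Φ (H.s l * a') = H'.s (φ l) * Φ a'
        rw [map_mul, s]) (H.γ a)

namespace HopfAlgebroid

variable {A L R : Type*} [Ring A] [Ring L] [Ring R]

/-- A strict isomorphism of Hopf algebroids: a homomorphism of the left bialgebroids with bijective
components that commutes with the antipodes. -/
structure IsStrictIso {A' L' R' : Type*} [Ring A'] [Ring L'] [Ring R']
    (H : HopfAlgebroid A L R) (H' : HopfAlgebroid A' L' R') (Φ : A →+* A') (φ : L →+* L') :
    Prop where
  isHom : H.left.IsHom H'.left Φ φ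
  bijective_total : Function.Bijective Φ
  bijective_base : Function.Bijective φ
  strict : ∀ a, Φ (H.S a) = H'.S (Φ a)

variable (H : HopfAlgebroid A L R)

/-- Left integrals: `a ℓ = s_L(π_L(a)) ℓ` for all `a`. -/
def IsLeftIntegral (ℓ : A) : Prop := ∀ a, a * ℓ = H.left.s (H.left.π a) * ℓ

/-- Right integrals: `ℓ a = ℓ s_R(π_R(a))` for all `a`. -/
def IsRightIntegral (ℓ : A) : Prop := ∀ a, ℓ * a = ℓ * H.right.s (H.right.π a)

/-- Two-sided non-degenerate integrals: the maps `φ ↦ φ ⇀ ℓ` from `𝒜^*` to `A` and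
`φ ↦ φ ⇁ ℓ` from `^*𝒜` to `A` are bijective. -/
structure IsNondegenerateIntegral (ℓ : A) : Prop where
  left_integral : H.IsLeftIntegral ℓ
  right_integral : H.IsRightIntegral ℓ
  bijective_act : Function.Bijective fun φ : H.right.Dual => φ.act ℓ
  bijective_coAct : Function.Bijective fun φ : H.right.coDual => H.right.coAct φ ℓ

variable {H}

/-- The bijection `i_R : 𝒜^* → A`, `φ ↦ φ ⇀ i`. -/
noncomputable def IsNondegenerateIntegral.iR {i : A} (hi : H.IsNondegenerateIntegral i) :
    H.right.Dual ≃ A :=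
  Equiv.ofBijective _ hi.bijective_act

/-- The element `i_R⁻¹(1)` of `𝒜^*`. -/
noncomputable def IsNondegenerateIntegral.dualIntegral {i : A}
    (hi : H.IsNondegenerateIntegral i) : H.right.Dual :=
  hi.iR.symm 1

/-- `D` is the dual Hopf algebroid `𝒜^*_i` on the ring `𝒜^*`: its structure maps are the following
ones, in which the coproduct `γ_R(i) = i⁽¹⁾ ⊗ i⁽²⁾` may be represented by any sum `∑ⱼ uⱼ ⊗ vⱼ`. -/
structure IsDual {i : A} (hi : H.IsNondegenerateIntegral i)
    (D : HopfAlgebroid H.right.Dual R L) : Prop where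
  left_s : ∀ r a, D.left.s r a = r * H.right.π a
  left_t : ∀ r a, D.left.t (.op r) a = H.right.π (H.right.s r * a)
  /-- `γ_L^*(φ) = φ ↼ i⁽¹⁾ ⊗ i_R⁻¹(i⁽²⁾)` -/
  left_γ : ∀ (n : ℕ) (u v : Fin n → A), H.right.γ i = ∑ j, BalTensor.tmul _ _ (u j) (v j) →
    ∀ φ, D.left.γ φ = ∑ j, BalTensor.tmul _ _ (φ.precomp (u j)) (hi.iR.symm (v j))
  left_π : ∀ φ : H.right.Dual, D.left.π φ = φ 1
  right_s : ∀ l a, D.right.s l a = H.right.π (H.left.s l * a)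
  right_t : ∀ l a, D.right.t (.op l) a = hi.dualIntegral (H.S (i * H.left.t (.op l)) * a)
  /-- `γ_R^*(φ) = φ ↼ S²(i⁽²⁾) ⊗ i_R⁻¹(i⁽¹⁾)` -/
  right_γ : ∀ (n : ℕ) (u v : Fin n → A), H.right.γ i = ∑ j, BalTensor.tmul _ _ (u j) (v j) →
    ∀ φ, D.right.γ φ =
      ∑ j, BalTensor.tmul _ _ (φ.precomp (H.S (H.S (v j)))) (hi.iR.symm (u j))
  right_π : ∀ φ : H.right.Dual,
    D.right.π φ = H.left.π (H.right.s ((hi.dualIntegral * φ) i))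
  antipode : ∀ φ, D.S φ = hi.iR.symm (H.S (hi.iR φ))

end HopfAlgebroid

/-! ## Depth 2 Frobenius 1-morphisms -/

universe w v u

/-- A bicategory enriched over abelian groups: the hom-categories are preadditive and horizontal
composition is additive in both arguments. -/
class PreadditiveBicategory (C : Type u) [Bicategory.{w, v} C]
    [∀ a b : C, Preadditive (a ⟶ b)] : Prop where
  whiskerLeft_add : ∀ {a b c : C} (f : a ⟶ b) {g h : b ⟶ c} (x y : g ⟶ h),
    f ◁ (x + y) = f ◁ x + f ◁ y
  add_whiskerRight : ∀ {a b c : C} {f g : a ⟶ b} (x y : f ⟶ g) (h : b ⟶ c),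
    (x + y) ▷ h = x ▷ h + y ▷ h

/-- Frobenius data for a 1-morphism `ι`: a two-sided dual `ῑ` together with the evaluation and
coevaluation 2-morphisms. Horizontal composition `f × g` is written `f ≫ g`. -/
structure FrobeniusData {C : Type u} [Bicategory.{w, v} C] {X Y : C} (ι : X ⟶ Y) where
  /-- the dual 1-morphism `ῑ` -/
  bar : Y ⟶ X
  adjL : Bicategory.Adjunction ι bar
  adjR : Bicategory.Adjunction bar ι

namespace FrobeniusData

section General

variable {C : Type u} [Bicategory.{w, v} C] {X Y : C} {ι : X ⟶ Y} (F : FrobeniusData ι)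

/-- `ev_L : ῑ × ι → 1` -/
abbrev evL : F.bar ≫ ι ⟶ 𝟙 Y := F.adjL.counit
/-- `coev_L : 1 → ι × ῑ` -/
abbrev coevL : 𝟙 X ⟶ ι ≫ F.bar := F.adjL.unit
/-- `ev_R : ι × ῑ → 1` -/
abbrev evR : ι ≫ F.bar ⟶ 𝟙 X := F.adjR.counit
/-- `coev_R : 1 → ῑ × ι` -/
abbrev coevR : 𝟙 Y ⟶ F.bar ≫ ι := F.adjR.unit

/-- `A = End(ι × ῑ)`, whose product is `a * b = a ∘ b` -/
abbrev A : Type w := End (ι ≫ F.bar)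
/-- `B = End(ῑ × ι)` -/
abbrev B : Type w := End (F.bar ≫ ι)
/-- `L = End(ι)` -/
abbrev L (_F : FrobeniusData ι) : Type w := End ι
/-- `R = End(ῑ)` -/
abbrev R : Type w := End F.bar

/-- The convolution product on `A`: the two factors are put side by side and the two inner legs
are closed by `coev_R` and `ev_L`. -/
def convA (a₁ a₂ : F.A) : F.A :=
  End.of ((ρ_ ι).inv ▷ F.bar ≫ (ι ◁ F.coevR) ▷ F.bar ≫ (α_ ι F.bar ι).inv ▷ F.bar ≫
    (α_ (ι ≫ F.bar) ι F.bar).hom ≫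
    a₁.asHom ▷ (ι ≫ F.bar) ≫ (ι ≫ F.bar) ◁ a₂.asHom ≫
    (α_ (ι ≫ F.bar) ι F.bar).inv ≫
    (α_ ι F.bar ι).hom ▷ F.bar ≫ (ι ◁ F.evL) ▷ F.bar ≫ (ρ_ ι).hom ▷ F.bar)

/-- The convolution product on `B`: the two factors are put side by side and the two inner legs
are closed by `coev_L` and `ev_R`. -/
def convB (b₁ b₂ : F.B) : F.B :=
  End.of (F.bar ◁ (λ_ ι).inv ≫ F.bar ◁ (F.coevL ▷ ι) ≫ F.bar ◁ (α_ ι F.bar ι).hom ≫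
    (α_ F.bar ι (F.bar ≫ ι)).inv ≫
    b₁.asHom ▷ (F.bar ≫ ι) ≫ (F.bar ≫ ι) ◁ b₂.asHom ≫
    (α_ F.bar ι (F.bar ≫ ι)).hom ≫
    F.bar ◁ (α_ ι F.bar ι).inv ≫ F.bar ◁ (F.evR ▷ ι) ≫ F.bar ◁ (λ_ ι).hom)

/-- The unit `i_A = coev_L ∘ ev_R` of the convolution product on `A`. -/
def iA : F.A := End.of (F.evR ≫ F.coevL)

/-- The Fourier transformation `ℱ : A → B`. -/
def fourier (a : F.A) : F.B :=
  End.of ((λ_ (F.bar ≫ ι)).inv ≫ F.coevR ▷ (F.bar ≫ ι) ≫ (α_ (F.bar ≫ ι) F.bar ι).inv ≫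
    (α_ F.bar ι F.bar).hom ▷ ι ≫ (F.bar ◁ a.asHom) ▷ ι ≫ (α_ F.bar ι F.bar).inv ▷ ι ≫
    (α_ (F.bar ≫ ι) F.bar ι).hom ≫ (F.bar ≫ ι) ◁ F.evL ≫ (ρ_ (F.bar ≫ ι)).hom)

/-- The second Fourier transformation `ℱ̇ : A → B`. -/
def fourierDot (a : F.A) : F.B :=
  End.of ((ρ_ (F.bar ≫ ι)).inv ≫ (F.bar ≫ ι) ◁ F.coevR ≫ (α_ F.bar ι (F.bar ≫ ι)).hom ≫
    F.bar ◁ (α_ ι F.bar ι).inv ≫ F.bar ◁ (a.asHom ▷ ι) ≫ F.bar ◁ (α_ ι F.bar ι).hom ≫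
    (α_ F.bar ι (F.bar ≫ ι)).inv ≫ F.evL ▷ (F.bar ≫ ι) ≫ (λ_ (F.bar ≫ ι)).hom)

/-- The inverse `ℱ⁻¹ : B → A`. -/
def fourierInv (b : F.B) : F.A :=
  End.of ((ρ_ (ι ≫ F.bar)).inv ≫ (ι ≫ F.bar) ◁ F.coevL ≫ (α_ ι F.bar (ι ≫ F.bar)).hom ≫
    ι ◁ (α_ F.bar ι F.bar).inv ≫ ι ◁ (b.asHom ▷ F.bar) ≫ ι ◁ (α_ F.bar ι F.bar).hom ≫
    (α_ ι F.bar (ι ≫ F.bar)).inv ≫ F.evR ▷ (ι ≫ F.bar) ≫ (λ_ (ι ≫ F.bar)).hom)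

/-- The inverse `ℱ̇⁻¹ : B → A`. -/
def fourierDotInv (b : F.B) : F.A :=
  End.of ((λ_ (ι ≫ F.bar)).inv ≫ F.coevL ▷ (ι ≫ F.bar) ≫ (α_ (ι ≫ F.bar) ι F.bar).inv ≫
    (α_ ι F.bar ι).hom ▷ F.bar ≫ (ι ◁ b.asHom) ▷ F.bar ≫ (α_ ι F.bar ι).inv ▷ F.bar ≫
    (α_ (ι ≫ F.bar) ι F.bar).hom ≫ (ι ≫ F.bar) ◁ F.evR ≫ (ρ_ (ι ≫ F.bar)).hom)

/-- `S_A = ℱ̇⁻¹ ∘ ℱ` -/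
def SA (a : F.A) : F.A := F.fourierDotInv (F.fourier a)

/-- `S_A⁻¹ = ℱ⁻¹ ∘ ℱ̇` -/
def SAInv (a : F.A) : F.A := F.fourierInv (F.fourierDot a)

/-- `S_B = ℱ ∘ ℱ̇⁻¹` -/
def SB (b : F.B) : F.B := F.fourier (F.fourierDotInv b)

/-- `μ : L → Rᵒᵖ` -/
def mu (l : F.L) : F.R :=
  End.of ((ρ_ F.bar).inv ≫ F.bar ◁ F.coevL ≫ (α_ F.bar ι F.bar).inv ≫
    (F.bar ◁ l.asHom) ▷ F.bar ≫ F.evL ▷ F.bar ≫ (λ_ F.bar).hom)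

/-- `ν : L → Rᵒᵖ` -/
def nu (l : F.L) : F.R :=
  End.of ((λ_ F.bar).inv ≫ F.coevR ▷ F.bar ≫ (α_ F.bar ι F.bar).hom ≫
    F.bar ◁ (l.asHom ▷ F.bar) ≫ F.bar ◁ F.evR ≫ (ρ_ F.bar).hom)

/-- `ν⁻¹ : R → Lᵒᵖ`; see `nuInv_nu` and `nu_nuInv`. -/
def nuInv (r : F.R) : F.L :=
  End.of ((ρ_ ι).inv ≫ ι ◁ F.coevR ≫ ι ◁ (r.asHom ▷ ι) ≫ (α_ ι F.bar ι).inv ≫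
    F.evR ▷ ι ≫ (λ_ ι).hom)

theorem nu_eq (l : F.L) : F.nu l = (conjugateEquiv F.adjR F.adjR).symm l :=
  (conjugateEquiv_symm_apply' F.adjR F.adjR l).symm

theorem nuInv_eq (r : F.R) : F.nuInv r = conjugateEquiv F.adjR F.adjR r :=
  (conjugateEquiv_apply' F.adjR F.adjR r).symm

theorem nuInv_nu (l : F.L) : F.nuInv (F.nu l) = l := by
  rw [nuInv_eq, nu_eq]
  exact Equiv.apply_symm_apply _ _

theorem nu_nuInv (r : F.R) : F.nu (F.nuInv r) = r := by
  rw [nuInv_eq, nu_eq]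
  exact Equiv.symm_apply_apply _ _

/-- The Frobenius map `φ_L : A → L`, the partial trace over the right leg. -/
def phiL (a : F.A) : F.L :=
  End.of ((ρ_ ι).inv ≫ ι ◁ F.coevR ≫ (α_ ι F.bar ι).inv ≫ a.asHom ▷ ι ≫ (α_ ι F.bar ι).hom ≫
    ι ◁ F.evL ≫ (ρ_ ι).hom)

end General

section Additive

variable {C : Type u} [Bicategory.{w, v} C] [∀ a b : C, Preadditive (a ⟶ b)]
  {X Y : C} {ι : X ⟶ Y} (F : FrobeniusData ι)

/-- The depth 2 condition: `(ι × ῑ) × ι` is a direct summand of a finite direct sum of copies of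
`ι`, and `(ῑ × ι) × ῑ` is a direct summand of a finite direct sum of copies of `ῑ`. -/
def IsD2 [∀ a b : C, HasFiniteBiproducts (a ⟶ b)] : Prop :=
  (∃ n : ℕ, Nonempty (Retract ((ι ≫ F.bar) ≫ ι) (⨁ fun _ : Fin n => ι))) ∧
    ∃ n : ℕ, Nonempty (Retract ((F.bar ≫ ι) ≫ F.bar) (⨁ fun _ : Fin n => F.bar))

/-- The families `y`, `x` form a D2 quasi-basis `∑ᵢ yᵢ ⊗ xᵢ`. -/
def IsQuasiBasis {n : ℕ} (y x : Fin n → F.A) : Prop :=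
  ∑ i, ((x i).asHom ▷ ι ≫ (α_ ι F.bar ι).hom ≫ ι ◁ F.evL ≫ ι ◁ F.coevR ≫
    (α_ ι F.bar ι).inv ≫ (y i).asHom ▷ ι) = 𝟙 ((ι ≫ F.bar) ≫ ι)

/-- `H` is the Hopf algebroid `𝒜` on `A`: its structure maps are the following ones. -/
structure IsHopfA (H : HopfAlgebroid F.A F.L F.R) : Prop where
  left_s : ∀ l, H.left.s l = l.asHom ▷ F.bar
  left_t : ∀ l, H.left.t (.op l) = ι ◁ (F.mu l).asHom
  left_γ : ∀ (n : ℕ) (y x : Fin n → F.A), F.IsQuasiBasis y x → ∀ a,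
    H.left.γ a = ∑ i, BalTensor.tmul _ _ (F.convA a (F.SAInv (y i))) (x i) ∧
    H.left.γ a = ∑ i, BalTensor.tmul _ _ (F.SAInv (y i)) (F.convA (x i) a)
  left_π : ∀ a, H.left.π a = F.phiL (a * F.iA)
  right_s : ∀ r, H.right.s r = ι ◁ r.asHom
  right_t : ∀ r, H.right.t (.op r) = (F.nuInv r).asHom ▷ F.bar
  right_γ : ∀ (n : ℕ) (y x : Fin n → F.A), F.IsQuasiBasis y x → ∀ a,
    H.right.γ a = ∑ i, BalTensor.tmul _ _ (F.convA a (F.SA (x i))) (y i) ∧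
    H.right.γ a = ∑ i, BalTensor.tmul _ _ (F.SA (x i)) (F.convA (y i) a)
  right_π : ∀ a, H.right.π a = F.nu (F.phiL (F.SAInv a * F.iA))
  antipode : ∀ a, H.S a = F.SA a

/-- `H` is the Hopf algebroid `ℬ` on `B`: its structure maps are the following ones. -/
structure IsHopfB (H : HopfAlgebroid F.B F.R F.L) : Prop where
  left_s : ∀ r, H.left.s r = r.asHom ▷ ι
  left_t : ∀ r, H.left.t (.op r) = F.bar ◁ (F.nuInv r).asHom
  left_γ : ∀ (n : ℕ) (y x : Fin n → F.A), F.IsQuasiBasis y x → ∀ b,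
    H.left.γ b = ∑ i, BalTensor.tmul _ _ (F.convB b (F.fourier (x i))) (F.fourier (y i)) ∧
    H.left.γ b = ∑ i, BalTensor.tmul _ _ (F.fourier (x i)) (F.convB (F.fourier (y i)) b)
  left_π : ∀ b, H.left.π b = F.nu (F.phiL (F.fourierInv b))
  right_s : ∀ l, H.right.s l = F.bar ◁ l.asHom
  right_t : ∀ l, H.right.t (.op l) = (F.mu l).asHom ▷ ι
  right_γ : ∀ (n : ℕ) (y x : Fin n → F.A), F.IsQuasiBasis y x → ∀ b,
    H.right.γ b =
      ∑ i, BalTensor.tmul _ _ (F.convB b (F.fourierDot (y i))) (F.fourierDot (x i)) ∧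
    H.right.γ b =
      ∑ i, BalTensor.tmul _ _ (F.fourierDot (y i)) (F.convB (F.fourierDot (x i)) b)
  right_π : ∀ b, H.right.π b = F.phiL (F.fourierDotInv b)
  antipode : ∀ b, H.S b = F.SB b

end Additive

end FrobeniusData

/-!
The ring `A` carries a second product `⋆`, with unit `i_A`. The map `S_A` reverses both products,
`a ⋆ 1` is the image of `φ_L(a)` under the source map, and inserting a D2 quasi-basis in the middle
of `(pq) ⋆ (dc)` gives the distributive law `(pq) ⋆ (dc) = ∑ⱼ ((p yⱼ) ⋆ d) ((xⱼ q) ⋆ c)`.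
All axioms of a Hopf algebroid follow from these facts. The maps `c ⊗ d ↦ S(c) ((d p) ⋆ 1)`
separate the points of the tensor product, and their values on a coproduct are products with respect
to `⋆`, so the multiplicativity of the coproduct is the distributive law.

These facts are stable under exchanging the two products of `A`. The ring `B` is `A` with the
product `⋆`, via `ℱ`, and so is the dual ring `𝒜^*`, via `a ↦ ν φ_L(S_A⁻¹(-) a)`, because `φ_L` is
a Frobenius homomorphism. Hence `B` and `𝒜^*` are two models of one Hopf algebroid, and comparing
them yields `α^*`.
-/

namespace BalTensor

variable {J K M N P : Type*} [AddCommGroup M] [AddCommGroup N] [AddCommGroup P]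

theorem sum_tmul {ρ : J → M →+ M} {κ : J → N →+ N} {n : ℕ} (u : Fin n → M) (v : N) :
    tmul ρ κ (∑ i, u i) v = ∑ i, tmul ρ κ (u i) v := by
  rw [← tmulHom_apply, map_sum, AddMonoidHom.finsetSum_apply]
  rfl

theorem tmul_sum {ρ : J → M →+ M} {κ : J → N →+ N} {n : ℕ} (u : M) (v : Fin n → N) :
    tmul ρ κ u (∑ i, v i) = ∑ i, tmul ρ κ u (v i) := by
  rw [← tmulHom_apply, map_sum]
  rfl

theorem assoc_mapL_eq_mapR_of_mul {ρ : J → M →+ M} {κ : J → N →+ N} {σ : K → N →+ N}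
    {τ : K → P →+ P} (h : ∀ j k n, σ k (κ j n) = κ j (σ k n)) {c : N →+ N →+ N}
    (hc : ∀ a b d, c (c a b) d = c a (c b d)) {f : N →+ BalTensor ρ κ} {g : N →+ BalTensor σ τ}
    {n m : ℕ} {r : Fin n → M} {w : Fin n → N} {p : Fin m → N} {q : Fin m → P}
    (hf : ∀ a, f a = ∑ k, tmul ρ κ (r k) (c (w k) a))
    (hg : ∀ a, g a = ∑ j, tmul σ τ (c a (p j)) (q j))
    (hfσ : ∀ k a, f (σ k a) = mapR (σ k) (fun j a' => h j k a') (f a))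
    (hgκ : ∀ j a, g (κ j a) = mapL (κ j) (fun k a' => (h j k a').symm) (g a)) (a : N) :
    assoc ρ κ σ τ h (mapL f hfσ (g a)) = mapR g hgκ (f a) := by
  simp only [hg a, hf a, map_sum, mapL_tmul, mapR_tmul]
  simp only [hf, hg, sum_tmul, tmul_sum, map_sum, assoc_tmul, hc]
  exact Finset.sum_comm

end BalTensor

/-- A ring `A` with a second product `conv` with unit `i`, a Frobenius homomorphism `φ` onto the
base ring `L`, and a bijection `S` that reverses both products. A family `y, x` makes `conv`
distribute over the multiplication of `A`. The model is the endomorphism ring of `ι × ῑ` for a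
Frobenius 1-morphism `ι` of depth 2, with its antipode `S`. -/
structure FrobeniusDoubleRing (A L : Type*) [Ring A] [Ring L] where
  conv : A →+ A →+ A
  i : A
  S : A ≃+ A
  s : L →+* A
  φ : A →+ L
  rank : ℕ
  y : Fin rank → A
  x : Fin rank → A
  conv_assoc : ∀ a b c, conv (conv a b) c = conv a (conv b c)
  i_conv : ∀ a, conv i a = a
  conv_i : ∀ a, conv a i = a
  S_mul : ∀ a b, S (a * b) = S b * S a
  S_conv : ∀ a b, S (conv a b) = conv (S b) (S a)
  conv_one : ∀ a, conv a 1 = s (φ a)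
  s_mul_conv : ∀ l a b, s l * conv a b = conv (s l * a) b
  conv_mul_s : ∀ l a b, conv a b * s l = conv (a * s l) b
  symm_S_s_mul_conv_eq : ∀ l a b, conv (S.symm (s l) * a) b = conv a (s l * b)
  φ_s_mul : ∀ l a, φ (s l * a) = l * φ a
  φ_i : φ i = 1
  mul_i : ∀ a, a * i = s (φ (a * i)) * i
  φ_conv_mul : ∀ a b c, φ (conv a b * c) = φ (a * conv c (S b))
  conv_mul_mul : ∀ p q d c, conv (p * q) (d * c) = ∑ j, conv (p * y j) d * conv (x j * q) c

namespace FrobeniusDoubleRing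

section Basic

variable {A L : Type*} [Ring A] [Ring L] (D : FrobeniusDoubleRing A L)

theorem φ_s_mul_i (l : L) : D.φ (D.s l * D.i) = l := by rw [D.φ_s_mul, D.φ_i, mul_one]

theorem s_injective : Function.Injective D.s :=
  Function.LeftInverse.injective (g := fun a => D.φ (a * D.i)) D.φ_s_mul_i

theorem φ_mul_s (a : A) (l : L) : D.φ (a * D.s l) = D.φ a * l := by
  apply D.s_injective
  rw [← D.conv_one, ← D.conv_mul_s, D.conv_one, map_mul]

theorem S_one : D.S 1 = 1 := by
  simpa only [one_mul, D.S.apply_symm_apply] using (D.S_mul 1 (D.S.symm 1)).symm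

theorem S_i : D.S D.i = D.i := by
  simpa only [D.i_conv, D.S.apply_symm_apply] using (D.S_conv D.i (D.S.symm D.i)).symm

theorem symm_S_one : D.S.symm 1 = 1 := by rw [AddEquiv.symm_apply_eq, D.S_one]

theorem symm_S_i : D.S.symm D.i = D.i := by rw [AddEquiv.symm_apply_eq, D.S_i]

theorem symm_S_mul (a b : A) : D.S.symm (a * b) = D.S.symm b * D.S.symm a := by
  rw [AddEquiv.symm_apply_eq, D.S_mul, D.S.apply_symm_apply, D.S.apply_symm_apply]

theorem symm_S_conv (a b : A) :
    D.S.symm (D.conv a b) = D.conv (D.S.symm b) (D.S.symm a) := by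
  rw [AddEquiv.symm_apply_eq, D.S_conv, D.S.apply_symm_apply, D.S.apply_symm_apply]

theorem conv_mul_S_s (l : L) (a b : A) :
    D.conv a b * D.S (D.s l) = D.conv a (b * D.S (D.s l)) := by
  apply D.S.symm.injective
  simp only [symm_S_mul, symm_S_conv, D.S.symm_apply_apply, D.s_mul_conv]

theorem symm_S_s_mul_conv (l : L) (a b : A) :
    D.S.symm (D.s l) * D.conv a b = D.conv a (D.S.symm (D.s l) * b) := by
  apply D.S.injective
  simp only [S_mul, S_conv, D.S.apply_symm_apply, D.conv_mul_s]

theorem symm_S_s_mul_i (l : L) : D.S.symm (D.s l) * D.i = D.s l * D.i := by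
  rw [← D.conv_i (D.S.symm (D.s l) * D.i), D.symm_S_s_mul_conv_eq, D.i_conv]

theorem i_mul_S_s (l : L) : D.i * D.S (D.s l) = D.i * D.s l := by
  have h := congrArg D.S (D.symm_S_s_mul_i l)
  rw [D.S_mul, D.S_mul, D.S.apply_symm_apply, D.S_i] at h
  exact h.symm

theorem symm_S_s_eq_conv (l : L) : D.S.symm (D.s l) = D.conv 1 (D.s l * D.i) := by
  rw [← D.symm_S_s_mul_conv_eq, mul_one, D.conv_i]

theorem s_mul_symm_S_s (l l' : L) :
    D.s l * D.S.symm (D.s l') = D.S.symm (D.s l') * D.s l := by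
  rw [symm_S_s_eq_conv, D.s_mul_conv, mul_one, ← D.symm_S_s_mul_conv_eq, D.conv_i,
    ← symm_S_s_eq_conv]

theorem s_mul_S_s (l l' : L) : D.s l * D.S (D.s l') = D.S (D.s l') * D.s l := by
  have h := congrArg D.S (D.s_mul_symm_S_s l' l)
  rwa [D.S_mul, D.S_mul, D.S.apply_symm_apply] at h

theorem i_mul (a : A) : D.i * a = D.i * D.S (D.s (D.φ (D.S.symm a * D.i))) := by
  have h := congrArg D.S (D.mul_i (D.S.symm a))
  rwa [D.S_mul, D.S_mul, D.S.apply_symm_apply, D.S_i] at h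

theorem φ_symm_S_s_mul_mul_i (l : L) (a : A) :
    D.φ (D.S.symm (D.s l) * a * D.i) = D.φ (a * D.i) * l := by
  rw [mul_assoc, D.mul_i a, ← mul_assoc, ← D.s_mul_symm_S_s, mul_assoc, symm_S_s_mul_i, D.φ_s_mul,
    D.φ_s_mul, D.φ_s_mul, D.φ_i, mul_one, mul_one]

theorem φ_mul_i (a : A) : D.φ (a * D.i) = D.φ (D.i * D.S a) := by
  simpa only [D.i_conv] using D.φ_conv_mul D.i a D.i

theorem S_conv_one_mul_i (a : A) : D.S (D.conv 1 (a * D.i)) = D.s (D.φ (a * D.i)) := by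
  rw [D.S_conv, D.S_one, D.S_mul, D.S_i, D.conv_one, D.φ_mul_i]

theorem S_S_s_φ (a : A) : D.S (D.S (D.s (D.φ a))) = D.s (D.φ (D.S (D.S a))) := by
  rw [← D.conv_one, D.S_conv, D.S_conv, D.S_one, D.S_one, D.conv_one]

theorem symm_S_symm_S_s_φ (a : A) :
    D.S.symm (D.S.symm (D.s (D.φ a))) = D.s (D.φ (D.S.symm (D.S.symm a))) := by
  rw [← D.conv_one, D.symm_S_conv, D.symm_S_conv, D.symm_S_one, D.symm_S_one, D.conv_one]

theorem S_S_s (l : L) : D.S (D.S (D.s l)) = D.s (D.φ (D.S (D.S (D.s l * D.i)))) := by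
  rw [← D.S_S_s_φ, φ_s_mul_i]

theorem symm_S_symm_S_s (l : L) :
    D.S.symm (D.S.symm (D.s l)) = D.s (D.φ (D.S.symm (D.S.symm (D.s l * D.i)))) := by
  rw [← D.symm_S_symm_S_s_φ, φ_s_mul_i]

/-- The automorphism `θ` of the base ring with `s (θ l) = S⁻² (s l)`. It compares the target map of
the left bialgebroid with the source map of the right one. -/
def nakayama : L ≃+* L where
  toFun l := D.φ (D.S.symm (D.S.symm (D.s l * D.i)))
  invFun l := D.φ (D.S (D.S (D.s l * D.i)))
  left_inv l := by
    apply D.s_injective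
    rw [← D.S_S_s, ← D.symm_S_symm_S_s, D.S.apply_symm_apply, D.S.apply_symm_apply]
  right_inv l := by
    apply D.s_injective
    rw [← D.symm_S_symm_S_s, ← D.S_S_s, D.S.symm_apply_apply, D.S.symm_apply_apply]
  map_mul' l l' := by
    apply D.s_injective
    rw [← D.symm_S_symm_S_s, D.s.map_mul, D.s.map_mul, ← D.symm_S_symm_S_s, ← D.symm_S_symm_S_s,
      D.symm_S_mul, D.symm_S_mul]
  map_add' l l' := by simp only [map_add, add_mul]

theorem s_nakayama (l : L) : D.s (D.nakayama l) = D.S.symm (D.S.symm (D.s l)) :=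
  (D.symm_S_symm_S_s l).symm

theorem S_s_nakayama (l : L) : D.S (D.s (D.nakayama l)) = D.S.symm (D.s l) := by
  rw [s_nakayama, D.S.apply_symm_apply]

/-! ### Dual bases -/

/-- Dual bases of the Frobenius homomorphism `φ`: families that expand every element of `A`. -/
def IsDualBasis {n : ℕ} (y x : Fin n → A) : Prop := ∀ a, ∑ j, y j * D.s (D.φ (x j * a)) = a

theorem isDualBasis : D.IsDualBasis D.y D.x := fun a => by
  simpa only [one_mul, mul_one, D.conv_i, D.conv_one] using (D.conv_mul_mul 1 a D.i 1).symm

theorem sum_s_φ_mul_mul (a : A) : ∑ j, D.s (D.φ (a * D.y j)) * D.x j = a := by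
  simpa only [one_mul, mul_one, D.conv_i, D.conv_one] using (D.conv_mul_mul a 1 1 D.i).symm

theorem sum_conv_mul (d : A) : ∑ j, D.conv (D.y j) d * D.x j = D.conv 1 (d * D.i) := by
  simpa only [one_mul, mul_one, D.conv_i] using (D.conv_mul_mul 1 1 d D.i).symm

theorem φ_mul_left_injective {a b : A} (h : ∀ c, D.φ (a * c) = D.φ (b * c)) : a = b := by
  rw [← D.sum_s_φ_mul_mul a, ← D.sum_s_φ_mul_mul b]
  simp only [h]

namespace IsDualBasis

variable {D} {n : ℕ} {y x : Fin n → A} (h : D.IsDualBasis y x)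
include h

theorem sum_mul (a : A) : ∑ j, D.s (D.φ (a * y j)) * x j = a := by
  refine D.φ_mul_left_injective fun c => ?_
  calc D.φ ((∑ j, D.s (D.φ (a * y j)) * x j) * c)
      = D.φ (a * ∑ j, y j * D.s (D.φ (x j * c))) := by
        simp only [Finset.sum_mul, Finset.mul_sum, map_sum, mul_assoc, D.φ_s_mul]
        simp only [← mul_assoc, D.φ_mul_s]
    _ = D.φ (a * c) := by rw [h c]

theorem sum_conv_mul_s (a c : A) : ∑ j, D.conv (y j) c * D.s (D.φ (x j * a)) = D.conv a c := by
  simp only [D.conv_mul_s]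
  rw [← AddMonoidHom.finsetSum_apply, ← map_sum, h a]

theorem sum_s_mul_conv (a c : A) : ∑ j, D.s (D.φ (a * y j)) * D.conv (x j) c = D.conv a c := by
  simp only [D.s_mul_conv]
  rw [← AddMonoidHom.finsetSum_apply, ← map_sum, h.sum_mul a]

theorem symm_S_sq :
    D.IsDualBasis (fun j => D.S.symm (D.S.symm (y j))) (fun j => D.S.symm (D.S.symm (x j))) :=
  fun a => by
  obtain ⟨a, rfl⟩ := D.S.symm.surjective a
  obtain ⟨a, rfl⟩ := D.S.symm.surjective a
  conv_rhs => rw [← h a]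
  simp only [map_sum, ← D.symm_S_mul, ← D.symm_S_symm_S_s_φ]

end IsDualBasis

end Basic

/-! ### The left bialgebroid -/

section Left

variable {A L : Type*} [Ring A] [Ring L] (D : FrobeniusDoubleRing A L)

/-- The source map `s` and the target map `S⁻¹ ∘ s` of the left bialgebroid. -/
def leftST : SourceTarget A L where
  s := D.s
  t :=
    { toFun := fun l => D.S.symm (D.s l.unop)
      map_one' := by rw [MulOpposite.unop_one, map_one, D.symm_S_one]
      map_mul' := fun l l' => by rw [MulOpposite.unop_mul, map_mul, D.symm_S_mul]
      map_zero' := by rw [MulOpposite.unop_zero, map_zero, map_zero]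
      map_add' := fun l l' => by rw [MulOpposite.unop_add, map_add, map_add] }
  comm := D.s_mul_symm_S_s

@[simp] theorem leftST_s (l : L) : D.leftST.s l = D.s l := rfl

@[simp] theorem leftST_t (l : L) : D.leftST.t (.op l) = D.S.symm (D.s l) := rfl

theorem symm_S_s_mul_tmul (l : L) (a b : A) :
    BalTensor.tmul D.leftST.tLeft D.leftST.sLeft (D.S.symm (D.s l) * a) b =
      BalTensor.tmul _ _ a (D.s l * b) :=
  BalTensor.balanced (ρ := D.leftST.tLeft) (κ := D.leftST.sLeft) l a b

variable {D} in
theorem IsDualBasis.sum_tmul_conv {n m : ℕ} {y x : Fin n → A} {y' x' : Fin m → A}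
    (h : D.IsDualBasis y x) (h' : D.IsDualBasis y' x') (a : A) :
    ∑ j, BalTensor.tmul D.leftST.tLeft D.leftST.sLeft (D.S.symm (y j)) (D.conv (x j) a) =
      ∑ k, BalTensor.tmul _ _ (D.conv a (D.S.symm (y' k))) (x' k) := by
  have expand : ∀ j, BalTensor.tmul D.leftST.tLeft D.leftST.sLeft
        (D.S.symm (y j)) (D.conv (x j) a) =
      ∑ k, BalTensor.tmul _ _
        (D.S.symm (y j * D.s (D.φ (x j * D.conv (y' k) (D.S a))))) (x' k) := fun j => by
    conv_lhs => rw [← h'.sum_mul (D.conv (x j) a), BalTensor.tmul_sum]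
    simp only [← D.symm_S_s_mul_tmul, D.symm_S_mul, D.φ_conv_mul]
  simp only [expand]
  rw [Finset.sum_comm]
  refine Finset.sum_congr rfl fun k _ => ?_
  rw [← BalTensor.sum_tmul, ← map_sum, h, D.symm_S_conv, D.S.symm_apply_apply]

/-- The coproduct `a ↦ ∑ S⁻¹(yⱼ) ⊗ xⱼ ⋆ a` of the left bialgebroid. -/
noncomputable def leftγ : A →+ D.leftST.LeftTensor :=
  ∑ j, (BalTensor.tmulHom _ _ (D.S.symm (D.y j))).comp (D.conv (D.x j))

theorem leftγ_eq_conv_tmul {n : ℕ} {y x : Fin n → A} (h : D.IsDualBasis y x) (a : A) :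
    D.leftγ a = ∑ j, BalTensor.tmul _ _ (D.conv a (D.S.symm (y j))) (x j) :=
  (AddMonoidHom.finsetSum_apply _ _ _).trans (D.isDualBasis.sum_tmul_conv h a)

theorem leftγ_eq_tmul_conv {n : ℕ} {y x : Fin n → A} (h : D.IsDualBasis y x) (a : A) :
    D.leftγ a = ∑ j, BalTensor.tmul _ _ (D.S.symm (y j)) (D.conv (x j) a) := by
  rw [D.leftγ_eq_conv_tmul h, h.sum_tmul_conv h]

/-- The test map `c ⊗ d ↦ S(c) ((d p) ⋆ e)`. For `e = 1` these maps separate the points of the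
tensor product. -/
noncomputable def leftTest (p e : A) : D.leftST.LeftTensor →+ A :=
  BalTensor.lift ((AddMonoidHom.mul.comp D.S.toAddMonoidHom).compl₂
      ((D.conv.flip e).comp (AddMonoidHom.mulRight p)))
    (fun l c d => by
      change D.S (D.S.symm (D.s l) * c) * D.conv (d * p) e =
        D.S c * D.conv (D.s l * d * p) e
      rw [D.S_mul, D.S.apply_symm_apply, mul_assoc, D.s_mul_conv, mul_assoc])

@[simp] theorem leftTest_tmul (p e c d : A) :
    D.leftTest p e (BalTensor.tmul _ _ c d) = D.S c * D.conv (d * p) e := rfl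

theorem leftTest_leftγ (p e a : A) : D.leftTest p e (D.leftγ a) = D.conv p (D.S a * e) := by
  have h := D.conv_mul_mul 1 p (D.S a) e
  simp only [one_mul] at h
  rw [D.leftγ_eq_conv_tmul D.isDualBasis, map_sum, h]
  refine Finset.sum_congr rfl fun j _ => ?_
  rw [leftTest_tmul, D.S_conv, D.S.apply_symm_apply]

theorem leftTest_leftTensorMul (p e c d : A) (z : D.leftST.LeftTensor) :
    D.leftTest p e (D.leftST.leftTensorMul c d z) = D.S c * D.leftTest (d * p) e z := by
  obtain ⟨n, u, v, rfl⟩ := BalTensor.exists_sum z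
  simp only [map_sum, SourceTarget.leftTensorMul_tmul, leftTest_tmul, Finset.mul_sum, D.S_mul,
    mul_assoc]

theorem eq_sum_tmul_leftTest (z : D.leftST.LeftTensor) :
    z = ∑ k, BalTensor.tmul _ _ (D.S.symm (D.leftTest (D.y k) 1 z)) (D.x k) := by
  obtain ⟨n, u, v, rfl⟩ := BalTensor.exists_sum z
  simp only [map_sum, leftTest_tmul, BalTensor.sum_tmul, D.symm_S_mul, D.conv_one,
    D.S.symm_apply_apply, D.symm_S_s_mul_tmul]
  rw [Finset.sum_comm]
  refine Finset.sum_congr rfl fun i _ => ?_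
  rw [← BalTensor.tmul_sum, D.sum_s_φ_mul_mul]

theorem leftTensor_ext {z z' : D.leftST.LeftTensor}
    (h : ∀ p, D.leftTest p 1 z = D.leftTest p 1 z') : z = z' := by
  rw [D.eq_sum_tmul_leftTest z, D.eq_sum_tmul_leftTest z']
  simp only [h]

theorem leftγ_one : D.leftγ 1 = BalTensor.tmul _ _ 1 1 := by
  refine D.leftTensor_ext fun p => ?_
  rw [leftTest_leftγ, leftTest_tmul, D.S_one]
  simp only [one_mul]

theorem leftTensorMul_leftγ (a : A) (l : L) :
    D.leftST.leftTensorMul (D.S.symm (D.s l)) 1 (D.leftγ a) =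
      D.leftST.leftTensorMul 1 (D.s l) (D.leftγ a) := by
  refine D.leftTensor_ext fun p => ?_
  rw [leftTest_leftTensorMul, leftTest_leftTensorMul, leftTest_leftγ, leftTest_leftγ,
    D.S.apply_symm_apply, D.S_one, D.s_mul_conv, one_mul, one_mul]

theorem leftγ_mul (a : A) {b : A} {n : ℕ} {c d : Fin n → A}
    (h : D.leftγ b = ∑ i, BalTensor.tmul _ _ (c i) (d i)) :
    D.leftγ (a * b) = ∑ i, D.leftST.leftTensorMul (c i) (d i) (D.leftγ a) := by
  refine D.leftTensor_ext fun p => ?_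
  have test_b := congrArg (D.leftTest p (D.S a)) h
  rw [leftTest_leftγ] at test_b
  simp only [map_sum, leftTest_leftTensorMul, leftTest_leftγ, mul_one, D.S_mul, test_b,
    leftTest_tmul]

theorem sum_s_φ_symm_S_y_mul_conv (a : A) :
    ∑ j, D.s (D.φ (D.S.symm (D.y j) * D.i)) * D.conv (D.x j) a = a := by
  simp only [D.φ_mul_i, D.S.apply_symm_apply]
  rw [D.isDualBasis.sum_s_mul_conv, D.i_conv]

theorem sum_symm_S_s_φ_x_mul_conv (a : A) :
    ∑ j, D.S.symm (D.s (D.φ (D.x j * D.i))) * D.conv a (D.S.symm (D.y j)) = a := by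
  simp only [D.symm_S_s_mul_conv, ← D.symm_S_mul]
  rw [← map_sum, ← map_sum, D.isDualBasis, D.symm_S_i, D.conv_i]

theorem leftγ_s_mul (l : L) (a : A) : D.leftγ (D.s l * a) =
    BalTensor.mapL (D.leftST.sLeft l) (fun l' a' => D.leftST.sLeft_tLeft l l' a') (D.leftγ a) := by
  simp only [D.leftγ_eq_conv_tmul D.isDualBasis, map_sum, SourceTarget.sLeft_apply,
    BalTensor.mapL_tmul, leftST_s, D.s_mul_conv]

theorem leftγ_t_mul (l : L) (a : A) : D.leftγ (D.S.symm (D.s l) * a) =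
    BalTensor.mapR (D.leftST.tLeft l) (fun l' a' => (D.leftST.sLeft_tLeft l' l a').symm)
      (D.leftγ a) := by
  simp only [D.leftγ_eq_tmul_conv D.isDualBasis, map_sum, SourceTarget.tLeft_apply,
    BalTensor.mapR_tmul, leftST_t, D.symm_S_s_mul_conv]

/-- The left bialgebroid of a Frobenius double ring, with counit `a ↦ φ(a i)`. -/
noncomputable def left : LeftBialgebroid A L where
  toSourceTarget := D.leftST
  γ := D.leftγ
  π := D.φ.comp (AddMonoidHom.mulRight D.i)
  γ_s_mul := D.leftγ_s_mul
  γ_t_mul := D.leftγ_t_mul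
  π_s_mul l a := (congrArg D.φ (mul_assoc _ _ _)).trans (D.φ_s_mul l (a * D.i))
  π_t_mul := D.φ_symm_S_s_mul_mul_i
  coassoc := BalTensor.assoc_mapL_eq_mapR_of_mul _ D.conv_assoc
    (D.leftγ_eq_tmul_conv D.isDualBasis) (D.leftγ_eq_conv_tmul D.isDualBasis) _ _
  counit_left a := by
    rw [D.leftγ_eq_tmul_conv D.isDualBasis, map_sum]
    exact D.sum_s_φ_symm_S_y_mul_conv a
  counit_right a := by
    rw [D.leftγ_eq_conv_tmul D.isDualBasis, map_sum]
    exact D.sum_symm_S_s_φ_x_mul_conv a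
  cross := D.leftTensorMul_leftγ
  γ_one := D.leftγ_one
  γ_mul a _ _ _ _ h := D.leftγ_mul a h
  π_one := by
    change D.φ (1 * D.i) = 1
    rw [one_mul, D.φ_i]
  π_mul_s a b := by
    change D.φ (a * D.s (D.φ (b * D.i)) * D.i) = D.φ (a * b * D.i)
    rw [mul_assoc, mul_assoc, ← D.mul_i]
  π_mul_t a b := by
    change D.φ (a * D.S.symm (D.s (D.φ (b * D.i))) * D.i) = D.φ (a * b * D.i)
    rw [mul_assoc, mul_assoc, D.symm_S_s_mul_i, ← D.mul_i]

end Left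

section Hopf

variable {A L R : Type*} [Ring A] [Ring L] [Ring R] (D : FrobeniusDoubleRing A L)
  (ν : L ≃+* Rᵐᵒᵖ)

/-! ### The right bialgebroid -/

/-- The source map `S ∘ s ∘ ν⁻¹` and the target map `s ∘ ν⁻¹` of the right bialgebroid, over a ring
`R` identified with the opposite of `L` by `ν`. -/
def rightST : SourceTarget A R where
  s :=
    { toFun := fun r => D.S (D.s (ν.symm (.op r)))
      map_one' := by rw [MulOpposite.op_one, map_one, map_one, D.S_one]
      map_mul' := fun r r' => by rw [MulOpposite.op_mul, map_mul, map_mul, D.S_mul]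
      map_zero' := by rw [MulOpposite.op_zero, map_zero, map_zero, map_zero]
      map_add' := fun r r' => by rw [MulOpposite.op_add, map_add, map_add, map_add] }
  t := D.s.comp ν.symm.toRingHom
  comm r r' := (D.s_mul_S_s _ _).symm

@[simp] theorem rightST_s (r : R) : (D.rightST ν).s r = D.S (D.s (ν.symm (.op r))) := rfl

@[simp] theorem rightST_t (r : R) : (D.rightST ν).t (.op r) = D.s (ν.symm (.op r)) := rfl

theorem tmul_mul_s (l : L) (a b : A) :
    BalTensor.tmul (D.rightST ν).sRight (D.rightST ν).tRight a (b * D.s l) =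
      BalTensor.tmul _ _ (a * D.S (D.s l)) b := by
  have h := BalTensor.balanced (ρ := (D.rightST ν).sRight) (κ := (D.rightST ν).tRight)
    (ν l).unop a b
  rw [SourceTarget.sRight_apply, SourceTarget.tRight_apply, rightST_s, rightST_t,
    MulOpposite.op_unop, RingEquiv.symm_apply_apply] at h
  exact h.symm

variable {D} in
theorem IsDualBasis.sum_tmul_conv_right {n m : ℕ} {y x : Fin n → A} {y' x' : Fin m → A}
    (h : D.IsDualBasis y x) (h' : D.IsDualBasis y' x') (a : A) :
    ∑ j, BalTensor.tmul (D.rightST ν).sRight (D.rightST ν).tRight (D.S (x j)) (D.conv (y j) a) =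
      ∑ k, BalTensor.tmul _ _ (D.conv a (D.S (x' k))) (y' k) := by
  have expand : ∀ j, BalTensor.tmul (D.rightST ν).sRight (D.rightST ν).tRight
        (D.S (x j)) (D.conv (y j) a) =
      ∑ k, BalTensor.tmul _ _
        (D.S (D.s (D.φ (D.conv (x' k) (D.S.symm a) * y j)) * x j)) (y' k) := fun j => by
    conv_lhs => rw [← h' (D.conv (y j) a), BalTensor.tmul_sum]
    simp only [D.tmul_mul_s, D.S_mul, D.φ_conv_mul, D.S.apply_symm_apply]
  simp only [expand]
  rw [Finset.sum_comm]
  refine Finset.sum_congr rfl fun k _ => ?_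
  rw [← BalTensor.sum_tmul, ← map_sum, h.sum_mul, D.S_conv, D.S.apply_symm_apply]

/-- The coproduct `a ↦ ∑ S(xⱼ) ⊗ yⱼ ⋆ a` of the right bialgebroid. -/
noncomputable def rightγ : A →+ (D.rightST ν).RightTensor :=
  ∑ j, (BalTensor.tmulHom _ _ (D.S (D.x j))).comp (D.conv (D.y j))

theorem rightγ_eq_conv_tmul {n : ℕ} {y x : Fin n → A} (h : D.IsDualBasis y x) (a : A) :
    D.rightγ ν a = ∑ j, BalTensor.tmul _ _ (D.conv a (D.S (x j))) (y j) :=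
  (AddMonoidHom.finsetSum_apply _ _ _).trans (D.isDualBasis.sum_tmul_conv_right ν h a)

theorem rightγ_eq_tmul_conv {n : ℕ} {y x : Fin n → A} (h : D.IsDualBasis y x) (a : A) :
    D.rightγ ν a = ∑ j, BalTensor.tmul _ _ (D.S (x j)) (D.conv (y j) a) := by
  rw [D.rightγ_eq_conv_tmul ν h, h.sum_tmul_conv_right ν h]

/-- The test map `c ⊗ d ↦ d ((S⁻¹(c) p) ⋆ e)`. For `e = 1` these maps separate the points of the
tensor product. -/
noncomputable def rightTest (p e : A) : (D.rightST ν).RightTensor →+ A :=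
  BalTensor.lift (AddMonoidHom.mul.compl₂
      ((D.conv.flip e).comp ((AddMonoidHom.mulRight p).comp D.S.symm.toAddMonoidHom))).flip
    (fun r c d => by
      change d * D.conv (D.S.symm (c * D.S (D.s _)) * p) e =
        d * D.s (ν.symm (.op r)) * D.conv (D.S.symm c * p) e
      rw [D.symm_S_mul, D.S.symm_apply_apply, mul_assoc, mul_assoc, D.s_mul_conv])

@[simp] theorem rightTest_tmul (p e c d : A) :
    D.rightTest ν p e (BalTensor.tmul _ _ c d) = d * D.conv (D.S.symm c * p) e := rfl

theorem rightTest_rightγ (p e a : A) : D.rightTest ν p e (D.rightγ ν a) = D.conv p (a * e) := by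
  have h := D.conv_mul_mul 1 p a e
  simp only [one_mul] at h
  rw [D.rightγ_eq_tmul_conv ν D.isDualBasis, map_sum, h]
  refine Finset.sum_congr rfl fun j _ => ?_
  rw [rightTest_tmul, D.S.symm_apply_apply]

theorem rightTest_rightTensorMul (p e c d : A) (z : (D.rightST ν).RightTensor) :
    D.rightTest ν p e ((D.rightST ν).rightTensorMul c d z) =
      d * D.rightTest ν (D.S.symm c * p) e z := by
  obtain ⟨n, u, v, rfl⟩ := BalTensor.exists_sum z
  simp only [map_sum, SourceTarget.rightTensorMul_tmul, rightTest_tmul, Finset.mul_sum,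
    D.symm_S_mul, mul_assoc]

theorem eq_sum_tmul_rightTest (z : (D.rightST ν).RightTensor) :
    z = ∑ k, BalTensor.tmul _ _ (D.S (D.x k)) (D.rightTest ν (D.y k) 1 z) := by
  obtain ⟨n, u, v, rfl⟩ := BalTensor.exists_sum z
  simp only [map_sum, rightTest_tmul, BalTensor.tmul_sum, D.conv_one, D.tmul_mul_s, ← D.S_mul]
  rw [Finset.sum_comm]
  refine Finset.sum_congr rfl fun i _ => ?_
  rw [← BalTensor.sum_tmul, ← map_sum, D.sum_s_φ_mul_mul, D.S.apply_symm_apply]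

theorem rightTensor_ext {z z' : (D.rightST ν).RightTensor}
    (h : ∀ p, D.rightTest ν p 1 z = D.rightTest ν p 1 z') : z = z' := by
  rw [D.eq_sum_tmul_rightTest ν z, D.eq_sum_tmul_rightTest ν z']
  simp only [h]

theorem rightγ_one : D.rightγ ν 1 = BalTensor.tmul _ _ 1 1 := by
  refine D.rightTensor_ext ν fun p => ?_
  rw [rightTest_rightγ, rightTest_tmul, D.symm_S_one]
  simp only [one_mul]

theorem rightTensorMul_rightγ (a : A) (l : L) :
    (D.rightST ν).rightTensorMul (D.S (D.s l)) 1 (D.rightγ ν a) =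
      (D.rightST ν).rightTensorMul 1 (D.s l) (D.rightγ ν a) := by
  refine D.rightTensor_ext ν fun p => ?_
  rw [rightTest_rightTensorMul, rightTest_rightTensorMul, rightTest_rightγ, rightTest_rightγ,
    D.S.symm_apply_apply, D.symm_S_one, D.s_mul_conv, one_mul, one_mul]

theorem rightγ_mul {a : A} (b : A) {n : ℕ} {c d : Fin n → A}
    (h : D.rightγ ν a = ∑ i, BalTensor.tmul _ _ (c i) (d i)) :
    D.rightγ ν (a * b) = ∑ i, (D.rightST ν).rightTensorMul (c i) (d i) (D.rightγ ν b) := by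
  refine D.rightTensor_ext ν fun p => ?_
  have test_a := congrArg (D.rightTest ν p b) h
  rw [rightTest_rightγ] at test_a
  simp only [map_sum, rightTest_rightTensorMul, rightTest_rightγ, mul_one, test_a, rightTest_tmul]

theorem rightγ_mul_s (r : R) (a : A) : D.rightγ ν (a * D.S (D.s (ν.symm (.op r)))) =
    BalTensor.mapR ((D.rightST ν).sRight r)
      (fun r' a' => (D.rightST ν).sRight_tRight r r' a') (D.rightγ ν a) := by
  simp only [D.rightγ_eq_tmul_conv ν D.isDualBasis, map_sum, SourceTarget.sRight_apply,
    BalTensor.mapR_tmul, rightST_s, D.conv_mul_S_s]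

theorem rightγ_mul_t (r : R) (a : A) : D.rightγ ν (a * D.s (ν.symm (.op r))) =
    BalTensor.mapL ((D.rightST ν).tRight r)
      (fun r' a' => ((D.rightST ν).sRight_tRight r' r a').symm) (D.rightγ ν a) := by
  simp only [D.rightγ_eq_conv_tmul ν D.isDualBasis, map_sum, SourceTarget.tRight_apply,
    BalTensor.mapL_tmul, rightST_t, D.conv_mul_s]

/-- The counit `a ↦ ν φ(S⁻¹(a) i)` of the right bialgebroid. -/
def rightπ : A →+ R :=
  (MulOpposite.opAddEquiv.symm.toAddMonoidHom.comp ν.toRingHom.toAddMonoidHom).comp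
    (D.φ.comp ((AddMonoidHom.mulRight D.i).comp D.S.symm.toAddMonoidHom))

theorem rightπ_apply (a : A) : D.rightπ ν a = (ν (D.φ (D.S.symm a * D.i))).unop := rfl

theorem symm_op_rightπ (a : A) : ν.symm (.op (D.rightπ ν a)) = D.φ (D.S.symm a * D.i) := by
  rw [rightπ_apply, MulOpposite.op_unop, RingEquiv.symm_apply_apply]

theorem sum_conv_mul_s_φ_x_mul (a : A) :
    ∑ j, D.conv (D.y j) a * D.s (D.φ (D.x j * D.i)) = a := by
  rw [D.isDualBasis.sum_conv_mul_s, D.i_conv]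

theorem sum_conv_mul_S_s_φ_symm_S_y_mul (a : A) :
    ∑ j, D.conv a (D.S (D.x j)) * D.S (D.s (D.φ (D.S.symm (D.y j) * D.i))) = a := by
  simp only [D.conv_mul_S_s, ← D.S_mul, D.φ_mul_i, D.S.apply_symm_apply]
  rw [← map_sum, ← map_sum, D.isDualBasis.sum_mul, D.S_i, D.conv_i]

/-- The right bialgebroid of a Frobenius double ring. -/
noncomputable def right : RightBialgebroid A R where
  toSourceTarget := D.rightST ν
  γ := D.rightγ ν
  π := D.rightπ ν
  γ_mul_s := D.rightγ_mul_s ν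
  γ_mul_t := D.rightγ_mul_t ν
  π_mul_s r a := by
    change D.rightπ ν (a * D.S (D.s (ν.symm (.op r)))) = _
    rw [rightπ_apply, rightπ_apply, D.symm_S_mul, D.S.symm_apply_apply, mul_assoc, D.φ_s_mul,
      map_mul, RingEquiv.apply_symm_apply, MulOpposite.unop_mul, MulOpposite.unop_op]
  π_mul_t r a := by
    change D.rightπ ν (a * D.s (ν.symm (.op r))) = _
    rw [rightπ_apply, rightπ_apply, D.symm_S_mul, D.φ_symm_S_s_mul_mul_i,
      map_mul, RingEquiv.apply_symm_apply, MulOpposite.unop_mul, MulOpposite.unop_op]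
  coassoc := BalTensor.assoc_mapL_eq_mapR_of_mul _ D.conv_assoc
    (D.rightγ_eq_tmul_conv ν D.isDualBasis) (D.rightγ_eq_conv_tmul ν D.isDualBasis) _ _
  counit_left a := by
    rw [D.rightγ_eq_tmul_conv ν D.isDualBasis, map_sum]
    change ∑ j, D.conv (D.y j) a * D.s (ν.symm (.op (D.rightπ ν (D.S (D.x j))))) = a
    simp only [symm_op_rightπ, D.S.symm_apply_apply, D.sum_conv_mul_s_φ_x_mul]
  counit_right a := by
    rw [D.rightγ_eq_conv_tmul ν D.isDualBasis, map_sum]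
    change ∑ j, D.conv a (D.S (D.x j)) * D.S (D.s (ν.symm (.op (D.rightπ ν (D.y j))))) = a
    simp only [symm_op_rightπ, D.sum_conv_mul_S_s_φ_symm_S_y_mul]
  cross a r := D.rightTensorMul_rightγ ν a (ν.symm (.op r))
  γ_one := D.rightγ_one ν
  γ_mul _ b _ _ _ h := D.rightγ_mul ν b h
  π_one := by
    rw [rightπ_apply, D.symm_S_one, one_mul, D.φ_i, map_one, MulOpposite.unop_one]
  π_s_mul a b := by
    change D.rightπ ν (D.S (D.s (ν.symm (.op (D.rightπ ν a)))) * b) = _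
    rw [symm_op_rightπ, rightπ_apply, rightπ_apply, D.symm_S_mul, D.symm_S_mul,
      D.S.symm_apply_apply, mul_assoc, mul_assoc, ← D.mul_i]
  π_t_mul a b := by
    change D.rightπ ν (D.s (ν.symm (.op (D.rightπ ν a))) * b) = _
    rw [symm_op_rightπ, rightπ_apply, rightπ_apply, D.symm_S_mul, D.symm_S_mul,
      mul_assoc, mul_assoc, D.symm_S_s_mul_i, ← D.mul_i]

theorem left_γ_eq_conv_tmul {n : ℕ} {y x : Fin n → A} (h : D.IsDualBasis y x) (a : A) :
    D.left.γ a = ∑ j, BalTensor.tmul D.left.tLeft D.left.sLeft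
      (D.conv a (D.S.symm (y j))) (x j) :=
  D.leftγ_eq_conv_tmul h a

theorem left_γ_eq_tmul_conv {n : ℕ} {y x : Fin n → A} (h : D.IsDualBasis y x) (a : A) :
    D.left.γ a = ∑ j, BalTensor.tmul D.left.tLeft D.left.sLeft
      (D.S.symm (y j)) (D.conv (x j) a) :=
  D.leftγ_eq_tmul_conv h a

theorem right_γ_eq_conv_tmul {n : ℕ} {y x : Fin n → A} (h : D.IsDualBasis y x) (a : A) :
    (D.right ν).γ a = ∑ j, BalTensor.tmul (D.right ν).sRight (D.right ν).tRight
      (D.conv a (D.S (x j))) (y j) :=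
  D.rightγ_eq_conv_tmul ν h a

theorem right_γ_eq_tmul_conv {n : ℕ} {y x : Fin n → A} (h : D.IsDualBasis y x) (a : A) :
    (D.right ν).γ a = ∑ j, BalTensor.tmul (D.right ν).sRight (D.right ν).tRight
      (D.S (x j)) (D.conv (y j) a) :=
  D.rightγ_eq_tmul_conv ν h a

/-! ### The Hopf algebroid -/

theorem antipode_left (a : A) :
    ∑ j, D.S (D.conv a (D.S.symm (D.y j))) * D.x j = D.S (D.s (D.φ (D.S.symm a * D.i))) := by
  simp only [D.S_conv, D.S.apply_symm_apply]
  rw [D.sum_conv_mul, D.φ_mul_i, D.S.apply_symm_apply, ← D.conv_one, D.S_conv, D.S_one, D.S_mul,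
    D.S_i]

theorem antipode_right (a : A) :
    ∑ j, D.S (D.x j) * D.S (D.conv (D.y j) a) = D.s (D.φ (a * D.i)) := by
  simp only [← D.S_mul]
  rw [← map_sum, D.sum_conv_mul, D.S_conv_one_mul_i]

/-- The Hopf algebroid of a Frobenius double ring. -/
noncomputable abbrev hopf : HopfAlgebroid A L R where
  left := D.left
  right := D.right ν
  S := D.S
  base_iso := ⟨(RingEquiv.opOp R).trans (RingEquiv.op ν).symm⟩
  range_s := (ν.symm.surjective.range_comp D.s).symm
  range_t := by
    ext a
    constructor
    · rintro ⟨⟨l⟩, rfl⟩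
      refine ⟨(ν (D.nakayama l)).unop, Eq.trans ?_ (D.S_s_nakayama l)⟩
      exact congrArg (fun l => D.S (D.s l)) (ν.symm_apply_apply _)
    · rintro ⟨r, rfl⟩
      refine ⟨.op (D.nakayama.symm (ν.symm (.op r))), (D.S_s_nakayama _).symm.trans ?_⟩
      exact congrArg (fun l => D.S (D.s l)) (D.nakayama.apply_symm_apply _)
  coassoc_left_right := BalTensor.assoc_mapL_eq_mapR_of_mul _ D.conv_assoc
    (D.leftγ_eq_tmul_conv D.isDualBasis) (D.rightγ_eq_conv_tmul ν D.isDualBasis) _ _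
  coassoc_right_left := BalTensor.assoc_mapL_eq_mapR_of_mul _ D.conv_assoc
    (D.rightγ_eq_tmul_conv ν D.isDualBasis) (D.leftγ_eq_conv_tmul D.isDualBasis) _ _
  S_left l l' a := by
    change D.S (D.S.symm (D.s l) * a * D.S.symm (D.s l')) = D.s l' * D.S a * D.s l
    rw [D.S_mul, D.S_mul, D.S.apply_symm_apply, D.S.apply_symm_apply, mul_assoc]
  S_right r r' a := by
    change D.S (D.s (ν.symm (.op r')) * a * D.s (ν.symm (.op r))) =
      D.S (D.s _) * D.S a * D.S (D.s _)
    rw [D.S_mul, D.S_mul, mul_assoc]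
  antipode_left a := by
    change BalTensor.lift _ _ (D.leftγ a) = D.S (D.s (ν.symm (.op (D.rightπ ν a))))
    rw [symm_op_rightπ, D.leftγ_eq_conv_tmul D.isDualBasis, map_sum]
    exact D.antipode_left a
  antipode_right a := by
    change BalTensor.lift _ _ (D.rightγ ν a) = D.s (D.φ (a * D.i))
    rw [D.rightγ_eq_tmul_conv ν D.isDualBasis, map_sum]
    exact D.antipode_right a

/-! ### The integral -/

/-- The functional `c ↦ ν φ(S⁻¹(c) a)`. It is the preimage of `a` under `ψ ↦ ψ ⇀ i`. -/
def functional (a : A) : (D.right ν).Dual :=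
  ⟨(MulOpposite.opAddEquiv.symm.toAddMonoidHom.comp ν.toRingHom.toAddMonoidHom).comp
    (D.φ.comp ((AddMonoidHom.mulRight a).comp D.S.symm.toAddMonoidHom)), fun c r => by
    change (ν (D.φ (D.S.symm (c * D.S (D.s (ν.symm (.op r)))) * a))).unop =
      (ν (D.φ (D.S.symm c * a))).unop * r
    rw [D.symm_S_mul, D.S.symm_apply_apply, mul_assoc, D.φ_s_mul,
      map_mul, RingEquiv.apply_symm_apply, MulOpposite.unop_mul, MulOpposite.unop_op]⟩

theorem functional_apply (a c : A) : D.functional ν a c = (ν (D.φ (D.S.symm c * a))).unop := rfl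

theorem symm_op_functional (a c : A) :
    ν.symm (.op (D.functional ν a c)) = D.φ (D.S.symm c * a) := by
  rw [functional_apply, MulOpposite.op_unop, RingEquiv.symm_apply_apply]

theorem act_eq_sum (ψ : (D.right ν).Dual) (a : A) :
    ψ.act a = ∑ j, D.conv (D.y j) a * D.s (ν.symm (.op (ψ (D.S (D.x j))))) := by
  rw [RightBialgebroid.Dual.act, AddMonoidHom.comp_apply, D.right_γ_eq_tmul_conv ν D.isDualBasis,
    map_sum]
  exact Finset.sum_congr rfl fun j _ => RightBialgebroid.Dual.actTensor_tmul ..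

theorem act_functional (a c : A) : (D.functional ν a).act c = D.conv a c := by
  simp only [act_eq_sum, symm_op_functional, D.S.symm_apply_apply, D.isDualBasis.sum_conv_mul_s]

variable {D ν} in
theorem dual_apply_mul_S_s (ψ : (D.right ν).Dual) (a : A) (l : L) :
    ψ (a * D.S (D.s l)) = ψ a * (ν l).unop := by
  have h := ψ.map_mul_s a (ν l).unop
  rwa [show (D.right ν).s (ν l).unop = D.S (D.s (ν.symm (.op (ν l).unop))) from rfl,
    MulOpposite.op_unop, RingEquiv.symm_apply_apply] at h

theorem functional_act_i (ψ : (D.right ν).Dual) : D.functional ν (ψ.act D.i) = ψ := by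
  ext c
  have pull_in : ∀ j,
      (ν (D.φ (D.S.symm c * (D.y j * D.s (ν.symm (.op (ψ (D.S (D.x j))))))))).unop =
        ψ (D.S (D.s (D.φ (D.S.symm c * D.y j)) * D.x j)) := fun j => by
    rw [← mul_assoc, D.φ_mul_s, map_mul, MulOpposite.unop_mul, RingEquiv.apply_symm_apply,
      MulOpposite.unop_op, D.S_mul, dual_apply_mul_S_s]
  simp only [functional_apply, act_eq_sum, D.conv_i, Finset.mul_sum, map_sum, Finset.unop_sum,
    pull_in]
  rw [← map_sum, ← map_sum, D.sum_s_φ_mul_mul, D.S.apply_symm_apply]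

/-- The functional `c ↦ ν φ(S⁻¹(a) c)`. It is the preimage of `a` under the second map in the
definition of a non-degenerate integral. -/
def coFunctional (a : A) : (D.right ν).coDual :=
  ⟨(MulOpposite.opAddEquiv.symm.toAddMonoidHom.comp ν.toRingHom.toAddMonoidHom).comp
    (D.φ.comp (AddMonoidHom.mulLeft (D.S.symm a))), fun c r => by
    change (ν (D.φ (D.S.symm a * (c * D.s (ν.symm (.op r)))))).unop =
      r * (ν (D.φ (D.S.symm a * c))).unop
    rw [← mul_assoc, D.φ_mul_s,
      map_mul, RingEquiv.apply_symm_apply, MulOpposite.unop_mul, MulOpposite.unop_op]⟩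

theorem coFunctional_apply (a c : A) :
    (D.coFunctional ν a).1 c = (ν (D.φ (D.S.symm a * c))).unop := rfl

theorem coAct_i (χ : (D.right ν).coDual) :
    (D.right ν).coAct χ D.i = ∑ j, D.S (D.x j) * D.S (D.s (ν.symm (.op (χ.1 (D.y j))))) := by
  rw [RightBialgebroid.coAct, AddMonoidHom.comp_apply, D.right_γ_eq_tmul_conv ν D.isDualBasis,
    map_sum]
  refine Finset.sum_congr rfl fun j _ => ?_
  rw [D.conv_i]
  rfl

variable {D ν} in
theorem coDual_apply_mul_s (χ : (D.right ν).coDual) (a : A) (l : L) :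
    χ.1 (a * D.s l) = (ν l).unop * χ.1 a := by
  have h := χ.2 a (ν l).unop
  rwa [show (D.right ν).t (.op (ν l).unop) = D.s (ν.symm (.op (ν l).unop)) from rfl,
    MulOpposite.op_unop, RingEquiv.symm_apply_apply] at h

theorem coFunctional_coAct_i (χ : (D.right ν).coDual) :
    D.coFunctional ν ((D.right ν).coAct χ D.i) = χ := by
  refine Subtype.ext (AddMonoidHom.ext fun c => ?_)
  have pull_in : ∀ j, (ν (D.φ (D.S.symm (D.S (D.x j) *
        D.S (D.s (ν.symm (.op (χ.1 (D.y j)))))) * c))).unop =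
      χ.1 (D.y j * D.s (D.φ (D.x j * c))) := fun j => by
    rw [← D.S_mul, D.S.symm_apply_apply, mul_assoc, D.φ_s_mul, map_mul, MulOpposite.unop_mul,
      RingEquiv.apply_symm_apply, MulOpposite.unop_op, coDual_apply_mul_s]
  simp only [coFunctional_apply, coAct_i, map_sum, Finset.sum_mul, Finset.unop_sum, pull_in]
  rw [← map_sum, D.isDualBasis]

theorem coAct_coFunctional_i (a : A) : (D.right ν).coAct (D.coFunctional ν a) D.i = a := by
  simp only [coAct_i, coFunctional_apply, MulOpposite.op_unop, RingEquiv.symm_apply_apply,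
    ← D.S_mul]
  rw [← map_sum, D.sum_s_φ_mul_mul, D.S.apply_symm_apply]

theorem isNondegenerateIntegral : (D.hopf ν).IsNondegenerateIntegral D.i where
  left_integral a := D.mul_i a
  right_integral a := by
    refine (D.i_mul a).trans ?_
    rw [← D.symm_op_rightπ ν]
    rfl
  bijective_act := Function.bijective_iff_has_inverse.2 ⟨D.functional ν, D.functional_act_i ν,
    fun a => (D.act_functional ν a D.i).trans (D.conv_i a)⟩
  bijective_coAct := Function.bijective_iff_has_inverse.2 ⟨D.coFunctional ν,
    D.coFunctional_coAct_i ν, D.coAct_coFunctional_i ν⟩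

variable {D ν}

theorem iR_functional (hi : (D.hopf ν).IsNondegenerateIntegral D.i) (a : A) :
    hi.iR (D.functional ν a) = a :=
  (D.act_functional ν a D.i).trans (D.conv_i a)

theorem iR_symm (hi : (D.hopf ν).IsNondegenerateIntegral D.i) (a : A) :
    hi.iR.symm a = D.functional ν a := by
  rw [Equiv.symm_apply_eq, iR_functional]

end Hopf

/-! ### The dual double ring -/

section Exchange

variable {A L : Type*} [Ring A] [Ring L] (D : FrobeniusDoubleRing A L)

theorem sum_conv_mul_conv_mul_conv (c q w p : A) :
    ∑ j, D.conv (c * D.conv (D.y j) q) w * D.conv (D.x j) p =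
      D.conv c (w * D.conv (D.S.symm q) p) := by
  have expand : ∀ j, D.conv (c * D.conv (D.y j) q) w =
      ∑ k, D.conv (c * D.y k) w * D.s (D.φ (D.conv (D.x k) (D.S.symm q) * D.y j)) := fun j => by
    conv_lhs => rw [← D.isDualBasis (D.conv (D.y j) q)]
    simp only [Finset.mul_sum, map_sum, AddMonoidHom.finsetSum_apply, ← mul_assoc,
      ← D.conv_mul_s, D.φ_conv_mul, D.S.apply_symm_apply]
  calc ∑ j, D.conv (c * D.conv (D.y j) q) w * D.conv (D.x j) p
      = ∑ k, D.conv (c * D.y k) w *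
          ∑ j, D.s (D.φ (D.conv (D.x k) (D.S.symm q) * D.y j)) * D.conv (D.x j) p := by
        simp only [expand, Finset.sum_mul, Finset.mul_sum, mul_assoc]
        exact Finset.sum_comm
    _ = ∑ k, D.conv (c * D.y k) w * D.conv (D.x k * 1) (D.conv (D.S.symm q) p) := by
        simp only [D.isDualBasis.sum_s_mul_conv, D.conv_assoc, mul_one]
    _ = D.conv c (w * D.conv (D.S.symm q) p) := by rw [← D.conv_mul_mul, mul_one]

theorem conv_mul_conv (d c p q : A) :
    D.conv d c * D.conv p q =
      ∑ j, D.conv (d * D.conv p (D.S (D.x j))) (c * D.conv (D.y j) q) := by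
  refine D.φ_mul_left_injective fun w => ?_
  have reverse : ∀ j, D.conv p (D.S (D.x j)) * D.conv w (D.S (c * D.conv (D.y j) q)) =
      D.S (D.conv (c * D.conv (D.y j) q) (D.S.symm w) * D.conv (D.x j) (D.S.symm p)) := fun j => by
    simp only [D.S_mul, D.S_conv, D.S.apply_symm_apply]
  symm
  calc D.φ ((∑ j, D.conv (d * D.conv p (D.S (D.x j))) (c * D.conv (D.y j) q)) * w)
      = D.φ (d * D.S (∑ j, D.conv (c * D.conv (D.y j) q) (D.S.symm w) *
          D.conv (D.x j) (D.S.symm p))) := by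
        simp only [Finset.sum_mul, map_sum, D.φ_conv_mul, mul_assoc, reverse, Finset.mul_sum]
    _ = D.φ (d * D.conv (D.conv p q * w) (D.S c)) := by
        rw [D.sum_conv_mul_conv_mul_conv, ← D.symm_S_conv, ← D.symm_S_mul, D.S_conv,
          D.S.apply_symm_apply]
    _ = D.φ (D.conv d c * D.conv p q * w) := by rw [← D.φ_conv_mul, mul_assoc]

theorem i_mul_s_conv (l : L) (a : A) : D.conv (D.i * D.s l) a = a * D.s l := by
  rw [← D.conv_mul_s, D.i_conv]

theorem conv_i_mul_s (l : L) (a : A) : D.conv a (D.i * D.s l) = a * D.S (D.s l) := by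
  rw [← D.i_mul_S_s, ← D.conv_mul_S_s, D.conv_i]

theorem s_mul_i_conv (l : L) (a : A) : D.conv (D.s l * D.i) a = D.s l * a := by
  rw [← D.s_mul_conv, D.i_conv]

theorem conv_s_mul_i (l : L) (a : A) : D.conv a (D.s l * D.i) = D.S.symm (D.s l) * a := by
  rw [← D.symm_S_s_mul_conv_eq, D.conv_i]

theorem symm_S_i_mul_s (l : L) : D.S.symm (D.i * D.s l) = D.s l * D.i := by
  rw [D.symm_S_mul, D.symm_S_i, D.symm_S_s_mul_i]

theorem conv_one_left (a : A) : D.conv 1 a = D.S.symm (D.s (D.φ (D.S a))) := by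
  rw [← D.conv_one, D.symm_S_conv, D.symm_S_one, D.S.symm_apply_apply]

end Exchange

section Dual

variable {A B L R : Type*} [Ring A] [Ring B] [Ring L] [Ring R] (D : FrobeniusDoubleRing A L)
  (ν : L ≃+* Rᵐᵒᵖ)

/-- The identification of the right base ring with the opposite of the left one that turns the dual
double ring into a Hopf algebroid. It differs from `ν` by the automorphism `D.nakayama`. -/
def dualBase : R ≃+* Lᵐᵒᵖ :=
  (RingEquiv.opOp R).trans (RingEquiv.op (ν.symm.trans D.nakayama.symm))

theorem dualBase_unop_ν (l : L) :
    D.dualBase ν (ν l).unop = .op (D.nakayama.symm l) := by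
  change MulOpposite.op (D.nakayama.symm (ν.symm (.op (ν l).unop))) = _
  rw [MulOpposite.op_unop, RingEquiv.symm_apply_apply]

theorem dualBase_symm_op (l : L) :
    (D.dualBase ν).symm (.op l) = (ν (D.nakayama l)).unop := rfl

theorem rightπ_conv (a b : A) :
    D.rightπ ν (D.conv a b) = (ν (D.φ (D.S.symm b * a))).unop := by
  rw [rightπ_apply, D.symm_S_conv, D.φ_conv_mul, D.S.apply_symm_apply, D.i_conv]

variable {F : A ≃+ B} (hF : ∀ a b, F (D.conv a b) = F a * F b)

include hF in
theorem map_i_of_map_conv : F D.i = 1 := by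
  have h := hF D.i (F.symm 1)
  rwa [D.i_conv, F.apply_symm_apply, mul_one, eq_comm] at h

variable (F) in
/-- The multiplication of `A`, reversed and transported along `F`. -/
def dualConv : B →+ B →+ B :=
  (((AddMonoidHom.mul.flip.compr₂ F.toAddMonoidHom).compl₂ F.symm.toAddMonoidHom).comp
    F.symm.toAddMonoidHom)

theorem dualConv_map (a b : A) : dualConv F (F a) (F b) = F (b * a) := by
  change F (F.symm (F b) * F.symm (F a)) = F (b * a)
  rw [F.symm_apply_apply, F.symm_apply_apply]

/-- The source map `ν l ↦ F(i s(l))` of the dual double ring. -/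
def dualSource : R →+* B where
  toFun r := F (D.i * D.s (ν.symm (.op r)))
  map_one' := by
    rw [MulOpposite.op_one, map_one, map_one, mul_one, D.map_i_of_map_conv hF]
  map_mul' r r' := by
    rw [MulOpposite.op_mul, map_mul ν.symm, map_mul D.s, ← hF, D.i_mul_s_conv, mul_assoc]
  map_zero' := by rw [MulOpposite.op_zero, map_zero, map_zero, mul_zero, map_zero]
  map_add' r r' := by rw [MulOpposite.op_add, map_add, map_add, mul_add, map_add]

theorem dualSource_apply (r : R) :
    D.dualSource ν hF r = F (D.i * D.s (ν.symm (.op r))) := rfl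

theorem dualSource_ν (l : L) : D.dualSource ν hF (ν l).unop = F (D.i * D.s l) := by
  rw [dualSource_apply, MulOpposite.op_unop, RingEquiv.symm_apply_apply]

theorem dualSource_rightπ (a : A) : D.dualSource ν hF (D.rightπ ν a) = F (D.i * a) := by
  rw [rightπ_apply, dualSource_ν, ← D.i_mul_S_s, ← D.i_mul]

/-- The double ring with the two products exchanged, on a ring `B` that models the second product
of `A` through `F`. -/
def dual : FrobeniusDoubleRing B R where
  conv := dualConv F
  i := F 1
  S := (F.symm.trans D.S).trans F
  s := D.dualSource ν hF
  φ := (D.rightπ ν).comp F.symm.toAddMonoidHom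
  rank := D.rank
  y j := F (D.S (D.x j))
  x j := F (D.y j)
  conv_assoc := F.surjective.forall₃.2 fun a b c => by simp only [dualConv_map, mul_assoc]
  i_conv := F.surjective.forall.2 fun a => by rw [dualConv_map, mul_one]
  conv_i := F.surjective.forall.2 fun a => by rw [dualConv_map, one_mul]
  S_mul := F.surjective.forall₂.2 fun a b => by
    simp only [← hF, AddEquiv.trans_apply, F.symm_apply_apply, D.S_conv]
  S_conv := F.surjective.forall₂.2 fun a b => by
    simp only [dualConv_map, AddEquiv.trans_apply, F.symm_apply_apply, D.S_mul]
  conv_one := F.surjective.forall.2 fun a => by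
    change _ = D.dualSource ν hF (D.rightπ ν (F.symm (F a)))
    rw [← D.map_i_of_map_conv hF, dualConv_map, F.symm_apply_apply, dualSource_rightπ]
  s_mul_conv r := F.surjective.forall₂.2 fun a b => by
    simp only [dualSource_apply, dualConv_map, ← hF, D.i_mul_s_conv, mul_assoc]
  conv_mul_s r := F.surjective.forall₂.2 fun a b => by
    simp only [dualSource_apply, dualConv_map, ← hF, D.conv_i_mul_s, mul_assoc]
  symm_S_s_mul_conv_eq r := F.surjective.forall₂.2 fun a b => by
    change dualConv F (F (D.S.symm (F.symm (D.dualSource ν hF r))) * F a) (F b) = _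
    simp only [dualSource_apply, F.symm_apply_apply, ← hF, D.symm_S_i_mul_s, D.s_mul_i_conv,
      dualConv_map, D.i_mul_s_conv, mul_assoc]
  φ_s_mul r := F.surjective.forall.2 fun a => by
    change D.rightπ ν (F.symm (D.dualSource ν hF r * F a)) = r * D.rightπ ν (F.symm (F a))
    simp only [dualSource_apply, ← hF, F.symm_apply_apply, D.i_mul_s_conv]
    exact (D.right ν).π_mul_t r a
  φ_i := (congrArg (D.rightπ ν) (F.symm_apply_apply 1)).trans (D.right ν).π_one
  mul_i := F.surjective.forall.2 fun a => by
    change _ = D.dualSource ν hF (D.rightπ ν (F.symm (F a * F 1))) * F 1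
    rw [← hF, F.symm_apply_apply, dualSource_rightπ, ← hF, D.conv_one, D.i_mul_s_conv, one_mul]
  φ_conv_mul := F.surjective.forall₃.2 fun a b c => by
    change D.rightπ ν (F.symm (dualConv F (F a) (F b) * F c)) =
      D.rightπ ν (F.symm (F a * dualConv F (F c) (F (D.S (F.symm (F b))))))
    simp only [dualConv_map, ← hF, F.symm_apply_apply, rightπ_conv, D.symm_S_mul,
      D.S.symm_apply_apply, mul_assoc]
  conv_mul_mul := F.surjective.forall₂.2 fun p q => F.surjective.forall₂.2 fun d c => by
    simp only [← hF, dualConv_map, D.conv_mul_conv d c p q, map_sum]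

@[simp] theorem dual_conv (a b : A) : (D.dual ν hF).conv (F a) (F b) = F (b * a) :=
  dualConv_map a b

@[simp] theorem dual_S (a : A) : (D.dual ν hF).S (F a) = F (D.S a) :=
  congrArg (fun c => F (D.S c)) (F.symm_apply_apply a)

@[simp] theorem dual_symm_S (a : A) : (D.dual ν hF).S.symm (F a) = F (D.S.symm a) :=
  congrArg (fun c => F (D.S.symm c)) (F.symm_apply_apply a)

theorem dual_s_ν (l : L) : (D.dual ν hF).s (ν l).unop = F (D.i * D.s l) := D.dualSource_ν ν hF l

theorem dual_s_dualBase (l : L) :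
    (D.dual ν hF).s ((D.dualBase ν).symm (.op l)) = F (D.i * D.S.symm (D.s l)) := by
  rw [dualBase_symm_op, dual_s_ν, ← D.i_mul_S_s, D.S_s_nakayama]

theorem dual_S_s_dualBase (l : L) :
    (D.dual ν hF).S ((D.dual ν hF).s ((D.dualBase ν).symm (.op l))) = F (D.s l * D.i) := by
  rw [dual_s_dualBase, dual_S, D.S_mul, D.S.apply_symm_apply, D.S_i]

theorem dual_s_ν_mul (l : L) (a : A) :
    (D.dual ν hF).s (ν l).unop * F a = F (a * D.s l) := by
  rw [dual_s_ν, ← hF, D.i_mul_s_conv]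

theorem dual_symm_S_s_ν_mul (l : L) (a : A) :
    (D.dual ν hF).S.symm ((D.dual ν hF).s (ν l).unop) * F a = F (D.s l * a) := by
  rw [dual_s_ν, dual_symm_S, ← hF, D.symm_S_i_mul_s, D.s_mul_i_conv]

theorem mul_dual_s_dualBase (l : L) (a : A) :
    F a * (D.dual ν hF).s ((D.dualBase ν).symm (.op l)) = F (a * D.S.symm (D.s l)) := by
  rw [dualBase_symm_op, dual_s_ν, ← hF, D.conv_i_mul_s, D.S_s_nakayama]

theorem mul_dual_S_s_dualBase (l : L) (a : A) :
    F a * (D.dual ν hF).S ((D.dual ν hF).s ((D.dualBase ν).symm (.op l))) =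
      F (D.S.symm (D.s l) * a) := by
  rw [dual_S_s_dualBase, ← hF, D.conv_s_mul_i]

variable {D} in
theorem IsDualBasis.dual {n : ℕ} {y x : Fin n → A} (h : D.IsDualBasis y x) :
    (D.dual ν hF).IsDualBasis (fun j => F (D.S (x j))) (fun j => F (y j)) :=
  F.surjective.forall.2 fun a => by
  have dual_s_φ : ∀ c, (D.dual ν hF).s ((D.dual ν hF).φ (F c)) = F (D.i * c) := fun c => by
    rw [← (D.dual ν hF).conv_one, ← D.map_i_of_map_conv hF, dual_conv]
  have expand : ∀ j, D.conv (D.S (x j)) (D.i * D.conv (y j) a) =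
      D.S (D.s (D.φ (D.S.symm a * y j)) * x j) := fun j => by
    rw [D.i_mul, ← D.conv_mul_S_s, D.conv_i, D.symm_S_conv, D.φ_conv_mul, D.S.apply_symm_apply,
      D.i_conv, D.S_mul]
  simp only [← hF, dual_s_φ, expand]
  rw [← map_sum, ← map_sum, h.sum_mul, D.S.apply_symm_apply]

theorem dual_left_γ_eq_conv_tmul {n : ℕ} {y x : Fin n → A} (h : D.IsDualBasis y x) (b : B) :
    (D.dual ν hF).left.γ b = ∑ j, BalTensor.tmul _ _
      ((D.dual ν hF).conv b (F (x j))) (F (y j)) := by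
  simp only [(D.dual ν hF).left_γ_eq_conv_tmul (h.dual ν hF), dual_symm_S, D.S.symm_apply_apply]

theorem dual_left_γ_eq_tmul_conv {n : ℕ} {y x : Fin n → A} (h : D.IsDualBasis y x) (b : B) :
    (D.dual ν hF).left.γ b = ∑ j, BalTensor.tmul _ _
      (F (x j)) ((D.dual ν hF).conv (F (y j)) b) := by
  simp only [(D.dual ν hF).left_γ_eq_tmul_conv (h.dual ν hF), dual_symm_S, D.S.symm_apply_apply]

theorem dual_right_γ_eq_conv_tmul (β : R ≃+* Lᵐᵒᵖ) {n : ℕ} {y x : Fin n → A}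
    (h : D.IsDualBasis y x) (b : B) :
    ((D.dual ν hF).right β).γ b = ∑ j, BalTensor.tmul _ _
      ((D.dual ν hF).conv b (F (D.S.symm (y j)))) (F (D.S.symm (x j))) := by
  simp only [(D.dual ν hF).right_γ_eq_conv_tmul β (h.symm_S_sq.dual ν hF), dual_S,
    D.S.apply_symm_apply]

theorem dual_right_γ_eq_tmul_conv (β : R ≃+* Lᵐᵒᵖ) {n : ℕ} {y x : Fin n → A}
    (h : D.IsDualBasis y x) (b : B) :
    ((D.dual ν hF).right β).γ b = ∑ j, BalTensor.tmul _ _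
      (F (D.S.symm (y j))) ((D.dual ν hF).conv (F (D.S.symm (x j))) b) := by
  simp only [(D.dual ν hF).right_γ_eq_tmul_conv β (h.symm_S_sq.dual ν hF), dual_S,
    D.S.apply_symm_apply]

theorem dual_left_π (a : A) : (D.dual ν hF).left.π (F a) = (ν (D.φ a)).unop := by
  change D.rightπ ν (F.symm (F a * F 1)) = _
  rw [← hF, F.symm_apply_apply, rightπ_conv, D.symm_S_one, one_mul]

theorem dual_right_π (a : A) :
    ((D.dual ν hF).right (D.dualBase ν)).π (F a) = D.φ (D.S a) := by
  change (D.dualBase ν ((D.dual ν hF).left.π ((D.dual ν hF).S.symm (F a)))).unop = _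
  rw [dual_symm_S, dual_left_π, dualBase_unop_ν, MulOpposite.unop_op, RingEquiv.symm_apply_eq]
  apply D.s_injective
  rw [s_nakayama, symm_S_symm_S_s_φ, D.S.symm_apply_apply]

theorem dual_left_γ_of_right_γ_i (a : A) {n : ℕ} {u v : Fin n → A}
    (h : (D.right ν).γ D.i = ∑ j, BalTensor.tmul _ _ (u j) (v j)) :
    (D.dual ν hF).left.γ (F a) =
      ∑ j, BalTensor.tmul _ _ (F (D.S.symm (u j) * a)) (F (v j)) := by
  let T : (D.right ν).RightTensor →+ (D.dual ν hF).left.LeftTensor := BalTensor.lift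
    (((BalTensor.tmulHom _ _).comp (F.toAddMonoidHom.comp
      ((AddMonoidHom.mulRight a).comp D.S.symm.toAddMonoidHom))).compl₂ F.toAddMonoidHom)
    (fun r c d => by
      change BalTensor.tmul _ _ (F (D.S.symm (c * D.S (D.s (ν.symm (.op r)))) * a)) (F d) =
        BalTensor.tmul _ _ (F (D.S.symm c * a)) (F (d * D.s (ν.symm (.op r))))
      rw [← D.dual_s_ν_mul ν hF, D.symm_S_mul, D.S.symm_apply_apply, mul_assoc,
        ← D.dual_symm_S_s_ν_mul ν hF]
      exact (D.dual ν hF).symm_S_s_mul_tmul _ _ _)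
  have T_tmul : ∀ c d, T (BalTensor.tmul _ _ c d) =
    BalTensor.tmul _ _ (F (D.S.symm c * a)) (F d) := fun _ _ => rfl
  have T_γ_i := congrArg T h
  rw [D.right_γ_eq_tmul_conv ν D.isDualBasis] at T_γ_i
  simp only [map_sum, T_tmul, D.S.symm_apply_apply, D.conv_i] at T_γ_i
  simp only [← T_γ_i, D.dual_left_γ_eq_conv_tmul ν hF D.isDualBasis, dual_conv]

theorem dual_right_γ_of_right_γ_i (a : A) {n : ℕ} {u v : Fin n → A}
    (h : (D.right ν).γ D.i = ∑ j, BalTensor.tmul _ _ (u j) (v j)) :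
    ((D.dual ν hF).right (D.dualBase ν)).γ (F a) =
      ∑ j, BalTensor.tmul _ _ (F (D.S (v j) * a)) (F (u j)) := by
  let T : (D.right ν).RightTensor →+ ((D.dual ν hF).right (D.dualBase ν)).RightTensor :=
    BalTensor.lift (((BalTensor.tmulHom _ _).comp
      (F.toAddMonoidHom.comp ((AddMonoidHom.mulRight a).comp D.S.toAddMonoidHom))).compl₂
        F.toAddMonoidHom).flip
    (fun r c d => by
      change BalTensor.tmul _ _ (F (D.S d * a)) (F (c * D.S (D.s (ν.symm (.op r))))) =
        BalTensor.tmul _ _ (F (D.S (d * D.s (ν.symm (.op r))) * a)) (F c)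
      obtain ⟨l, hl⟩ := D.nakayama.surjective (ν.symm (.op r))
      rw [← hl, D.S_mul, mul_assoc, D.S_s_nakayama, ← D.mul_dual_s_dualBase ν hF,
        ← D.mul_dual_S_s_dualBase ν hF]
      exact (D.dual ν hF).tmul_mul_s (D.dualBase ν) _ _ _)
  have T_tmul : ∀ c d, T (BalTensor.tmul _ _ c d) =
    BalTensor.tmul _ _ (F (D.S d * a)) (F c) := fun _ _ => rfl
  have T_γ_i := congrArg T h
  rw [D.right_γ_eq_tmul_conv ν D.isDualBasis] at T_γ_i
  simp only [map_sum, T_tmul, D.conv_i] at T_γ_i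
  simp only [← T_γ_i, dual_S, dual_conv,
    (D.dual ν hF).right_γ_eq_conv_tmul _ (D.isDualBasis.dual ν hF)]

variable {C : Type*} [Ring C] {G : A ≃+ C} (hG : ∀ a b, G (D.conv a b) = G a * G b)

variable {D} in
/-- The canonical isomorphism between two rings that model the second product of `A`. -/
def modelEquiv : B ≃+* C :=
  { F.symm.trans G with
    map_mul' := F.surjective.forall₂.2 fun a b => by
      change G (F.symm (F a * F b)) = G (F.symm (F a)) * G (F.symm (F b))
      simp only [← hF, F.symm_apply_apply, hG] }

theorem modelEquiv_map (a : A) : modelEquiv hF hG (F a) = G a :=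
  congrArg G (F.symm_apply_apply a)

theorem modelEquiv_isStrictIso (β : R ≃+* Lᵐᵒᵖ) :
    ((D.dual ν hF).hopf β).IsStrictIso ((D.dual ν hG).hopf β)
      (modelEquiv hF hG : B →+* C) (RingHom.id R) where
  isHom :=
    { s := fun r => (modelEquiv_map D hF hG _).symm
      t := fun l => by
        change (D.dual ν hG).S.symm (G (D.i * D.s (ν.symm (.op l)))) =
          modelEquiv hF hG ((D.dual ν hF).S.symm (F (D.i * D.s (ν.symm (.op l)))))
        rw [dual_symm_S, dual_symm_S, modelEquiv_map]
      π := F.surjective.forall.2 fun a =>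
        (congrArg _ (modelEquiv_map D hF hG a)).trans
          ((D.dual_left_π ν hG a).trans (D.dual_left_π ν hF a).symm)
      γ := F.surjective.forall.2 fun a => by
        refine (congrArg _ (modelEquiv_map D hF hG a)).trans ?_
        rw [D.dual_left_γ_eq_conv_tmul ν hF D.isDualBasis,
          D.dual_left_γ_eq_conv_tmul ν hG D.isDualBasis, map_sum]
        refine Finset.sum_congr rfl fun j _ => ?_
        rw [dual_conv, dual_conv, ← modelEquiv_map D hF hG, ← modelEquiv_map D hF hG]
        rfl }
  bijective_total := (modelEquiv hF hG).bijective
  bijective_base := Function.bijective_id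
  strict := F.surjective.forall.2 fun a => by
    change modelEquiv hF hG ((D.dual ν hF).S (F a)) = (D.dual ν hG).S (modelEquiv hF hG (F a))
    rw [dual_S, modelEquiv_map, modelEquiv_map, dual_S]

end Dual

/-! ### The dual with respect to the integral -/

variable {A L R : Type*} [Ring A] [Ring L] [Ring R] (D : FrobeniusDoubleRing A L)
  (ν : L ≃+* Rᵐᵒᵖ)

/-- The additive bijection `D.functional ν` from `A` to the dual ring of its right bialgebroid. -/
noncomputable def functionalEquiv : A ≃+ (D.right ν).Dual where
  toFun := D.functional ν
  invFun ψ := ψ.act D.i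
  left_inv a := (D.act_functional ν a D.i).trans (D.conv_i a)
  right_inv := D.functional_act_i ν
  map_add' a b := by
    ext c
    simp only [RightBialgebroid.Dual.add_apply, functional_apply, map_add, mul_add,
      MulOpposite.unop_add]

theorem functionalEquiv_apply_apply (a c : A) :
    D.functionalEquiv ν a c = (ν (D.φ (D.S.symm c * a))).unop := rfl

theorem functionalEquiv_conv (a b : A) :
    D.functionalEquiv ν (D.conv a b) = D.functionalEquiv ν a * D.functionalEquiv ν b := by
  ext c
  rw [RightBialgebroid.Dual.mul_apply]
  change _ = D.functional ν a ((D.functional ν b).act c)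
  rw [act_functional, functionalEquiv_apply_apply, functional_apply, D.symm_S_conv, D.φ_conv_mul,
    D.S.apply_symm_apply]

/-- The dual double ring on the dual ring of the right bialgebroid. -/
noncomputable abbrev functionalDual : FrobeniusDoubleRing (D.right ν).Dual R :=
  D.dual ν (D.functionalEquiv_conv ν)

theorem isDual (hi : (D.hopf ν).IsNondegenerateIntegral D.i) :
    HopfAlgebroid.IsDual hi ((D.functionalDual ν).hopf (D.dualBase ν)) where
  left_s r a := by
    change D.functionalEquiv ν (D.i * D.s (ν.symm (.op r))) a = r * D.rightπ ν a
    rw [functionalEquiv_apply_apply, ← mul_assoc, D.φ_mul_s, map_mul, RingEquiv.apply_symm_apply,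
      MulOpposite.unop_mul, MulOpposite.unop_op, rightπ_apply]
  left_t r a := by
    change (D.functionalDual ν).S.symm (D.functionalEquiv ν (D.i * D.s (ν.symm (.op r)))) a =
      D.rightπ ν (D.S (D.s (ν.symm (.op r))) * a)
    rw [dual_symm_S, D.symm_S_i_mul_s, functionalEquiv_apply_apply, rightπ_apply, D.symm_S_mul,
      D.S.symm_apply_apply, mul_assoc]
  left_γ n u v h := (D.functionalEquiv ν).surjective.forall.2 fun a => by
    refine (D.dual_left_γ_of_right_γ_i ν (D.functionalEquiv_conv ν) a h).trans
      (Finset.sum_congr rfl fun j _ => ?_)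
    rw [iR_symm]
    congr 1
    ext c
    change (ν _).unop = (ν (D.φ (D.S.symm (u j * c) * a))).unop
    rw [D.symm_S_mul, mul_assoc]
    rfl
  left_π := (D.functionalEquiv ν).surjective.forall.2 fun a => by
    refine (D.dual_left_π ν (D.functionalEquiv_conv ν) a).trans ?_
    rw [functionalEquiv_apply_apply, D.symm_S_one, one_mul]
  right_s l a := by
    change (D.functionalDual ν).S ((D.functionalDual ν).s ((D.dualBase ν).symm (.op l))) a =
      D.rightπ ν (D.s l * a)
    rw [dual_S_s_dualBase, functionalEquiv_apply_apply, rightπ_apply, D.symm_S_mul, mul_assoc,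
      D.symm_S_s_mul_i]
  right_t l a := by
    rw [HopfAlgebroid.IsNondegenerateIntegral.dualIntegral, iR_symm]
    change (D.functionalDual ν).s ((D.dualBase ν).symm (.op l)) a =
      D.functional ν 1 (D.S (D.i * D.S.symm (D.s l)) * a)
    rw [dual_s_dualBase, functionalEquiv_apply_apply, functional_apply, D.symm_S_mul,
      D.S.symm_apply_apply, mul_one]
  right_γ n u v h := (D.functionalEquiv ν).surjective.forall.2 fun a => by
    refine (D.dual_right_γ_of_right_γ_i ν (D.functionalEquiv_conv ν) a h).trans
      (Finset.sum_congr rfl fun j _ => ?_)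
    rw [iR_symm]
    congr 1
    ext c
    change (ν _).unop = (ν (D.φ (D.S.symm (D.S (D.S (v j)) * c) * a))).unop
    rw [D.symm_S_mul, mul_assoc, D.S.symm_apply_apply]
    rfl
  right_π := (D.functionalEquiv ν).surjective.forall.2 fun a => by
    refine (D.dual_right_π ν (D.functionalEquiv_conv ν) a).trans ?_
    rw [HopfAlgebroid.IsNondegenerateIntegral.dualIntegral, iR_symm]
    change _ = D.left.π (D.S (D.s (ν.symm (.op
      ((D.functionalEquiv ν 1 * D.functionalEquiv ν a : (D.right ν).Dual) D.i)))))
    rw [← functionalEquiv_conv, functionalEquiv_apply_apply, MulOpposite.op_unop,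
      RingEquiv.symm_apply_apply, D.symm_S_i, D.conv_one_left, ← D.S_s_nakayama, D.i_mul_S_s,
      D.φ_mul_s, D.φ_i, one_mul, D.S_s_nakayama]
    change _ = D.φ (D.S.symm (D.s (D.φ (D.S a))) * D.i)
    rw [D.symm_S_s_mul_i, D.φ_s_mul_i]
  antipode := (D.functionalEquiv ν).surjective.forall.2 fun a => by
    refine (D.dual_S ν (D.functionalEquiv_conv ν) a).trans ?_
    rw [iR_symm]
    exact congrArg (fun c => D.functional ν (D.S c)) (iR_functional hi a).symm

end FrobeniusDoubleRing

/-! ### Components of 2-morphisms -/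

section Components

variable {C : Type u} [Bicategory.{w, v} C]

/-- The component at `U` of an endomorphism `a` of `f ≫ g`, for `a` regarded as a natural
transformation of the functor `U ↦ (U ≫ f) ≫ g`. Together with `unitComp` and `counitComp` it turns
string diagrams into compositions of natural transformations, which need no associators. -/
def endComp {X Y Z W : C} {f : X ⟶ Y} {g : Y ⟶ Z} (a : f ≫ g ⟶ f ≫ g) (U : W ⟶ X) :
    (U ≫ f) ≫ g ⟶ (U ≫ f) ≫ g :=
  (α_ U f g).hom ≫ U ◁ a ≫ (α_ U f g).inv

/-- The component at `U` of the unit of an adjunction `f ⊣ g`, for the unit regarded as a natural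
transformation from the identity to `U ↦ (U ≫ f) ≫ g`. -/
def unitComp {X Y W : C} {f : X ⟶ Y} {g : Y ⟶ X} (adj : f ⊣ g) (U : W ⟶ X) : U ⟶ (U ≫ f) ≫ g :=
  (ρ_ U).inv ≫ U ◁ adj.unit ≫ (α_ U f g).inv

/-- The component at `V` of the counit of an adjunction `f ⊣ g`, for the counit regarded as a
natural transformation from `V ↦ (V ≫ g) ≫ f` to the identity. -/
def counitComp {X Y W : C} {f : X ⟶ Y} {g : Y ⟶ X} (adj : f ⊣ g) (V : W ⟶ Y) : (V ≫ g) ≫ f ⟶ V :=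
  (α_ V g f).hom ≫ V ◁ adj.counit ≫ (ρ_ V).hom

section Endomorphism

variable {X Y Z W : C} {f : X ⟶ Y} {g : Y ⟶ Z}

theorem endComp_naturality (a : f ≫ g ⟶ f ≫ g) {U U' : W ⟶ X} (h : U ⟶ U') :
    (h ▷ f) ▷ g ≫ endComp a U' = endComp a U ≫ (h ▷ f) ▷ g := by
  simp only [endComp, associator_naturality_left_assoc, ← whisker_exchange_assoc,
    associator_inv_naturality_left, Category.assoc]

theorem endComp_naturality_assoc (a : f ≫ g ⟶ f ≫ g) {U U' : W ⟶ X} (h : U ⟶ U') {Q : W ⟶ Z}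
    (k : (U' ≫ f) ≫ g ⟶ Q) :
    (h ▷ f) ▷ g ≫ endComp a U' ≫ k = endComp a U ≫ (h ▷ f) ▷ g ≫ k := by
  rw [← Category.assoc, endComp_naturality, Category.assoc]

theorem endComp_whiskerRight_naturality_assoc {Z' : C} {p : Z ⟶ Z'} (a : f ≫ g ⟶ f ≫ g)
    {U U' : W ⟶ X} (h : U ⟶ U') {Q : W ⟶ Z'} (k : ((U' ≫ f) ≫ g) ≫ p ⟶ Q) :
    ((h ▷ f) ▷ g) ▷ p ≫ endComp a U' ▷ p ≫ k = endComp a U ▷ p ≫ ((h ▷ f) ▷ g) ▷ p ≫ k := by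
  rw [← comp_whiskerRight_assoc, endComp_naturality, comp_whiskerRight_assoc]

theorem endComp_mul (a b : End (f ≫ g)) (U : W ⟶ X) :
    endComp (a * b) U = endComp b U ≫ endComp a U := by
  simp only [endComp, End.mul_def, whiskerLeft_comp, Category.assoc, Iso.inv_hom_id_assoc]

theorem endComp_id (U : W ⟶ X) : endComp (𝟙 (f ≫ g)) U = 𝟙 _ := by
  simp only [endComp, Bicategory.whiskerLeft_id, Category.id_comp, Iso.hom_inv_id]

theorem endComp_whiskerRight (l : f ⟶ f) (U : W ⟶ X) : endComp (l ▷ g) U = (U ◁ l) ▷ g := by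
  simp only [endComp, whisker_assoc]

theorem endComp_whiskerLeft (r : g ⟶ g) (U : W ⟶ X) : endComp (f ◁ r) U = (U ≫ f) ◁ r := by
  simp only [endComp, comp_whiskerLeft]

theorem endComp_injective {a b : f ≫ g ⟶ f ≫ g} (h : endComp a (𝟙 X) = endComp b (𝟙 X)) :
    a = b := by
  simp only [endComp, cancel_epi, cancel_mono, ← Category.assoc] at h
  exact (whiskerLeft_iff a b).1 h

end Endomorphism

section Adjunction

variable {X Y W : C} {f : X ⟶ Y} {g : Y ⟶ X} (adj : f ⊣ g)

theorem unitComp_naturality {U U' : W ⟶ X} (h : U ⟶ U') :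
    h ≫ unitComp adj U' = unitComp adj U ≫ (h ▷ f) ▷ g := by
  rw [unitComp, unitComp, Category.assoc, Category.assoc, ← associator_inv_naturality_left,
    whisker_exchange_assoc, rightUnitor_inv_naturality_assoc]

theorem unitComp_naturality_assoc {U U' Q : W ⟶ X} (h : U ⟶ U') (k : (U' ≫ f) ≫ g ⟶ Q) :
    h ≫ unitComp adj U' ≫ k = unitComp adj U ≫ (h ▷ f) ▷ g ≫ k := by
  rw [← Category.assoc, unitComp_naturality, Category.assoc]

theorem counitComp_naturality {V V' : W ⟶ Y} (h : V ⟶ V') :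
    (h ▷ g) ▷ f ≫ counitComp adj V' = counitComp adj V ≫ h := by
  simp only [counitComp, associator_naturality_left_assoc, Category.assoc]
  rw [← whisker_exchange_assoc, rightUnitor_naturality]

theorem counitComp_naturality_assoc {V V' Q : W ⟶ Y} (h : V ⟶ V') (k : V' ⟶ Q) :
    (h ▷ g) ▷ f ≫ counitComp adj V' ≫ k = counitComp adj V ≫ h ≫ k := by
  rw [← Category.assoc, counitComp_naturality, Category.assoc]

theorem unitComp_whiskerRight_counitComp (U : W ⟶ X) :
    unitComp adj U ▷ f ≫ counitComp adj (U ≫ f) = 𝟙 _ := by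
  have h := congrArg (fun z => (ρ_ U).inv ▷ f ≫ (α_ _ _ _).hom ≫ U ◁ z ≫ U ◁ (ρ_ f).hom)
    adj.left_triangle
  refine Eq.trans ?_ (h.trans ?_)
  · simp only [unitComp, counitComp, leftZigzag]
    bicategory
  · bicategory

theorem unitComp_whiskerRight_counitComp_assoc (U : W ⟶ X) {Q : W ⟶ Y} (k : U ≫ f ⟶ Q) :
    unitComp adj U ▷ f ≫ counitComp adj (U ≫ f) ≫ k = k := by
  rw [← Category.assoc, unitComp_whiskerRight_counitComp, Category.id_comp]

theorem unitComp_counitComp_whiskerRight (V : W ⟶ Y) :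
    unitComp adj (V ≫ g) ≫ counitComp adj V ▷ g = 𝟙 _ := by
  have h := congrArg (fun z => V ◁ (ρ_ g).inv ≫ V ◁ z ≫ V ◁ (λ_ g).hom) adj.right_triangle
  refine Eq.trans ?_ (h.trans ?_)
  · simp only [unitComp, counitComp, rightZigzag]
    bicategory
  · bicategory

theorem unitComp_counitComp_whiskerRight_assoc (V : W ⟶ Y) {Q : W ⟶ X} (k : V ≫ g ⟶ Q) :
    unitComp adj (V ≫ g) ≫ counitComp adj V ▷ g ≫ k = k := by
  rw [← Category.assoc, unitComp_counitComp_whiskerRight, Category.id_comp]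

end Adjunction

end Components

/-! ### The two products and the antipode -/

namespace FrobeniusData

section General

variable {C : Type u} [Bicategory.{w, v} C] {X Y W : C} {ι : X ⟶ Y}

/-- The Frobenius data of `ῑ` with the dual `ι`. It exchanges the roles of `A` and `B`: its `ℱ` and
`ℱ̇` are `ℱ̇⁻¹` and `ℱ⁻¹`. -/
abbrev flip (F : FrobeniusData ι) : FrobeniusData F.bar := ⟨ι, F.adjR, F.adjL⟩

variable (F : FrobeniusData ι)

theorem flip_convA (b b' : F.B) : F.flip.convA b b' = F.convB b b' := by
  revert b b'
  intro (b : F.bar ≫ ι ⟶ F.bar ≫ ι) (b' : F.bar ≫ ι ⟶ F.bar ≫ ι)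
  simp only [End.of, End.asHom, convA, convB]
  bicategory

theorem endComp_convA (a b : ι ≫ F.bar ⟶ ι ≫ F.bar) (U : W ⟶ X) :
    endComp (F.convA a b) U =
      unitComp F.adjR (U ≫ ι) ▷ F.bar ≫ (endComp a U ▷ ι) ▷ F.bar ≫
        endComp b ((U ≫ ι) ≫ F.bar) ≫ counitComp F.adjL (U ≫ ι) ▷ F.bar := by
  simp only [End.of, End.asHom, endComp, unitComp, counitComp, convA]
  bicategory

theorem endComp_iA (U : W ⟶ X) :
    endComp F.iA U = counitComp F.adjR U ≫ unitComp F.adjL U := by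
  simp only [endComp, unitComp, counitComp, iA]
  bicategory

theorem endComp_fourier (a : ι ≫ F.bar ⟶ ι ≫ F.bar) (V : W ⟶ Y) :
    endComp (F.fourier a) V = (unitComp F.adjR V ▷ F.bar) ▷ ι ≫ endComp a (V ≫ F.bar) ▷ ι ≫
      counitComp F.adjL ((V ≫ F.bar) ≫ ι) := by
  simp only [End.of, End.asHom, endComp, unitComp, counitComp, fourier]
  bicategory

theorem endComp_fourierInv (b : F.bar ≫ ι ⟶ F.bar ≫ ι) (U : W ⟶ X) :
    endComp (F.fourierInv b) U = unitComp F.adjL ((U ≫ ι) ≫ F.bar) ≫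
      endComp b (U ≫ ι) ▷ F.bar ≫ (counitComp F.adjR U ▷ ι) ▷ F.bar := by
  simp only [End.of, End.asHom, endComp, unitComp, counitComp, fourierInv]
  bicategory

theorem endComp_fourierDot (a : ι ≫ F.bar ⟶ ι ≫ F.bar) (V : W ⟶ Y) :
    endComp (F.fourierDot a) V = unitComp F.adjR ((V ≫ F.bar) ≫ ι) ≫ endComp a (V ≫ F.bar) ▷ ι ≫
      (counitComp F.adjL V ▷ F.bar) ▷ ι :=
  F.flip.endComp_fourierInv a V

theorem whiskerLeft_phiL (a : ι ≫ F.bar ⟶ ι ≫ F.bar) (U : W ⟶ X) :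
    U ◁ F.phiL a = unitComp F.adjR (U ≫ ι) ≫ endComp a U ▷ ι ≫ counitComp F.adjL (U ≫ ι) := by
  simp only [End.of, End.asHom, endComp, unitComp, counitComp, phiL]
  bicategory

theorem whiskerLeft_mu (l : ι ⟶ ι) (V : W ⟶ Y) :
    V ◁ F.mu l = unitComp F.adjL (V ≫ F.bar) ≫ ((V ≫ F.bar) ◁ l) ▷ F.bar ≫
      counitComp F.adjL V ▷ F.bar := by
  simp only [End.of, End.asHom, unitComp, counitComp, mu]
  bicategory

theorem whiskerLeft_nu (l : ι ⟶ ι) (V : W ⟶ Y) :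
    V ◁ F.nu l = unitComp F.adjR V ▷ F.bar ≫ ((V ≫ F.bar) ◁ l) ▷ F.bar ≫
      counitComp F.adjR (V ≫ F.bar) := by
  simp only [End.of, End.asHom, unitComp, counitComp, nu]
  bicategory

theorem fourier_convA (a b : F.A) : F.fourier (F.convA a b) = F.fourier a * F.fourier b := by
  apply endComp_injective
  rw [endComp_mul]
  simp only [endComp_fourier, endComp_convA, comp_whiskerRight, Category.assoc]
  rw [← counitComp_naturality]
  simp only [comp_whiskerRight, Category.assoc]
  rw [← endComp_whiskerRight_naturality_assoc, ← endComp_whiskerRight_naturality_assoc]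
  simp only [← comp_whiskerRight, ← comp_whiskerRight_assoc]
  rw [unitComp_naturality_assoc]
  simp only [comp_whiskerRight, Category.assoc]

theorem fourierDot_convA (a b : F.A) :
    F.fourierDot (F.convA a b) = F.fourierDot b * F.fourierDot a := by
  apply endComp_injective
  rw [endComp_mul]
  simp only [endComp_fourierDot, endComp_convA, comp_whiskerRight, Category.assoc]
  rw [unitComp_naturality_assoc, unitComp_naturality_assoc, unitComp_naturality_assoc,
    endComp_whiskerRight_naturality_assoc]
  simp only [← comp_whiskerRight]
  rw [endComp_naturality_assoc, ← comp_whiskerRight, counitComp_naturality]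
  simp only [comp_whiskerRight]
  rw [endComp_whiskerRight_naturality_assoc]

theorem fourierInv_fourier (a : F.A) : F.fourierInv (F.fourier a) = a := by
  apply endComp_injective
  simp only [endComp_fourierInv, endComp_fourier, comp_whiskerRight, Category.assoc]
  rw [← unitComp_naturality_assoc, ← unitComp_naturality_assoc,
    unitComp_counitComp_whiskerRight_assoc, ← endComp_naturality, ← comp_whiskerRight_assoc,
    unitComp_counitComp_whiskerRight, id_whiskerRight, Category.id_comp]

theorem fourier_fourierInv (b : F.B) : F.fourier (F.fourierInv b) = b := by
  apply endComp_injective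
  simp only [endComp_fourierInv, endComp_fourier, comp_whiskerRight, Category.assoc]
  rw [counitComp_naturality, counitComp_naturality_assoc, unitComp_whiskerRight_counitComp_assoc,
    endComp_naturality_assoc, ← comp_whiskerRight, unitComp_whiskerRight_counitComp,
    id_whiskerRight, Category.comp_id]

theorem fourierDotInv_fourierDot (a : F.A) : F.fourierDotInv (F.fourierDot a) = a :=
  F.flip.fourier_fourierInv a

theorem fourierDot_fourierDotInv (b : F.B) : F.fourierDot (F.fourierDotInv b) = b :=
  F.flip.fourierInv_fourier b

theorem fourier_iA : F.fourier F.iA = 1 := by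
  apply endComp_injective
  simp only [endComp_fourier, endComp_iA, comp_whiskerRight, Category.assoc]
  rw [unitComp_whiskerRight_counitComp, Category.comp_id, ← comp_whiskerRight,
    unitComp_whiskerRight_counitComp, id_whiskerRight]
  exact (endComp_id _).symm

theorem convB_fourier (a b : F.A) : F.convB (F.fourier a) (F.fourier b) = F.fourier (b * a) := by
  have fourierInv_convB : F.fourierInv (F.convB (F.fourier a) (F.fourier b)) =
      F.fourierInv (F.fourier b) * F.fourierInv (F.fourier a) :=
    F.flip_convA _ _ ▸ F.flip.fourierDot_convA (F.fourier a) (F.fourier b)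
  rw [← F.fourier_fourierInv (F.convB _ _), fourierInv_convB, fourierInv_fourier,
    fourierInv_fourier]

theorem convB_eq_fourier (b b' : F.B) :
    F.convB b b' = F.fourier (F.fourierInv b' * F.fourierInv b) := by
  rw [← convB_fourier, fourier_fourierInv, fourier_fourierInv]

theorem fourierDotInv_convB (a b : F.B) :
    F.fourierDotInv (F.convB a b) = F.fourierDotInv a * F.fourierDotInv b :=
  F.flip_convA a b ▸ F.flip.fourier_convA a b

theorem SA_SAInv (a : F.A) : F.SA (F.SAInv a) = a := by
  rw [SA, SAInv, fourier_fourierInv, fourierDotInv_fourierDot]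

theorem SAInv_SA (a : F.A) : F.SAInv (F.SA a) = a := by
  rw [SA, SAInv, fourierDot_fourierDotInv, fourierInv_fourier]

theorem fourierDot_SA (a : F.A) : F.fourierDot (F.SA a) = F.fourier a :=
  F.fourierDot_fourierDotInv _

theorem fourier_SAInv (a : F.A) : F.fourier (F.SAInv a) = F.fourierDot a :=
  F.fourier_fourierInv _

theorem SA_mul (a b : F.A) : F.SA (a * b) = F.SA b * F.SA a := by
  rw [SA, ← convB_fourier, fourierDotInv_convB, SA, SA]

theorem SA_convA (a b : F.A) : F.SA (F.convA a b) = F.convA (F.SA b) (F.SA a) := by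
  rw [← F.fourierDotInv_fourierDot (F.convA (F.SA b) _), fourierDot_convA, fourierDot_SA,
    fourierDot_SA, ← fourier_convA, SA]

theorem convA_assoc (a b c : F.A) : F.convA (F.convA a b) c = F.convA a (F.convA b c) := by
  rw [← F.fourierInv_fourier (F.convA (F.convA a b) c), fourier_convA, fourier_convA, mul_assoc,
    ← fourier_convA, ← fourier_convA, fourierInv_fourier]

theorem iA_convA (a : F.A) : F.convA F.iA a = a := by
  rw [← F.fourierInv_fourier (F.convA _ _), fourier_convA, fourier_iA, one_mul, fourierInv_fourier]

theorem convA_iA (a : F.A) : F.convA a F.iA = a := by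
  rw [← F.fourierInv_fourier (F.convA _ _), fourier_convA, fourier_iA, mul_one, fourierInv_fourier]

theorem convA_one (a : F.A) : F.convA a 1 = F.phiL a ▷ F.bar := by
  apply endComp_injective
  rw [endComp_whiskerRight, whiskerLeft_phiL, endComp_convA, End.one_def, endComp_id]
  simp only [comp_whiskerRight, Category.id_comp]

theorem whiskerRight_mul_convA (l : F.L) (a b : F.A) :
    End.of (l.asHom ▷ F.bar) * F.convA a b = F.convA (End.of (l.asHom ▷ F.bar) * a) b := by
  apply endComp_injective
  simp only [endComp_mul, endComp_convA, endComp_whiskerRight, comp_whiskerRight, Category.assoc]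
  rw [← comp_whiskerRight, ← counitComp_naturality, comp_whiskerRight, ← endComp_naturality_assoc]

theorem convA_mul_whiskerRight (l : F.L) (a b : F.A) :
    F.convA a b * End.of (l.asHom ▷ F.bar) = F.convA (a * End.of (l.asHom ▷ F.bar)) b := by
  apply endComp_injective
  simp only [endComp_mul, endComp_convA, endComp_whiskerRight, comp_whiskerRight, Category.assoc]
  rw [← comp_whiskerRight_assoc, unitComp_naturality, comp_whiskerRight_assoc]

theorem whiskerLeft_mu_counitComp (l : F.L) (V : W ⟶ Y) :
    (V ◁ F.mu l) ▷ ι ≫ counitComp F.adjL V = (V ≫ F.bar) ◁ l.asHom ≫ counitComp F.adjL V := by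
  rw [whiskerLeft_mu]
  simp only [comp_whiskerRight, Category.assoc]
  rw [counitComp_naturality, counitComp_naturality_assoc, unitComp_whiskerRight_counitComp_assoc]

theorem unitComp_whiskerLeft_nu (l : F.L) (V : W ⟶ Y) :
    unitComp F.adjR V ≫ (V ◁ F.nu l) ▷ ι = unitComp F.adjR V ≫ (V ≫ F.bar) ◁ l.asHom := by
  rw [whiskerLeft_nu]
  simp only [comp_whiskerRight]
  rw [← unitComp_naturality_assoc, ← unitComp_naturality_assoc, unitComp_counitComp_whiskerRight,
    Category.comp_id]

theorem convA_whiskerLeft_mu_mul (l : F.L) (a b : F.A) :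
    F.convA (End.of (ι ◁ (F.mu l).asHom) * a) b = F.convA a (End.of (l.asHom ▷ F.bar) * b) := by
  apply endComp_injective
  simp only [endComp_mul, endComp_convA, endComp_whiskerRight, endComp_whiskerLeft,
    comp_whiskerRight, Category.assoc]
  rw [endComp_naturality_assoc]
  simp only [← comp_whiskerRight]
  rw [whiskerLeft_mu_counitComp]

theorem fourier_whiskerLeft_mu (l : F.L) :
    F.fourier (ι ◁ (F.mu l).asHom) = F.fourierDot (l.asHom ▷ F.bar) := by
  apply endComp_injective
  rw [endComp_fourier, endComp_fourierDot, endComp_whiskerRight, endComp_whiskerLeft,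
    ← comp_whiskerRight_assoc, ← whisker_exchange, comp_whiskerRight, Category.assoc,
    counitComp_naturality, ← Category.assoc, whiskerLeft_mu_counitComp,
    ← unitComp_naturality_assoc, ← unitComp_naturality, Category.assoc]

theorem fourier_whiskerRight (l : F.L) :
    F.fourier (l.asHom ▷ F.bar) = F.fourierDot (ι ◁ (F.nu l).asHom) := by
  apply endComp_injective
  rw [endComp_fourier, endComp_fourierDot, endComp_whiskerRight, endComp_whiskerLeft,
    ← comp_whiskerRight, whisker_exchange, comp_whiskerRight, ← unitComp_naturality_assoc,
    unitComp_whiskerLeft_nu, counitComp_naturality, counitComp_naturality_assoc]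

theorem SAInv_whiskerRight (l : F.L) : F.SAInv (l.asHom ▷ F.bar) = ι ◁ (F.mu l).asHom := by
  rw [SAInv, ← fourier_whiskerLeft_mu]
  exact F.fourierInv_fourier _

theorem SA_whiskerRight (l : F.L) : F.SA (l.asHom ▷ F.bar) = ι ◁ (F.nu l).asHom := by
  rw [SA, fourier_whiskerRight]
  exact F.fourierDotInv_fourierDot _

theorem phiL_whiskerRight_mul (l : F.L) (a : F.A) :
    F.phiL (End.of (l.asHom ▷ F.bar) * a) = l * F.phiL a := by
  refine (whiskerLeft_iff _ _).1 (?_ : 𝟙 X ◁ _ = 𝟙 X ◁ (F.phiL a ≫ l))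
  simp only [whiskerLeft_phiL, endComp_mul, whiskerLeft_comp, endComp_whiskerRight,
    comp_whiskerRight, Category.assoc, counitComp_naturality]

theorem phiL_iA : F.phiL F.iA = 1 := by
  refine (whiskerLeft_iff _ _).1 (?_ : 𝟙 X ◁ _ = 𝟙 X ◁ 𝟙 ι)
  simp only [whiskerLeft_phiL, endComp_iA, comp_whiskerRight, Category.assoc,
    unitComp_whiskerRight_counitComp, Category.comp_id, unitComp_counitComp_whiskerRight,
    Bicategory.whiskerLeft_id]

theorem mul_iA (a : F.A) : a * F.iA = End.of (F.phiL (a * F.iA) ▷ F.bar) * F.iA := by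
  apply endComp_injective
  simp only [endComp_mul, endComp_whiskerRight, whiskerLeft_phiL, endComp_iA, comp_whiskerRight,
    Category.assoc]
  rw [← comp_whiskerRight_assoc, unitComp_counitComp_whiskerRight, id_whiskerRight,
    Category.id_comp, ← unitComp_naturality_assoc, ← unitComp_naturality_assoc,
    unitComp_counitComp_whiskerRight, Category.comp_id]

theorem fourier_iA_mul_whiskerRight (l : F.L) :
    F.fourier (F.iA * End.of (l.asHom ▷ F.bar)) = F.nu l ▷ ι := by
  apply endComp_injective
  simp only [endComp_mul, endComp_whiskerRight, whiskerLeft_nu, endComp_iA, comp_whiskerRight,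
    Category.assoc, endComp_fourier, unitComp_whiskerRight_counitComp, Category.comp_id]

theorem fourier_whiskerRight_mul_iA (l : F.L) :
    F.fourier (End.of (l.asHom ▷ F.bar) * F.iA) = F.bar ◁ l.asHom := by
  apply endComp_injective
  simp only [endComp_mul, endComp_whiskerRight, endComp_whiskerLeft, endComp_iA,
    comp_whiskerRight, Category.assoc, endComp_fourier]
  rw [counitComp_naturality, unitComp_whiskerRight_counitComp_assoc, ← comp_whiskerRight_assoc,
    unitComp_whiskerRight_counitComp, id_whiskerRight, Category.id_comp]

theorem endComp_convA_counitComp (x a : F.A) (U : W ⟶ X) :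
    endComp (F.convA x a) U ▷ ι ≫ counitComp F.adjL (U ≫ ι) =
      endComp (F.fourier a) (U ≫ ι) ≫ endComp x U ▷ ι ≫ counitComp F.adjL (U ≫ ι) := by
  simp only [endComp_convA, endComp_fourier, comp_whiskerRight, Category.assoc,
    counitComp_naturality]
  rw [← counitComp_naturality_assoc, ← endComp_whiskerRight_naturality_assoc]

theorem unitComp_endComp_convA (y a : F.A) (U : W ⟶ X) :
    unitComp F.adjR (U ≫ ι) ≫ endComp (F.convA y a) U ▷ ι =
      unitComp F.adjR (U ≫ ι) ≫ endComp y U ▷ ι ≫ endComp (F.fourierDot a) (U ≫ ι) := by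
  simp only [endComp_convA, endComp_fourierDot, comp_whiskerRight]
  rw [unitComp_naturality_assoc, unitComp_naturality_assoc]

theorem phiL_convA_mul (x a y : F.A) :
    F.phiL (F.convA x a * y) = F.phiL (x * F.convA y (F.SA a)) := by
  refine (whiskerLeft_iff _ _).1 ?_
  rw [whiskerLeft_phiL, whiskerLeft_phiL, endComp_mul, endComp_mul, comp_whiskerRight,
    comp_whiskerRight, Category.assoc, Category.assoc, endComp_convA_counitComp,
    ← Category.assoc (unitComp _ _), ← Category.assoc (unitComp _ _), unitComp_endComp_convA,
    fourierDot_SA]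
  simp only [Category.assoc]

theorem nu_mul (l l' : F.L) : F.nu (l * l') = F.nu l' * F.nu l := by
  simp only [nu_eq]
  exact (conjugateEquiv_symm_comp F.adjR F.adjR F.adjR l' l).symm

end General

end FrobeniusData

/-! ### Depth 2 -/

theorem sum_retract_comp_eq_id {D : Type*} [Category D] [Preadditive D] {X Y : D} {n : ℕ}
    [HasBiproduct fun _ : Fin n => Y] (r : Retract X (⨁ fun _ : Fin n => Y)) :
    ∑ k, (r.i ≫ biproduct.π (fun _ => Y) k) ≫ biproduct.ι (fun _ => Y) k ≫ r.r = 𝟙 X :=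
  calc ∑ k, (r.i ≫ biproduct.π (fun _ => Y) k) ≫ biproduct.ι (fun _ => Y) k ≫ r.r
      = r.i ≫ (∑ k, biproduct.π (fun _ => Y) k ≫ biproduct.ι (fun _ => Y) k) ≫ r.r := by
        simp only [Preadditive.comp_sum, Preadditive.sum_comp, Category.assoc]
    _ = 𝟙 X := by rw [biproduct.total, Category.id_comp, r.retract]

section Additive

theorem end_add_def {D : Type*} [Category D] [Preadditive D] {X : D} (a b : End X) :
    a + b = (a.asHom + b.asHom : X ⟶ X) := rfl

variable {C : Type u} [Bicategory.{w, v} C] [∀ a b : C, Preadditive (a ⟶ b)]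

namespace PreadditiveBicategory

variable [PreadditiveBicategory C] {X Y Z : C}

theorem whiskerLeft_sum (f : X ⟶ Y) {g h : Y ⟶ Z} {n : ℕ} (x : Fin n → (g ⟶ h)) :
    f ◁ (∑ i, x i) = ∑ i, f ◁ x i :=
  map_sum (AddMonoidHom.mk' (fun x : g ⟶ h => f ◁ x)
    (whiskerLeft_add f)) x Finset.univ

theorem sum_whiskerRight {f g : X ⟶ Y} {n : ℕ} (x : Fin n → (f ⟶ g)) (h : Y ⟶ Z) :
    (∑ i, x i) ▷ h = ∑ i, x i ▷ h :=
  map_sum (AddMonoidHom.mk' (fun x : f ⟶ g => x ▷ h)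
    (fun x y => add_whiskerRight x y h)) x Finset.univ

theorem zero_whiskerRight {f g : X ⟶ Y} (h : Y ⟶ Z) : (0 : f ⟶ g) ▷ h = 0 :=
  (AddMonoidHom.mk' (fun x : f ⟶ g => x ▷ h)
    (fun x y => add_whiskerRight x y h)).map_zero

end PreadditiveBicategory

theorem endComp_sum [PreadditiveBicategory C] {X Y Z W : C} {f : X ⟶ Y} {g : Y ⟶ Z}
    {n : ℕ} (a : Fin n → End (f ≫ g)) (U : W ⟶ X) :
    endComp (∑ i, a i) U = ∑ i, endComp (a i) U := by
  have whiskerLeft_sum_end : U ◁ (∑ i, a i) = ∑ i, U ◁ a i :=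
    PreadditiveBicategory.whiskerLeft_sum U a
  simp only [endComp]
  rw [whiskerLeft_sum_end, Preadditive.sum_comp, Preadditive.comp_sum]

namespace FrobeniusData

variable {X Y : C} {ι : X ⟶ Y} (F : FrobeniusData ι)

theorem isQuasiBasis_of_sum_comp_eq_id {n : ℕ} {u : Fin n → ((ι ≫ F.bar) ≫ ι ⟶ ι)}
    {v : Fin n → (ι ⟶ (ι ≫ F.bar) ≫ ι)} (huv : ∑ k, u k ≫ v k = 𝟙 _) :
    F.IsQuasiBasis (fun k => v k ▷ F.bar ≫ counitComp F.adjR (ι ≫ F.bar))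
      (fun k => unitComp F.adjL (ι ≫ F.bar) ≫ u k ▷ F.bar) := by
  have unbend_u : ∀ k, (unitComp F.adjL (ι ≫ F.bar) ≫ u k ▷ F.bar) ▷ ι ≫ counitComp F.adjL ι =
      u k := fun k => by
    rw [comp_whiskerRight, Category.assoc, counitComp_naturality,
      unitComp_whiskerRight_counitComp_assoc]
  have unbend_v : ∀ k, unitComp F.adjR ι ≫ (v k ▷ F.bar ≫ counitComp F.adjR (ι ≫ F.bar)) ▷ ι =
      v k := fun k => by
    rw [comp_whiskerRight, ← unitComp_naturality_assoc, unitComp_counitComp_whiskerRight,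
      Category.comp_id]
  rw [IsQuasiBasis, ← huv]
  refine Finset.sum_congr rfl fun k _ => ?_
  conv_rhs => rw [← unbend_u k, ← unbend_v k]
  simp only [counitComp, unitComp, End.asHom, Category.assoc, Iso.hom_inv_id_assoc]

theorem IsD2.exists_isQuasiBasis [∀ a b : C, HasFiniteBiproducts (a ⟶ b)] {F : FrobeniusData ι}
    (hF : F.IsD2) : ∃ (n : ℕ) (y x : Fin n → F.A), F.IsQuasiBasis y x :=
  let ⟨⟨n, ⟨r⟩⟩, _⟩ := hF
  ⟨n, _, _, F.isQuasiBasis_of_sum_comp_eq_id (sum_retract_comp_eq_id r)⟩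

variable [PreadditiveBicategory C]

theorem convA_add (a b c : F.A) : F.convA a (b + c) = F.convA a b + F.convA a c := by
  simp only [convA, End.of, End.asHom, end_add_def, PreadditiveBicategory.whiskerLeft_add,
    Preadditive.comp_add, Preadditive.add_comp]

theorem add_convA (a b c : F.A) : F.convA (a + b) c = F.convA a c + F.convA b c := by
  simp only [convA, End.of, End.asHom, end_add_def, PreadditiveBicategory.add_whiskerRight,
    Preadditive.comp_add, Preadditive.add_comp]

theorem fourier_add (a b : F.A) : F.fourier (a + b) = F.fourier a + F.fourier b := by
  simp only [fourier, End.of, End.asHom, end_add_def, PreadditiveBicategory.whiskerLeft_add,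
    PreadditiveBicategory.add_whiskerRight, Preadditive.comp_add, Preadditive.add_comp]

theorem fourierDotInv_add (a b : F.B) :
    F.fourierDotInv (a + b) = F.fourierDotInv a + F.fourierDotInv b := by
  simp only [fourierDotInv, End.of, End.asHom, end_add_def, PreadditiveBicategory.whiskerLeft_add,
    PreadditiveBicategory.add_whiskerRight, Preadditive.comp_add, Preadditive.add_comp]

theorem phiL_add (a b : F.A) : F.phiL (a + b) = F.phiL a + F.phiL b := by
  simp only [phiL, End.of, End.asHom, end_add_def, PreadditiveBicategory.add_whiskerRight,
    Preadditive.comp_add, Preadditive.add_comp]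

theorem nu_add (l l' : F.L) : F.nu (l + l') = F.nu l + F.nu l' := by
  simp only [nu, End.of, End.asHom, end_add_def, PreadditiveBicategory.whiskerLeft_add,
    PreadditiveBicategory.add_whiskerRight, Preadditive.comp_add, Preadditive.add_comp]

namespace IsQuasiBasis

variable {F} {n : ℕ} {y x : Fin n → F.A} (h : F.IsQuasiBasis y x)
include h

theorem sum_endComp_whiskerRight {W : C} (U : W ⟶ X) :
    ∑ i, endComp (x i) U ▷ ι ≫ counitComp F.adjL (U ≫ ι) ≫ unitComp F.adjR (U ≫ ι) ≫
      endComp (y i) U ▷ ι = 𝟙 _ := by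
  have component : ∀ x y : ι ≫ F.bar ⟶ ι ≫ F.bar,
      endComp x U ▷ ι ≫ counitComp F.adjL (U ≫ ι) ≫ unitComp F.adjR (U ≫ ι) ≫
        endComp y U ▷ ι = ((α_ U ι F.bar).hom ▷ ι ≫ (α_ U (ι ≫ F.bar) ι).hom) ≫
      (U ◁ (x ▷ ι ≫ (α_ ι F.bar ι).hom ≫ ι ◁ F.evL ≫ ι ◁ F.coevR ≫
        (α_ ι F.bar ι).inv ≫ y ▷ ι)) ≫ (α_ U (ι ≫ F.bar) ι).inv ≫ (α_ U ι F.bar).inv ▷ ι := by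
    intro x y
    simp only [endComp, unitComp, counitComp]
    bicategory
  have whiskerLeft_h := congrArg (fun z => U ◁ z) h
  simp only [End.asHom, PreadditiveBicategory.whiskerLeft_sum] at whiskerLeft_h
  simp only [component]
  rw [← Preadditive.comp_sum, ← Preadditive.sum_comp, whiskerLeft_h]
  simp only [Bicategory.whiskerLeft_id, Category.id_comp, Category.assoc, Iso.hom_inv_id_assoc,
    hom_inv_whiskerRight]

theorem convA_mul_mul (p q d c : F.A) :
    F.convA (p * q) (d * c) = ∑ i, F.convA (p * y i) d * F.convA (x i * q) c := by
  have component : ∀ i, endComp (F.convA (p * y i) d * F.convA (x i * q) c) (𝟙 X) =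
      (unitComp F.adjR (𝟙 X ≫ ι) ▷ F.bar ≫ endComp q (𝟙 X) ▷ ι ▷ F.bar ≫
        endComp c ((𝟙 X ≫ ι) ≫ F.bar)) ≫
      (endComp (x i) (𝟙 X) ▷ ι ≫ counitComp F.adjL (𝟙 X ≫ ι) ≫ unitComp F.adjR (𝟙 X ≫ ι) ≫
        endComp (y i) (𝟙 X) ▷ ι) ▷ F.bar ≫
      endComp p (𝟙 X) ▷ ι ▷ F.bar ≫ endComp d ((𝟙 X ≫ ι) ≫ F.bar) ≫
        counitComp F.adjL (𝟙 X ≫ ι) ▷ F.bar := fun i => by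
    simp only [endComp_mul, endComp_convA, comp_whiskerRight, Category.assoc]
    rw [endComp_naturality_assoc]
  apply endComp_injective
  rw [endComp_sum, endComp_convA, endComp_mul, endComp_mul]
  simp only [component]
  rw [← Preadditive.comp_sum, ← Preadditive.sum_comp, ← PreadditiveBicategory.sum_whiskerRight,
    h.sum_endComp_whiskerRight]
  simp only [comp_whiskerRight, id_whiskerRight, Category.id_comp, Category.assoc]
  rw [endComp_naturality_assoc]

end IsQuasiBasis

/-- The isomorphism `ν : L → Rᵒᵖ`. -/
def nuEquiv : F.L ≃+* F.Rᵐᵒᵖ where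
  toFun l := .op (F.nu l)
  invFun r := F.nuInv r.unop
  left_inv l := F.nuInv_nu l
  right_inv r := congrArg MulOpposite.op (F.nu_nuInv r.unop)
  map_mul' l l' := congrArg MulOpposite.op (F.nu_mul l l')
  map_add' l l' := congrArg MulOpposite.op (F.nu_add l l')

/-- The antipode `S_A` as an additive bijection. -/
def SAEquiv : F.A ≃+ F.A where
  toFun := F.SA
  invFun := F.SAInv
  left_inv := F.SAInv_SA
  right_inv := F.SA_SAInv
  map_add' a b := by rw [SA, fourier_add, fourierDotInv_add, SA, SA]

/-- The Fourier transformation `ℱ` as an additive bijection. -/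
def fourierEquiv : F.A ≃+ F.B where
  toFun := F.fourier
  invFun := F.fourierInv
  left_inv := F.fourierInv_fourier
  right_inv := F.fourier_fourierInv
  map_add' := F.fourier_add

/-- The ring homomorphism `l ↦ l × ῑ` from `L` to `A`, the source map of the left bialgebroid. -/
def whiskerRightBar : F.L →+* F.A where
  toFun l := End.of (l.asHom ▷ F.bar)
  map_one' := id_whiskerRight ι F.bar
  map_mul' l l' := comp_whiskerRight l'.asHom l.asHom F.bar
  map_zero' := PreadditiveBicategory.zero_whiskerRight F.bar
  map_add' l l' := PreadditiveBicategory.add_whiskerRight l.asHom l'.asHom F.bar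

variable {F} {n : ℕ} {y x : Fin n → F.A}

/-- The double ring on `A = End(ι × ῑ)`, with the composition and convolution products. -/
def IsQuasiBasis.doubleRing (h : F.IsQuasiBasis y x) : FrobeniusDoubleRing F.A F.L where
  conv := AddMonoidHom.mk' (fun a => AddMonoidHom.mk' (F.convA a) (F.convA_add a))
    (fun a b => AddMonoidHom.ext fun c => F.add_convA a b c)
  i := F.iA
  S := F.SAEquiv
  s := F.whiskerRightBar
  φ := AddMonoidHom.mk' F.phiL F.phiL_add
  rank := n
  y := y
  x := x
  conv_assoc := F.convA_assoc
  i_conv := F.iA_convA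
  conv_i := F.convA_iA
  S_mul := F.SA_mul
  S_conv := F.SA_convA
  conv_one := F.convA_one
  s_mul_conv := F.whiskerRight_mul_convA
  conv_mul_s := F.convA_mul_whiskerRight
  symm_S_s_mul_conv_eq l a b := by
    change F.convA (F.SAInv (l.asHom ▷ F.bar) * a) b = _
    rw [SAInv_whiskerRight]
    exact F.convA_whiskerLeft_mu_mul l a b
  φ_s_mul := F.phiL_whiskerRight_mul
  φ_i := F.phiL_iA
  mul_i := F.mul_iA
  φ_conv_mul := F.phiL_convA_mul
  conv_mul_mul := h.convA_mul_mul

namespace IsQuasiBasis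

variable (h : F.IsQuasiBasis y x)

theorem isDualBasis {m : ℕ} {y' x' : Fin m → F.A} (h' : F.IsQuasiBasis y' x') :
    h.doubleRing.IsDualBasis y' x' :=
  h'.doubleRing.isDualBasis

theorem isHopfA : F.IsHopfA (h.doubleRing.hopf F.nuEquiv) where
  left_s l := rfl
  left_t l := F.SAInv_whiskerRight l
  left_γ n y x h' a :=
    ⟨h.doubleRing.left_γ_eq_conv_tmul (h.isDualBasis h') a,
      h.doubleRing.left_γ_eq_tmul_conv (h.isDualBasis h') a⟩
  left_π a := rfl
  right_s r := (F.SA_whiskerRight (F.nuInv r)).trans (by rw [nu_nuInv])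
  right_t r := rfl
  right_γ n y x h' a :=
    ⟨h.doubleRing.right_γ_eq_conv_tmul F.nuEquiv (h.isDualBasis h') a,
      h.doubleRing.right_γ_eq_tmul_conv F.nuEquiv (h.isDualBasis h') a⟩
  right_π a := rfl
  antipode a := rfl

/-- The double ring on `B = End(ῑ × ι)`: the double ring on `A` with the two products exchanged. -/
noncomputable abbrev dualDoubleRing : FrobeniusDoubleRing F.B F.R :=
  h.doubleRing.dual F.nuEquiv (F := F.fourierEquiv) F.fourier_convA

theorem dualDoubleRing_S (b : F.B) : h.dualDoubleRing.S b = F.SB b :=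
  congrArg (fun c => F.fourier (F.fourierDotInv c)) (F.fourier_fourierInv b)

theorem isHopfB : F.IsHopfB (h.dualDoubleRing.hopf (h.doubleRing.dualBase F.nuEquiv)) where
  left_s r := (F.fourier_iA_mul_whiskerRight (F.nuInv r)).trans (by rw [nu_nuInv])
  left_t r := calc
    h.dualDoubleRing.S.symm (F.fourier (F.iA * F.whiskerRightBar (F.nuInv r)))
      = F.fourier (F.whiskerRightBar (F.nuInv r) * F.iA) :=
        (h.doubleRing.dual_symm_S F.nuEquiv _ _).trans
          (congrArg F.fourier (h.doubleRing.symm_S_i_mul_s _))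
    _ = F.bar ◁ (F.nuInv r).asHom := F.fourier_whiskerRight_mul_iA (F.nuInv r)
  left_γ n y x h' b := by
    simp only [convB_eq_fourier]
    exact ⟨h.doubleRing.dual_left_γ_eq_conv_tmul F.nuEquiv _ (h.isDualBasis h') b,
      h.doubleRing.dual_left_γ_eq_tmul_conv F.nuEquiv _ (h.isDualBasis h') b⟩
  left_π := F.fourierEquiv.surjective.forall.2 fun a =>
    (h.doubleRing.dual_left_π F.nuEquiv _ a).trans
      (congrArg (fun c => F.nu (F.phiL c)) (F.fourierInv_fourier a).symm)
  right_s l := (h.doubleRing.dual_S_s_dualBase F.nuEquiv _ l).trans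
    (F.fourier_whiskerRight_mul_iA l)
  right_t l := calc
    h.dualDoubleRing.s ((h.doubleRing.dualBase F.nuEquiv).symm (.op l))
      = F.fourierEquiv (h.doubleRing.i * h.doubleRing.S.symm (h.doubleRing.s l)) :=
        h.doubleRing.dual_s_dualBase F.nuEquiv _ l
    _ = F.fourierEquiv (h.doubleRing.i *
          h.doubleRing.S (h.doubleRing.s (F.nuInv (F.mu l)))) := by
        congr 2
        exact (F.SAInv_whiskerRight l).trans
          ((F.SA_whiskerRight (F.nuInv (F.mu l))).trans (by rw [nu_nuInv])).symm
    _ = F.fourier (F.iA * End.of ((F.nuInv (F.mu l)).asHom ▷ F.bar)) :=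
        congrArg F.fourier (h.doubleRing.i_mul_S_s _)
    _ = (F.mu l).asHom ▷ ι := (F.fourier_iA_mul_whiskerRight _).trans (by rw [nu_nuInv])
  right_γ n y x h' b := by
    simp only [convB_eq_fourier, ← fourier_SAInv]
    exact ⟨h.doubleRing.dual_right_γ_eq_conv_tmul F.nuEquiv _ _ (h.isDualBasis h') b,
      h.doubleRing.dual_right_γ_eq_tmul_conv F.nuEquiv _ _ (h.isDualBasis h') b⟩
  right_π := F.fourierEquiv.surjective.forall.2 fun a =>
    h.doubleRing.dual_right_π F.nuEquiv _ a
  antipode := h.dualDoubleRing_S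

/-- The ring isomorphism `α^*` from `B` to the dual of `A`. -/
noncomputable def alphaStar : F.B ≃+* (h.doubleRing.right F.nuEquiv).Dual :=
  FrobeniusDoubleRing.modelEquiv (D := h.doubleRing) (F := F.fourierEquiv) F.fourier_convA
    (h.doubleRing.functionalEquiv_conv F.nuEquiv)

theorem alphaStar_apply (b : F.B) (a : F.A) :
    h.alphaStar b a = F.nu (F.phiL (F.SAInv a * F.fourierInv b)) := rfl

end IsQuasiBasis

end FrobeniusData

end Additive

theorem mainTheorem3_general {C : Type u} [Bicategory.{w, v} C] [∀ a b : C, Preadditive (a ⟶ b)]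
    [PreadditiveBicategory C] {X Y : C} {ι : X ⟶ Y} (F : FrobeniusData ι)
    (hF : ∃ (n : ℕ) (y x : Fin n → F.A), F.IsQuasiBasis y x) :
    ∃ (𝒜 : HopfAlgebroid F.A F.L F.R) (ℬ : HopfAlgebroid F.B F.R F.L),
      F.IsHopfA 𝒜 ∧ F.IsHopfB ℬ ∧
      ∃ (hi : 𝒜.IsNondegenerateIntegral F.iA) (𝒟 : HopfAlgebroid 𝒜.right.Dual F.R F.L),
        HopfAlgebroid.IsDual hi 𝒟 ∧
        ∃ α : F.B →+* 𝒜.right.Dual,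
          (∀ b a, α b a = F.nu (F.phiL (F.SAInv a * F.fourierInv b))) ∧
          ℬ.IsStrictIso 𝒟 α (RingHom.id F.R) := by
  obtain ⟨n, y, x, h⟩ := hF
  exact ⟨_, _, h.isHopfA, h.isHopfB, h.doubleRing.isNondegenerateIntegral F.nuEquiv, _,
    h.doubleRing.isDual F.nuEquiv _, h.alphaStar, h.alphaStar_apply,
    h.doubleRing.modelEquiv_isStrictIso F.nuEquiv _ _ _⟩

theorem mainTheorem3 {C : Type u} [Bicategory.{w, v} C] [∀ a b : C, Preadditive (a ⟶ b)]
    [PreadditiveBicategory C] [∀ a b : C, HasFiniteBiproducts (a ⟶ b)]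
    {X Y : C} {ι : X ⟶ Y} (F : FrobeniusData ι) (hF : F.IsD2) :
    (∃ (n : ℕ) (y x : Fin n → F.A), F.IsQuasiBasis y x) ∧
    ∃ (𝒜 : HopfAlgebroid F.A F.L F.R) (ℬ : HopfAlgebroid F.B F.R F.L),
      F.IsHopfA 𝒜 ∧ F.IsHopfB ℬ ∧
      ∃ (hi : 𝒜.IsNondegenerateIntegral F.iA) (𝒟 : HopfAlgebroid 𝒜.right.Dual F.R F.L),
        HopfAlgebroid.IsDual hi 𝒟 ∧
        ∃ α : F.B →+* 𝒜.right.Dual,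
          (∀ b a, α b a = F.nu (F.phiL (F.SAInv a * F.fourierInv b))) ∧
          ℬ.IsStrictIso 𝒟 α (RingHom.id F.R) :=
  ⟨hF.exists_isQuasiBasis, mainTheorem3_general F hF.exists_isQuasiBasis⟩
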